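/- Let $k\ge 2$ and $m\ge 0$ be integers and put $n=m+k$. Let $(M^n,h)$ and $(L^k,g)$ be oriented smooth Riemannian manifolds without boundary of dimensions $n$ and $k$, with $M$ compact, and let $\alpha\in\Omega^{n-k}(M)$ be a closed calibration, that is, a smooth form with $d\alpha=0$ and $-1\le\alpha(e_1,\dots,e_{n-k})\le 1$ for all orthonormal $e_1,\dots,e_{n-k}\in T_xM$ and all $x\in M$. For a smooth map $u\colon M\to L$ let $|du_x|^2=\sum_i|du_x(e_i)|^2$ for an orthonormal basis $(e_i)$ of $T_xM$, and let the $k$-energy be $$E_k(u)=\frac{1}{(\sqrt k)^k}\int_M|du|^k\,\mathsf{vol}_M .$$ Call $u$ a Smith submersion with respect to $\alpha$ if at every point of $M$ $$\alpha\wedge u^*\mathsf{vol}_L=\frac{1}{(\sqrt k)^k}|du|^k\,\mathsf{vol}_M,\qquad u^*g=\frac1k|du|^2\,h^{(0,2)},$$ where $h^{(0,2)}_x(v,w)=h_x(Pv,Pw)$ and $P$ is the orthogonal projection of $T_xM$ onto $(\ker du_x)^\perp$. Call $u$ $k$-harmonic if it is a critical point of $E_k$: for every smooth variation $(u_t)_{|t|<\varepsilon}$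 of $u=u_0$ the function $t\mapsto E_k(u_t)$ is differentiable at $0$ with derivative $0$. Let $[\,\cdot\,]$ denote de Rham cohomology classes. Then: 1. For every smooth map $u\colon M\to L$, $$E_k(u)\ \ge\ \big([\alpha]\cup u^*[\mathsf{vol}_L]\big)\cdot[M]=\int_M\alpha\wedge u^*\mathsf{vol}_L ,$$ with equality if and only if $u$ is a Smith submersion with respect to $\alpha$. 2. The lower bound is topological: it depends only on the cohomology class $[\alpha]$ and the homotopy class of $u$; that is, $([\alpha]\cup u^*[\mathsf{vol}_L])\cdot[M]=([\alpha]\cup u'^*[\mathsf{vol}_L])\cdot[M]$ for homotopic smooth maps $u,u'\colon M\to L$. 3. If $u$ is a Smith submersion with respect to $\alpha$, then $E_k(u)\le E_k(u')$ for every smooth map $u'\colon M\to L$ homotopic to $u$, and $u$ is $k$-harmonic. -/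

import Mathlib

open Set Filter Topology Manifold Bundle
open scoped ContDiff

noncomputable section

namespace SmithMaps

/-! ### Differential forms on a smooth manifold

Throughout, an `n`-manifold is modelled on `EuclideanSpace ℝ (Fin n)` (no boundary). -/

section Forms

variable {n : ℕ} {M : Type*} [TopologicalSpace M] [ChartedSpace (EuclideanSpace ℝ (Fin n)) M]

/-- A (not necessarily continuous) differential `p`-form on the `n`-manifold `M`. -/
abbrev DForm (n : ℕ) (M : Type*) [TopologicalSpace M] [ChartedSpace (EuclideanSpace ℝ (Fin n)) M]
    (p : ℕ) : Type _ :=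
  ∀ x : M, TangentSpace (𝓡 n) x [⋀^Fin p]→L[ℝ] ℝ

instance addCommGroupDForm (p : ℕ) : AddCommGroup (DForm n M p) := Pi.addCommGroup

instance moduleDForm (p : ℕ) : Module ℝ (DForm n M p) := Pi.module _ _ _

/-- The differential at `y` of the inverse of the preferred chart around `x₀`. It sends the
standard basis to the coordinate frame `∂₁, …, ∂ₙ`. -/
def chartFrame (x₀ : M) (y : EuclideanSpace ℝ (Fin n)) :
    EuclideanSpace ℝ (Fin n) →L[ℝ] TangentSpace (𝓡 n) ((extChartAt (𝓡 n) x₀).symm y) :=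
  mfderiv 𝓘(ℝ, EuclideanSpace ℝ (Fin n)) (𝓡 n) (extChartAt (𝓡 n) x₀).symm y

/-- The differential at `x₀` of the preferred chart around `x₀`. -/
def chartDeriv (x₀ : M) : TangentSpace (𝓡 n) x₀ →L[ℝ] EuclideanSpace ℝ (Fin n) :=
  mfderiv (𝓡 n) 𝓘(ℝ, EuclideanSpace ℝ (Fin n)) (extChartAt (𝓡 n) x₀) x₀

/-- The coordinate expression of a form in the preferred chart around `x₀`, i.e. its pullback under
the inverse of the chart (meaningful on the target of the chart). -/
def inChart {p : ℕ} (φ : DForm n M p) (x₀ : M) (y : EuclideanSpace ℝ (Fin n)) :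
    EuclideanSpace ℝ (Fin n) [⋀^Fin p]→L[ℝ] ℝ :=
  (φ ((extChartAt (𝓡 n) x₀).symm y)).compContinuousLinearMap (chartFrame x₀ y)

/-- A form is smooth if all its coordinate expressions are. -/
def IsSmoothForm {p : ℕ} (φ : DForm n M p) : Prop :=
  ∀ x₀ : M, ContDiffOn ℝ ∞ (inChart φ x₀) (extChartAt (𝓡 n) x₀).target

/-- The exterior derivative, computed at `x` in the preferred chart around `x`. -/
def dForm {p : ℕ} (φ : DForm n M p) : DForm n M (p + 1) := fun x =>
  (extDeriv (inChart φ x) (extChartAt (𝓡 n) x x)).compContinuousLinearMap (chartDeriv x)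

lemma inChart_add {p : ℕ} (φ η : DForm n M p) (x₀ : M) :
    inChart (φ + η) x₀ = inChart φ x₀ + inChart η x₀ := by
  ext y v; rfl

lemma inChart_smul {p : ℕ} (c : ℝ) (φ : DForm n M p) (x₀ : M) :
    inChart (c • φ) x₀ = c • inChart φ x₀ := by
  ext y v; rfl

lemma inChart_zero {p : ℕ} (x₀ : M) : inChart (0 : DForm n M p) x₀ = 0 := by
  ext y v; rfl

lemma IsSmoothForm.add {p : ℕ} {φ η : DForm n M p} (hφ : IsSmoothForm φ) (hη : IsSmoothForm η) :
    IsSmoothForm (φ + η) := fun x₀ => by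
  rw [inChart_add]; exact (hφ x₀).add (hη x₀)

lemma IsSmoothForm.smul {p : ℕ} (c : ℝ) {φ : DForm n M p} (hφ : IsSmoothForm φ) :
    IsSmoothForm (c • φ) := fun x₀ => by
  rw [inChart_smul]; exact (hφ x₀).const_smul c

lemma isSmoothForm_zero {p : ℕ} : IsSmoothForm (0 : DForm n M p) := fun x₀ => by
  rw [inChart_zero]; exact contDiffOn_const

lemma IsSmoothForm.differentiableAt {p : ℕ} {φ : DForm n M p} (hφ : IsSmoothForm φ) (x : M) :
    DifferentiableAt ℝ (inChart φ x) (extChartAt (𝓡 n) x x) :=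
  ((hφ x).contDiffAt (extChartAt_target_mem_nhds x)).differentiableAt (by simp)

lemma dForm_add {p : ℕ} {φ η : DForm n M p} (hφ : IsSmoothForm φ) (hη : IsSmoothForm η) :
    dForm (φ + η) = dForm φ + dForm η := by
  funext x
  simp only [dForm, inChart_add, Pi.add_apply]
  rw [extDeriv_add (hφ.differentiableAt x) (hη.differentiableAt x)]
  rfl

lemma dForm_smul {p : ℕ} (c : ℝ) (φ : DForm n M p) : dForm (c • φ) = c • dForm φ := by
  funext x
  simp only [dForm, inChart_smul, Pi.smul_apply]
  rw [extDeriv_smul]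
  rfl

lemma dForm_zero {p : ℕ} : dForm (0 : DForm n M p) = 0 := by
  have h := dForm_smul (0 : ℝ) (0 : DForm n M p)
  rwa [zero_smul, zero_smul] at h

variable (n M) in
/-- The space of smooth closed `p`-forms. -/
def closedForms (p : ℕ) : Submodule ℝ (DForm n M p) where
  carrier := {φ | IsSmoothForm φ ∧ dForm φ = 0}
  add_mem' := fun h h' => ⟨h.1.add h'.1, by rw [dForm_add h.1 h'.1, h.2, h'.2, add_zero]⟩
  zero_mem' := ⟨isSmoothForm_zero, dForm_zero⟩
  smul_mem' := fun c _ h => ⟨h.1.smul c, by rw [dForm_smul, h.2, smul_zero]⟩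

variable (n M) in
/-- The space of exact `p`-forms, i.e. exterior derivatives of smooth `(p-1)`-forms
(only `0` when `p = 0`). -/
def exactForms : (p : ℕ) → Submodule ℝ (DForm n M p)
  | 0 => ⊥
  | p + 1 =>
    { carrier := {φ | ∃ β : DForm n M p, IsSmoothForm β ∧ dForm β = φ}
      add_mem' := by
        rintro _ _ ⟨β, hβ, rfl⟩ ⟨γ, hγ, rfl⟩
        exact ⟨β + γ, hβ.add hγ, dForm_add hβ hγ⟩
      zero_mem' := ⟨0, isSmoothForm_zero, dForm_zero⟩
      smul_mem' := by
        rintro c _ ⟨β, hβ, rfl⟩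
        exact ⟨c • β, hβ.smul c, dForm_smul c β⟩ }

variable (n M) in
/-- De Rham cohomology: smooth closed `p`-forms modulo exact ones. -/
abbrev DeRham (p : ℕ) : Type _ :=
  closedForms n M p ⧸ (exactForms n M p).submoduleOf (closedForms n M p)

open Classical in
/-- The cohomology class `[φ]` of a smooth closed form `φ` (by convention `0` for other forms). -/
def deRhamClass {p : ℕ} (φ : DForm n M p) : DeRham n M p :=
  if h : φ ∈ closedForms n M p then Submodule.Quotient.mk ⟨φ, h⟩ else 0

/-- A smooth closed form representing a cohomology class. -/
def representative {p : ℕ} (c : DeRham n M p) : DForm n M p :=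
  ((Submodule.Quotient.mk_surjective _ c).choose : closedForms n M p)

end Forms

/-! ### Wedge product, pullback -/

section Wedge

variable {V : Type*} [AddCommGroup V] [Module ℝ V] [TopologicalSpace V]

/-- The multilinear map `(v₁, …, vₘ₊ₖ) ↦ a (v₁, …, vₘ) * b (vₘ₊₁, …, vₘ₊ₖ)`. -/
def tensorForm {m k : ℕ} (a : V [⋀^Fin m]→L[ℝ] ℝ) (b : V [⋀^Fin k]→L[ℝ] ℝ) :
    ContinuousMultilinearMap ℝ (fun _ : Fin (m + k) => V) ℝ where
  toMultilinearMap :=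
    (LinearMap.mul' ℝ ℝ).compMultilinearMap
      ((MultilinearMap.domCoprod a.toAlternatingMap.toMultilinearMap
        b.toAlternatingMap.toMultilinearMap).domDomCongr finSumFinEquiv)
  cont := by
    have ha : Continuous fun v : Fin (m + k) → V => a (fun i => v (Fin.castAdd k i)) :=
      a.cont.comp (by fun_prop)
    have hb : Continuous fun v : Fin (m + k) → V => b (fun i => v (Fin.natAdd m i)) :=
      b.cont.comp (by fun_prop)
    exact (ha.mul hb).congr fun v => by
      simp [MultilinearMap.domCoprod_apply]

lemma tensorForm_apply {m k : ℕ} (a : V [⋀^Fin m]→L[ℝ] ℝ) (b : V [⋀^Fin k]→L[ℝ] ℝ)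
    (v : Fin (m + k) → V) :
    tensorForm a b v = a (fun i => v (Fin.castAdd k i)) * b (fun i => v (Fin.natAdd m i)) := by
  change LinearMap.mul' ℝ ℝ ((MultilinearMap.domCoprod a.toAlternatingMap.toMultilinearMap
        b.toAlternatingMap.toMultilinearMap).domDomCongr finSumFinEquiv v) = _
  simp [MultilinearMap.domCoprod_apply]

variable [IsTopologicalAddGroup V] [ContinuousConstSMul ℝ V]

/-- The wedge product of alternating forms,
`(a ∧ b)(v) = (1 / (m! k!)) ∑_σ sign(σ) a(v_σ(1), …, v_σ(m)) b(v_σ(m+1), …, v_σ(m+k))`. -/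
def wedge {m k : ℕ} (a : V [⋀^Fin m]→L[ℝ] ℝ) (b : V [⋀^Fin k]→L[ℝ] ℝ) :
    V [⋀^Fin (m + k)]→L[ℝ] ℝ :=
  ((m.factorial : ℝ) * (k.factorial : ℝ))⁻¹ •
    ContinuousMultilinearMap.alternatization (tensorForm a b)

end Wedge

section FormOperations

variable {n l : ℕ} {M : Type*} [TopologicalSpace M] [ChartedSpace (EuclideanSpace ℝ (Fin n)) M]
  {L : Type*} [TopologicalSpace L] [ChartedSpace (EuclideanSpace ℝ (Fin l)) L]

/-- The wedge product of differential forms. -/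
def wedgeForm {m k : ℕ} (a : DForm n M m) (b : DForm n M k) : DForm n M (m + k) :=
  fun x => wedge (a x) (b x)

/-- The pullback `u^* φ` of a differential form. -/
def pullbackForm {p : ℕ} (u : M → L) (φ : DForm l L p) : DForm n M p := fun x =>
  (φ (u x)).compContinuousLinearMap (mfderiv (𝓡 n) (𝓡 l) u x)

/-- The cup product `[a] ∪ [b] = [a ∧ b]` in de Rham cohomology. -/
def cup {m k : ℕ} (a : DeRham n M m) (b : DeRham n M k) : DeRham n M (m + k) :=
  deRhamClass (wedgeForm (representative a) (representative b))

/-- The pullback `u^* [φ] = [u^* φ]` in de Rham cohomology, for a smooth map `u`. -/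
def pullbackClass {p : ℕ} (u : M → L) (c : DeRham l L p) : DeRham n M p :=
  deRhamClass (pullbackForm u (representative c))

end FormOperations

/-! ### Orientations and integration -/

section Orientations

variable {n : ℕ} {M : Type*} [TopologicalSpace M] [ChartedSpace (EuclideanSpace ℝ (Fin n)) M]

/-- Given an orientation of every tangent space, the sign (`1` or `-1`) telling whether the
coordinate frame at `y` of the preferred chart around `x₀` is positively oriented. -/
def frameSign (o : ∀ x : M, Orientation ℝ (TangentSpace (𝓡 n) x) (Fin n)) (x₀ : M)
    (y : EuclideanSpace ℝ (Fin n)) : ℝ :=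
  SignType.sign ((o ((extChartAt (𝓡 n) x₀).symm y)).someVector
    (fun i => chartFrame x₀ y (EuclideanSpace.basisFun (Fin n) ℝ i)))

variable (n M) in
/-- An orientation of a manifold: an orientation of every tangent space that is locally constant
in charts. -/
structure ManifoldOrientation where
  orient : ∀ x : M, Orientation ℝ (TangentSpace (𝓡 n) x) (Fin n)
  locallyConstant : ∀ x₀ : M, ∀ y ∈ (extChartAt (𝓡 n) x₀).target,
    ∀ᶠ z in 𝓝 y, frameSign orient x₀ z = frameSign orient x₀ y

variable (n M) in
/-- A smooth partition of unity subordinate to the preferred charts. -/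
def chartPartition [IsManifold (𝓡 n) ∞ M] [T2Space M] [SigmaCompactSpace M] :
    SmoothPartitionOfUnity M (𝓡 n) M univ :=
  (SmoothPartitionOfUnity.exists_isSubordinate_chartAt_source (𝓡 n) M).choose

/-- The integral `∫_M φ` of a top degree form over a compact oriented manifold: the sum over a
subordinate partition of unity `ρ` of the integrals of `ρᵢ φ` in the charts. -/
def integral [IsManifold (𝓡 n) ∞ M] [T2Space M] [CompactSpace M]
    (o : ManifoldOrientation n M) (φ : DForm n M n) : ℝ :=
  ∑ᶠ i : M, ∫ y in (extChartAt (𝓡 n) i).target,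
    frameSign o.orient i y * chartPartition n M i ((extChartAt (𝓡 n) i).symm y) *
      inChart φ i y (EuclideanSpace.basisFun (Fin n) ℝ)

/-- The evaluation `c · [M]` of a top degree cohomology class on the fundamental class. -/
def evalFundamental [IsManifold (𝓡 n) ∞ M] [T2Space M] [CompactSpace M]
    (o : ManifoldOrientation n M) (c : DeRham n M n) : ℝ :=
  integral o (representative c)

end Orientations

/-! ### Riemannian notions -/

section Riemannian

variable {n l : ℕ} {M : Type*} [TopologicalSpace M] [ChartedSpace (EuclideanSpace ℝ (Fin n)) M]
  [RiemannianBundle (fun x : M => TangentSpace (𝓡 n) x)]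
  {L : Type*} [TopologicalSpace L] [ChartedSpace (EuclideanSpace ℝ (Fin l)) L]
  [RiemannianBundle (fun x : L => TangentSpace (𝓡 l) x)]

instance finiteDimensional_tangentSpace (x : M) : FiniteDimensional ℝ (TangentSpace (𝓡 n) x) :=
  inferInstanceAs (FiniteDimensional ℝ (EuclideanSpace ℝ (Fin n)))

instance fact_finrank_tangentSpace (x : M) :
    Fact (Module.finrank ℝ (TangentSpace (𝓡 n) x) = n) :=
  ⟨(finrank_euclideanSpace_fin : Module.finrank ℝ (EuclideanSpace ℝ (Fin n)) = n)⟩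

/-- The Riemannian volume form. -/
def volForm (o : ManifoldOrientation n M) : DForm n M n := fun x =>
  (o.orient x).volumeForm.mkContinuous 1 fun v => by
    rw [one_mul]; exact (o.orient x).abs_volumeForm_apply_le v

/-- A calibration: `-1 ≤ α(e₁, …, eₘ) ≤ 1` for all orthonormal tangent vectors `e₁, …, eₘ`. -/
def IsCalibration {m : ℕ} (α : DForm n M m) : Prop :=
  ∀ (x : M) (e : Fin m → TangentSpace (𝓡 n) x), Orthonormal ℝ e → |α x e| ≤ 1

variable (n l) in
/-- The norm `|du_x|`, with `|du_x|² = ∑ᵢ |du_x(eᵢ)|²` for an orthonormal basis `eᵢ`. -/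
def normDu (u : M → L) (x : M) : ℝ :=
  Real.sqrt (∑ i, ‖mfderiv (𝓡 n) (𝓡 l) u x (stdOrthonormalBasis ℝ (TangentSpace (𝓡 n) x) i)‖ ^ 2)

variable (l) in
/-- The `k`-energy `E_k(u) = (√k)^{-k} ∫_M |du|^k vol_M` of a map into an `l`-manifold. -/
def energy [IsManifold (𝓡 n) ∞ M] [T2Space M] [CompactSpace M]
    (o : ManifoldOrientation n M) (k : ℕ) (u : M → L) : ℝ :=
  (Real.sqrt k ^ k)⁻¹ * integral o (fun x => normDu n l u x ^ k • volForm o x)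

variable (l) in
/-- `u` is `k`-harmonic: it is a critical point of the `k`-energy, i.e. for every smooth variation
`u_t`, `t ∈ (-ε, ε)`, of `u = u_0`, the energy `E_k(u_t)` has derivative `0` at `t = 0`. -/
def IsKHarmonic [IsManifold (𝓡 n) ∞ M] [T2Space M] [CompactSpace M]
    (o : ManifoldOrientation n M) (k : ℕ) (u : M → L) : Prop :=
  ∀ ε > 0, ∀ F : ℝ → M → L,
    ContMDiffOn (𝓘(ℝ, ℝ).prod (𝓡 n)) (𝓡 l) ∞ (fun p : ℝ × M => F p.1 p.2)
      (Ioo (-ε) ε ×ˢ univ) →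
    F 0 = u → HasDerivAt (fun t => energy l o k (F t)) 0 0

/-- The pointwise equations of a Smith submersion `u : Mⁿ → Lᵏ`, where `n = m + k`, with respect
to an `m`-form `α`:
`α ∧ u^* vol_L = (√k)^{-k} |du|^k vol_M` and `u^* g = k⁻¹ |du|² h^{(0,2)}`, where
`h^{(0,2)}(v, w)` is the inner product of the projections of `v`, `w` to `(ker du_x)^⊥`. -/
structure IsSmithSubmersion {m k : ℕ}
    {M : Type*} [TopologicalSpace M] [ChartedSpace (EuclideanSpace ℝ (Fin (m + k))) M]
    [RiemannianBundle (fun x : M => TangentSpace (𝓡 (m + k)) x)]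
    {L : Type*} [TopologicalSpace L] [ChartedSpace (EuclideanSpace ℝ (Fin k)) L]
    [RiemannianBundle (fun x : L => TangentSpace (𝓡 k) x)]
    (oM : ManifoldOrientation (m + k) M) (oL : ManifoldOrientation k L)
    (α : DForm (m + k) M m) (u : M → L) : Prop where
  contMDiff : ContMDiff (𝓡 (m + k)) (𝓡 k) ∞ u
  wedge_eq : ∀ x : M, wedgeForm α (pullbackForm u (volForm oL)) x =
    ((Real.sqrt k ^ k)⁻¹ * normDu (m + k) k u x ^ k) • volForm oM x
  horizontally_conformal : ∀ (x : M) (v w : TangentSpace (𝓡 (m + k)) x),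
    inner ℝ (mfderiv (𝓡 (m + k)) (𝓡 k) u x v) (mfderiv (𝓡 (m + k)) (𝓡 k) u x w) =
      (k : ℝ)⁻¹ * normDu (m + k) k u x ^ 2 *
        inner ℝ (((mfderiv (𝓡 (m + k)) (𝓡 k) u x).ker)ᗮ.starProjection v)
          (((mfderiv (𝓡 (m + k)) (𝓡 k) u x).ker)ᗮ.starProjection w)

/-- The number `([α] ∪ u^*[vol_L]) · [M]`. -/
def topologicalEnergy {m k : ℕ}
    {M : Type*} [TopologicalSpace M] [ChartedSpace (EuclideanSpace ℝ (Fin (m + k))) M]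
    [IsManifold (𝓡 (m + k)) ∞ M] [T2Space M] [CompactSpace M]
    {L : Type*} [TopologicalSpace L] [ChartedSpace (EuclideanSpace ℝ (Fin k)) L]
    [RiemannianBundle (fun x : L => TangentSpace (𝓡 k) x)]
    (oM : ManifoldOrientation (m + k) M) (oL : ManifoldOrientation k L)
    (α : DForm (m + k) M m) (u : M → L) : ℝ :=
  evalFundamental oM (cup (deRhamClass α) (pullbackClass u (deRhamClass (volForm oL))))

end Riemannian

end SmithMaps

end

/-! The theorem is a calibration argument. At each point `α ∧ u^*vol_L = c vol_M` with `|c| ≤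
k^(-k/2) |du|^k` (`calibrated_wedge`). If `du` is not onto, the pullback vanishes. Otherwise take an
orthonormal basis of `ker du`, together with an orthonormal basis `f_j` of its complement that
diagonalizes `du^T du`. On this basis the wedge reduces to `α(ker basis) · vol_L(du f_1, …, du
f_k)`, which the calibration condition and orthogonality bound by `∏ |du f_j|`; the inequality of
arithmetic and geometric means applied to `|du f_j|²` finishes. Equality makes all `|du f_j|` equal,
which is horizontal conformality.

Integration gives `∫ α ∧ u^*vol_L ≤ E_k(u)`. In the equality case the difference is a continuous
nonnegative density of integral zero, so equality holds at every point (`integral_wedge_le_energy`).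
The left side is the cohomological number because representatives differ by exact forms, which
contribute nothing by the Leibniz rule and Stokes' theorem (`topologicalEnergy_eq`).

Homotopy invariance avoids smoothing the homotopy. Near any `q` in `L` the top degree form `vol_L`
equals `dη` for a globally defined smooth `η`. Replacing `vol_L` by `vol_L - dη` keeps the integral
and kills the integrand where `u` is near `q`, so modifying `u` inside a small open set of `L`
changes nothing (`exists_nhds_integral_wedge_pullback_eq`). Two smooth maps close to the same
continuous map are joined by finitely many such modifications, and smooth maps are dense, so the
integral extends to a locally constant function on `C(M, L)`, which is constant along the path given
by a homotopy (`eq_of_homotopic_of_local`).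

A Smith submersion attains the homotopy-invariant bound, hence minimizes energy in its class. For `k
≥ 2` the energy is differentiable along variations (`exists_hasDerivAt_energy`), so at this minimum
its derivative is zero. -/

set_option linter.unusedSectionVars false

noncomputable section

namespace SmithMaps

/-! ### Functions valued in alternating maps -/

section AlternatingSmooth

variable {E X : Type*} [NormedAddCommGroup E] [NormedSpace ℝ E] [FiniteDimensional ℝ E]
  [NormedAddCommGroup X] [NormedSpace ℝ X] {p : ℕ}

/-- Alternating maps on a finite-dimensional space are recovered linearly and continuously from
their values on tuples of basis vectors. -/
lemma exists_reconstruction {ι : Type*} [Fintype ι] (b : Module.Basis ι ℝ E) (p : ℕ) :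
    ∃ g : ((Fin p → ι) → ℝ) →L[ℝ] (E [⋀^Fin p]→L[ℝ] ℝ),
      ∀ a : E [⋀^Fin p]→L[ℝ] ℝ, g (fun r => a (fun i => b (r i))) = a := by
  let j : (E [⋀^Fin p]→L[ℝ] ℝ) →ₗ[ℝ] ((Fin p → ι) → ℝ) :=
    { toFun := fun a r => a (fun i => b (r i))
      map_add' := fun _ _ => rfl
      map_smul' := fun _ _ => rfl }
  have hj : LinearMap.ker j = ⊥ := by
    rw [LinearMap.ker_eq_bot]
    intro a a' h
    have : a.toAlternatingMap = a'.toAlternatingMap :=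
      Module.Basis.ext_alternating b fun v _ => congrFun h v
    ext v
    exact congrArg (fun t : E [⋀^Fin p]→ₗ[ℝ] ℝ => t v) this
  obtain ⟨g, hg⟩ := LinearMap.exists_leftInverse_of_injective j hj
  exact ⟨LinearMap.toContinuousLinearMap g, fun a => LinearMap.congr_fun hg a⟩

/-- `f` is a fixed continuous linear map applied to finitely many of its values on basis tuples, so
smoothness may be tested on constant arguments. -/
lemma contDiffWithinAt_alternating {f : X → E [⋀^Fin p]→L[ℝ] ℝ} {s : Set X} {x : X} {r : ℕ∞ω}
    (h : ∀ v : Fin p → E, ContDiffWithinAt ℝ r (fun y => f y v) s x) :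
    ContDiffWithinAt ℝ r f s x := by
  obtain ⟨g, hg⟩ := exists_reconstruction (Module.finBasis ℝ E) p
  have : f = fun y => g (fun r => f y (fun i => Module.finBasis ℝ E (r i))) := by
    funext y; rw [hg]
  rw [this]
  exact g.contDiff.comp_contDiffWithinAt (contDiffWithinAt_pi.2 fun r => h _)

lemma contDiffAt_alternating {f : X → E [⋀^Fin p]→L[ℝ] ℝ} {x : X} {r : ℕ∞ω}
    (h : ∀ v : Fin p → E, ContDiffAt ℝ r (fun y => f y v) x) : ContDiffAt ℝ r f x :=
  contDiffWithinAt_alternating h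

lemma contDiffWithinAt_alternating_apply {f : X → E [⋀^Fin p]→L[ℝ] ℝ} {w : Fin p → X → E}
    {s : Set X} {x : X} {r : ℕ∞ω} (hf : ContDiffWithinAt ℝ r f s x)
    (hw : ∀ i, ContDiffWithinAt ℝ r (w i) s x) :
    ContDiffWithinAt ℝ r (fun y => f y (fun i => w i y)) s x := by
  have : (fun y => f y (fun i => w i y)) = fun y => (f y).1 (fun i => w i y) := rfl
  classical
  let b := Module.finBasis ℝ E
  -- Expanding every argument in a basis by multilinearity leaves products of coordinate functions
  -- with values of `f` on fixed tuples.
  have key : (fun y => f y (fun i => w i y)) = fun y => ∑ q : Fin p → Fin (Module.finrank ℝ E),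
      (∏ i, b.equivFunL (w i y) (q i)) * f y (fun i => b (q i)) := by
    funext y
    conv_lhs => rw [show (fun i => w i y) = fun i => ∑ a, b.equivFunL (w i y) a • b a from
      funext fun i => (b.sum_equivFun (w i y)).symm]
    exact ((f y).toMultilinearMap.map_sum _).trans
      (Finset.sum_congr rfl fun q _ => (f y).toMultilinearMap.map_smul_univ _ _)
  rw [key]
  refine ContDiffWithinAt.sum fun q _ => ContDiffWithinAt.mul ?_ ?_
  · refine contDiffWithinAt_prod fun i _ => ?_
    exact contDiffWithinAt_pi.1 (b.equivFunL.contDiff.comp_contDiffWithinAt (hw i)) (q i)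
  · exact (ContinuousAlternatingMap.apply ℝ E ℝ (fun i =>
      b (q i))).contDiff.comp_contDiffWithinAt hf

lemma contDiffAt_alternating_apply {f : X → E [⋀^Fin p]→L[ℝ] ℝ} {w : Fin p → X → E}
    {x : X} {r : ℕ∞ω} (hf : ContDiffAt ℝ r f x) (hw : ∀ i, ContDiffAt ℝ r (w i) x) :
    ContDiffAt ℝ r (fun y => f y (fun i => w i y)) x :=
  contDiffWithinAt_alternating_apply (s := univ) hf hw

lemma contDiffAt_alternating_comp {E' : Type*} [NormedAddCommGroup E'] [NormedSpace ℝ E']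
    [FiniteDimensional ℝ E'] {f : X → E [⋀^Fin p]→L[ℝ] ℝ} {A : X → E' →L[ℝ] E} {x : X} {r : ℕ∞ω}
    (hf : ContDiffAt ℝ r f x) (hA : ContDiffAt ℝ r A x) :
    ContDiffAt ℝ r (fun y => (f y).compContinuousLinearMap (A y)) x :=
  contDiffAt_alternating fun v =>
    contDiffAt_alternating_apply (w := fun i y => A y (v i)) hf
      fun _ => hA.clm_apply contDiffAt_const

end AlternatingSmooth

/-! ### Coordinate expressions of forms -/

section Coordinates

variable {n l : ℕ} {M : Type*} [TopologicalSpace M] [ChartedSpace (EuclideanSpace ℝ (Fin n)) M]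
  {L : Type*} [TopologicalSpace L] [ChartedSpace (EuclideanSpace ℝ (Fin l)) L]

/-- Tangent spaces at provably equal points are distinct types that both unfold to the Euclidean
model space. Stating the equality there avoids transport along `x = x'`. -/
lemma form_congr {p : ℕ} (φ : DForm n M p) {x x' : M} (h : x = x')
    (v v' : Fin p → EuclideanSpace ℝ (Fin n)) (hv : v = v') :
    (φ x : EuclideanSpace ℝ (Fin n) [⋀^Fin p]→L[ℝ] ℝ) v =
      (φ x' : EuclideanSpace ℝ (Fin n) [⋀^Fin p]→L[ℝ] ℝ) v' := by
  subst h hv; rfl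

lemma inChart_smul_fun {p : ℕ} (f : M → ℝ) (φ : DForm n M p) (i : M)
    (y : EuclideanSpace ℝ (Fin n)) :
    inChart (fun x => f x • φ x) i y = f ((extChartAt (𝓡 n) i).symm y) • inChart φ i y := by
  ext v; rfl

variable [IsManifold (𝓡 n) ∞ M] [IsManifold (𝓡 l) ∞ L]

/-- The regularity required by `extDeriv_pullback`, where symmetry of second derivatives enters. -/
lemma two_le_smooth : minSmoothness ℝ 2 ≤ (∞ : ℕ∞ω) := by
  rw [minSmoothness_of_isRCLikeNormedField]
  exact WithTop.coe_le_coe.2 le_top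

/-- The coordinate expression of a map between manifolds. -/
def inCharts (i : M) (j : L) (u : M → L) : EuclideanSpace ℝ (Fin n) → EuclideanSpace ℝ (Fin l) :=
  fun y => extChartAt (𝓡 l) j (u ((extChartAt (𝓡 n) i).symm y))

lemma contMDiffAt_symm (i : M) {y : EuclideanSpace ℝ (Fin n)}
    (hy : y ∈ (extChartAt (𝓡 n) i).target) :
    ContMDiffAt 𝓘(ℝ, EuclideanSpace ℝ (Fin n)) (𝓡 n) ∞ (extChartAt (𝓡 n) i).symm y :=
  (contMDiffOn_extChartAt_symm i).contMDiffAt ((isOpen_extChartAt_target i).mem_nhds hy)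

lemma mdifferentiableAt_symm (i : M) {y : EuclideanSpace ℝ (Fin n)}
    (hy : y ∈ (extChartAt (𝓡 n) i).target) :
    MDifferentiableAt 𝓘(ℝ, EuclideanSpace ℝ (Fin n)) (𝓡 n) (extChartAt (𝓡 n) i).symm y :=
  (contMDiffAt_symm i hy).mdifferentiableAt (by simp)

lemma contMDiffAt_chart (i : M) {x : M} (hx : x ∈ (extChartAt (𝓡 n) i).source) :
    ContMDiffAt (𝓡 n) 𝓘(ℝ, EuclideanSpace ℝ (Fin n)) ∞ (extChartAt (𝓡 n) i) x :=
  contMDiffAt_extChartAt' (by rwa [extChartAt_source] at hx)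

lemma mdifferentiableAt_chart (i : M) {x : M} (hx : x ∈ (extChartAt (𝓡 n) i).source) :
    MDifferentiableAt (𝓡 n) 𝓘(ℝ, EuclideanSpace ℝ (Fin n)) (extChartAt (𝓡 n) i) x :=
  (contMDiffAt_chart i hx).mdifferentiableAt (by simp)

lemma contDiffAt_inCharts {i : M} {j : L} {u : M → L} {y : EuclideanSpace ℝ (Fin n)}
    (hy : y ∈ (extChartAt (𝓡 n) i).target)
    (hu : ContMDiffAt (𝓡 n) (𝓡 l) ∞ u ((extChartAt (𝓡 n) i).symm y))
    (hj : u ((extChartAt (𝓡 n) i).symm y) ∈ (extChartAt (𝓡 l) j).source) :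
    ContDiffAt ℝ ∞ (inCharts (n := n) (l := l) i j u) y := by
  rw [← contMDiffAt_iff_contDiffAt]
  have h : ContMDiffAt 𝓘(ℝ, EuclideanSpace ℝ (Fin n)) (𝓡 l) ∞ (u ∘ (extChartAt (𝓡 n) i).symm) y :=
    ContMDiffAt.comp y hu (contMDiffAt_symm i hy)
  exact ContMDiffAt.comp (g := extChartAt (𝓡 l) j) (f := u ∘ (extChartAt (𝓡 n) i).symm) y
    (contMDiffAt_chart j hj) h

/-- The chain rule: the differential of `u` in coordinate frames is the derivative of its
coordinate expression. -/
lemma mfderiv_chartFrame {i : M} {j : L} {u : M → L} {y : EuclideanSpace ℝ (Fin n)}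
    (hy : y ∈ (extChartAt (𝓡 n) i).target)
    (hu : MDifferentiableAt (𝓡 n) (𝓡 l) u ((extChartAt (𝓡 n) i).symm y))
    (hj : u ((extChartAt (𝓡 n) i).symm y) ∈ (extChartAt (𝓡 l) j).source)
    (v : EuclideanSpace ℝ (Fin n)) :
    (mfderiv (𝓡 n) (𝓡 l) u ((extChartAt (𝓡 n) i).symm y) (chartFrame i y v) :
      EuclideanSpace ℝ (Fin l)) =
      chartFrame j (inCharts i j u y) (fderiv ℝ (inCharts i j u) y v) := by
  have h1 : MDifferentiableAt 𝓘(ℝ, EuclideanSpace ℝ (Fin n)) (𝓡 l)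
      (u ∘ (extChartAt (𝓡 n) i).symm) y := hu.comp y (mdifferentiableAt_symm i hy)
  have h2 : MDifferentiableAt 𝓘(ℝ, EuclideanSpace ℝ (Fin n)) 𝓘(ℝ, EuclideanSpace ℝ (Fin l))
      (inCharts i j u) y :=
    MDifferentiableAt.comp y (mdifferentiableAt_chart j hj) h1
  have h3 : inCharts i j u y ∈ (extChartAt (𝓡 l) j).target := (extChartAt (𝓡 l) j).map_source hj
  have h4 : u ∘ (extChartAt (𝓡 n) i).symm =ᶠ[𝓝 y]
      (extChartAt (𝓡 l) j).symm ∘ inCharts i j u := by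
    have := h1.continuousAt.preimage_mem_nhds ((isOpen_extChartAt_source (I := 𝓡 l) j).mem_nhds hj)
    filter_upwards [this] with z hz
    exact ((extChartAt (𝓡 l) j).left_inv hz).symm
  have e1 := mfderiv_comp y hu (mdifferentiableAt_symm i hy)
  have e2 := mfderiv_comp y (mdifferentiableAt_symm j h3) h2
  have e3 := h4.mfderiv_eq (I := 𝓘(ℝ, EuclideanSpace ℝ (Fin n))) (I' := 𝓡 l)
  rw [mfderiv_eq_fderiv] at e2
  have a1 := DFunLike.congr_fun e1 v
  have a2 := DFunLike.congr_fun e2 v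
  have a3 := DFunLike.congr_fun e3 v
  exact a1.symm.trans (a3.trans a2)

/-- The coordinate expression of a pullback. -/
lemma inChart_pullbackForm {p : ℕ} {i : M} {j : L} {u : M → L} (φ : DForm l L p)
    {y : EuclideanSpace ℝ (Fin n)} (hy : y ∈ (extChartAt (𝓡 n) i).target)
    (hu : MDifferentiableAt (𝓡 n) (𝓡 l) u ((extChartAt (𝓡 n) i).symm y))
    (hj : u ((extChartAt (𝓡 n) i).symm y) ∈ (extChartAt (𝓡 l) j).source) :
    inChart (pullbackForm u φ) i y =
      (inChart φ j (inCharts i j u y)).compContinuousLinearMap (fderiv ℝ (inCharts i j u) y) := by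
  ext v
  refine form_congr φ ((extChartAt (𝓡 l) j).left_inv hj).symm _ _ ?_
  funext a
  exact mfderiv_chartFrame hy hu hj (v a)

/-- Turns every result on pullbacks into one on changes of charts, by taking `u = id` with different
charts at source and target. -/
lemma pullbackForm_id {p : ℕ} (φ : DForm n M p) : pullbackForm id φ = φ := by
  funext x
  ext v
  simp only [pullbackForm, id_eq, ContinuousAlternatingMap.compContinuousLinearMap_apply]
  rw [mfderiv_id]
  rfl

/-- Change of coordinates. -/
lemma inChart_transition {p : ℕ} (i j : M) (φ : DForm n M p)
    {y : EuclideanSpace ℝ (Fin n)} (hy : y ∈ (extChartAt (𝓡 n) i).target)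
    (hj : (extChartAt (𝓡 n) i).symm y ∈ (extChartAt (𝓡 n) j).source) :
    inChart φ i y = (inChart φ j (inCharts i j (id : M → M) y)).compContinuousLinearMap
      (fderiv ℝ (inCharts i j (id : M → M)) y) := by
  have := inChart_pullbackForm (u := (id : M → M)) φ hy mdifferentiableAt_id hj
  rwa [pullbackForm_id] at this

lemma eventually_mem_chart (i : M) {y : EuclideanSpace ℝ (Fin n)}
    (hy : y ∈ (extChartAt (𝓡 n) i).target) {u : M → L}
    (hu : ContinuousAt u ((extChartAt (𝓡 n) i).symm y)) {s : Set L} (hs : IsOpen s)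
    (h : u ((extChartAt (𝓡 n) i).symm y) ∈ s) :
    ∀ᶠ z in 𝓝 y, z ∈ (extChartAt (𝓡 n) i).target ∧ u ((extChartAt (𝓡 n) i).symm z) ∈ s :=
  ((isOpen_extChartAt_target i).eventually_mem hy).and
    ((ContinuousAt.comp hu (mdifferentiableAt_symm i hy).continuousAt).preimage_mem_nhds
      (hs.mem_nhds h))

lemma IsSmoothForm.contDiffAt {p : ℕ} {φ : DForm n M p} (hφ : IsSmoothForm φ) (i : M)
    {y : EuclideanSpace ℝ (Fin n)} (hy : y ∈ (extChartAt (𝓡 n) i).target) :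
    ContDiffAt ℝ ∞ (inChart φ i) y :=
  (hφ i).contDiffAt ((isOpen_extChartAt_target i).mem_nhds hy)

lemma eventually_inChart_pullbackForm {p : ℕ} {i : M} {j : L} {u : M → L} (φ : DForm l L p)
    (hu : ContMDiff (𝓡 n) (𝓡 l) ∞ u)
    {y : EuclideanSpace ℝ (Fin n)} (hy : y ∈ (extChartAt (𝓡 n) i).target)
    (hj : u ((extChartAt (𝓡 n) i).symm y) ∈ (extChartAt (𝓡 l) j).source) :
    inChart (pullbackForm u φ) i =ᶠ[𝓝 y] fun z =>
      (inChart φ j (inCharts i j u z)).compContinuousLinearMap (fderiv ℝ (inCharts i j u) z) := by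
  filter_upwards [eventually_mem_chart i hy hu.continuous.continuousAt
    (isOpen_extChartAt_source j) hj] with z hz
  exact inChart_pullbackForm φ hz.1 ((hu _).mdifferentiableAt (by simp)) hz.2

lemma contDiffAt_inChart_pullbackForm {p : ℕ} {i : M} {j : L} {u : M → L} {φ : DForm l L p}
    (hu : ContMDiff (𝓡 n) (𝓡 l) ∞ u)
    {y : EuclideanSpace ℝ (Fin n)} (hy : y ∈ (extChartAt (𝓡 n) i).target)
    (hj : u ((extChartAt (𝓡 n) i).symm y) ∈ (extChartAt (𝓡 l) j).source)
    (hφ : ContDiffAt ℝ ∞ (inChart φ j) (inCharts i j u y)) :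
    ContDiffAt ℝ ∞ (inChart (pullbackForm u φ) i) y := by
  have h1 := contDiffAt_inCharts hy (hu _) hj
  refine ContDiffAt.congr_of_eventuallyEq ?_ (eventually_inChart_pullbackForm φ hu hy hj)
  exact contDiffAt_alternating_comp (hφ.comp y h1) (h1.fderiv_right (by simp))

lemma IsSmoothForm.pullback {p : ℕ} {u : M → L} (hu : ContMDiff (𝓡 n) (𝓡 l) ∞ u)
    {φ : DForm l L p} (hφ : IsSmoothForm φ) : IsSmoothForm (pullbackForm u φ : DForm n M p) :=
  fun i y hy => by
    have hj := mem_extChartAt_source (I := 𝓡 l) (u ((extChartAt (𝓡 n) i).symm y))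
    exact (contDiffAt_inChart_pullbackForm hu hy hj
      (hφ.contDiffAt _ ((extChartAt (𝓡 l) _).map_source hj))).contDiffWithinAt

/-- Smoothness of a form may be tested near each point in one chart. -/
lemma isSmoothForm_of_contDiffAt {p : ℕ} {φ : DForm n M p}
    (h : ∀ x : M, ∃ j : M, x ∈ (extChartAt (𝓡 n) j).source ∧
      ContDiffAt ℝ ∞ (inChart φ j) (extChartAt (𝓡 n) j x)) : IsSmoothForm φ := fun i y hy => by
  obtain ⟨j, hj, hd⟩ := h ((extChartAt (𝓡 n) i).symm y)
  have := contDiffAt_inChart_pullbackForm (u := (id : M → M)) contMDiff_id hy hj hd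
  rw [pullbackForm_id] at this
  exact this.contDiffWithinAt

/-- `dForm` at a point uses the preferred chart of that point. Comparison with another chart `i`
therefore brings in the derivative of the transition map. -/
lemma chartDeriv_chartFrame (i : M) {y : EuclideanSpace ℝ (Fin n)}
    (hy : y ∈ (extChartAt (𝓡 n) i).target) (v : EuclideanSpace ℝ (Fin n)) :
    chartDeriv ((extChartAt (𝓡 n) i).symm y) (chartFrame i y v) =
      fderiv ℝ (inCharts i ((extChartAt (𝓡 n) i).symm y) (id : M → M)) y v := by
  have h := mfderiv_comp y (mdifferentiableAt_chart ((extChartAt (𝓡 n) i).symm y)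
    (mem_extChartAt_source (I := 𝓡 n) ((extChartAt (𝓡 n) i).symm y))) (mdifferentiableAt_symm i hy)
  have h' : (extChartAt (𝓡 n) ((extChartAt (𝓡 n) i).symm y)) ∘ (extChartAt (𝓡 n) i).symm =
    inCharts i ((extChartAt (𝓡 n) i).symm y) (id : M → M) := rfl
  rw [h', mfderiv_eq_fderiv] at h
  exact (DFunLike.congr_fun h v).symm

/-- The exterior derivative can be computed in any chart. -/
lemma inChart_dForm {p : ℕ} {φ : DForm n M p} (hφ : IsSmoothForm φ) (i : M)
    {y : EuclideanSpace ℝ (Fin n)} (hy : y ∈ (extChartAt (𝓡 n) i).target) :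
    inChart (dForm φ) i y = extDeriv (inChart φ i) y := by
  set x := (extChartAt (𝓡 n) i).symm y with hx
  have hj := mem_extChartAt_source (I := 𝓡 n) x
  have e := eventually_inChart_pullbackForm (u := (id : M → M)) (j := x) φ contMDiff_id hy hj
  rw [pullbackForm_id] at e
  have h1 := contDiffAt_inCharts (u := (id : M → M)) (j := x) hy contMDiffAt_id hj
  -- Near `y` the expression in chart `i` is the pullback, under the transition map, of the
  -- expression in the preferred chart of `x`; the exterior derivative on vector spaces commutes
  -- with this pullback.
  rw [e.extDeriv_eq, extDeriv_pullback (f := inCharts (n := n) (l := n) i x (id : M → M)) (r := ∞)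
    (hφ.differentiableAt x) h1 two_le_smooth]
  ext v
  simp only [inChart, dForm, ContinuousAlternatingMap.compContinuousLinearMap_apply]
  congr 1
  funext a
  exact chartDeriv_chartFrame i hy (v a)

lemma chartDeriv_mfderiv {u : M → L} (hu : ContMDiff (𝓡 n) (𝓡 l) ∞ u) (x : M)
    (v : TangentSpace (𝓡 n) x) :
    chartDeriv (u x) (mfderiv (𝓡 n) (𝓡 l) u x v) =
      fderiv ℝ (inCharts x (u x) u) (extChartAt (𝓡 n) x x) (chartDeriv x v) := by
  have hx := mem_extChartAt_source (I := 𝓡 n) x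
  have hj := mem_extChartAt_source (I := 𝓡 l) (u x)
  have h0 : (extChartAt (𝓡 n) x).symm (extChartAt (𝓡 n) x x) = x := extChartAt_to_inv x
  have h1 := contDiffAt_inCharts (i := x) (j := u x) (u := u) (mem_extChartAt_target x)
    (hu _) (by rw [h0]; exact hj)
  have e1 := mfderiv_comp x (mdifferentiableAt_chart (u x) hj)
    ((hu x).mdifferentiableAt (by simp))
  have e2 := mfderiv_comp x (h1.differentiableAt (by simp)).mdifferentiableAt
    (mdifferentiableAt_chart x hx)
  have e3 : (extChartAt (𝓡 l) (u x)) ∘ u =ᶠ[𝓝 x] inCharts x (u x) u ∘ extChartAt (𝓡 n) x := by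
    filter_upwards [(isOpen_extChartAt_source (I := 𝓡 n) x).mem_nhds hx] with z hz
    simp only [Function.comp, inCharts]
    rw [(extChartAt (𝓡 n) x).left_inv hz]
  have e4 := e3.mfderiv_eq (I := 𝓡 n) (I' := 𝓘(ℝ, EuclideanSpace ℝ (Fin l)))
  rw [mfderiv_eq_fderiv] at e2
  exact (DFunLike.congr_fun e1 v).symm.trans
    ((DFunLike.congr_fun e4 v).trans (DFunLike.congr_fun e2 v))

/-- The exterior derivative commutes with pullbacks. -/
lemma dForm_pullbackForm {p : ℕ} {u : M → L} (hu : ContMDiff (𝓡 n) (𝓡 l) ∞ u)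
    {φ : DForm l L p} (hφ : IsSmoothForm φ) :
    dForm (pullbackForm u φ : DForm n M p) = pullbackForm u (dForm φ) := by
  funext x
  have hj := mem_extChartAt_source (I := 𝓡 l) (u x)
  have h0 : (extChartAt (𝓡 n) x).symm (extChartAt (𝓡 n) x x) = x := extChartAt_to_inv x
  have hj' : u ((extChartAt (𝓡 n) x).symm (extChartAt (𝓡 n) x x)) ∈
    (extChartAt (𝓡 l) (u x)).source := by rw [h0]; exact hj
  have e := eventually_inChart_pullbackForm φ hu (mem_extChartAt_target (I := 𝓡 n) x) hj'
  have h1 := contDiffAt_inCharts (mem_extChartAt_target (I := 𝓡 n) x) (hu _) hj'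
  have h2 : inCharts x (u x) u (extChartAt (𝓡 n) x x) = extChartAt (𝓡 l) (u x) (u x) := by
    simp only [inCharts, h0]
  have hd := hφ.differentiableAt (u x)
  rw [← h2] at hd
  unfold dForm
  rw [e.extDeriv_eq, extDeriv_pullback (r := ∞) hd h1 two_le_smooth, h2]
  ext v
  simp only [pullbackForm, ContinuousAlternatingMap.compContinuousLinearMap_apply]
  congr 1
  funext a
  exact (chartDeriv_mfderiv hu x (v a)).symm

lemma IsSmoothForm.dForm {p : ℕ} {φ : DForm n M p} (hφ : IsSmoothForm φ) :
    IsSmoothForm (dForm φ) := fun i => by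
  refine ContDiffOn.congr ?_ fun y hy => inChart_dForm hφ i hy
  have h : ContDiffOn ℝ ∞ (fderiv ℝ (inChart φ i)) (extChartAt (𝓡 n) i).target :=
    (hφ i).fderiv_of_isOpen (isOpen_extChartAt_target i) (by simp)
  exact (ContinuousAlternatingMap.alternatizeUncurryFinCLM ℝ
    (EuclideanSpace ℝ (Fin n)) ℝ).contDiff.comp_contDiffOn h

lemma IsSmoothForm.neg {p : ℕ} {φ : DForm n M p} (hφ : IsSmoothForm φ) : IsSmoothForm (-φ) := by
  have := hφ.smul (-1)
  rwa [neg_one_smul] at this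

lemma IsSmoothForm.sub {p : ℕ} {φ η : DForm n M p} (hφ : IsSmoothForm φ) (hη : IsSmoothForm η) :
    IsSmoothForm (φ - η) := by
  rw [sub_eq_add_neg]; exact hφ.add hη.neg

lemma IsSmoothForm.smul_fun {p : ℕ} {f : M → ℝ} (hf : ContMDiff (𝓡 n) 𝓘(ℝ, ℝ) ∞ f)
    {φ : DForm n M p} (hφ : IsSmoothForm φ) : IsSmoothForm (fun x => f x • φ x : DForm n M p) :=
  fun i => by
    have h1 : ContDiffOn ℝ ∞ (fun y => f ((extChartAt (𝓡 n) i).symm y))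
        (extChartAt (𝓡 n) i).target := by
      rw [← contMDiffOn_iff_contDiffOn]
      exact hf.comp_contMDiffOn (contMDiffOn_extChartAt_symm i)
    exact (h1.smul (hφ i)).congr fun y _ => inChart_smul_fun f φ i y

end Coordinates

/-! ### The Leibniz rule -/

section Alternation

open Equiv

variable {V : Type*}

/-- The alternating sum of a function over all permutations of its arguments. -/
def alternation {n : ℕ} (f : (Fin n → V) → ℝ) (v : Fin n → V) : ℝ :=
  ∑ σ : Perm (Fin n), ((Perm.sign σ : ℤ) : ℝ) * f (v ∘ σ)

lemma sign_mul_self (n : ℕ) (σ : Perm (Fin n)) :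
    ((Perm.sign σ : ℤ) : ℝ) * ((Perm.sign σ : ℤ) : ℝ) = 1 := by
  rcases Int.units_eq_one_or (Perm.sign σ) with h | h <;> simp [h]

/-- Reindex the sum by `σ ↦ σ * τ`; the sign of `τ` is its own inverse. -/
lemma alternation_comp_perm {n : ℕ} (f : (Fin n → V) → ℝ) (τ : Perm (Fin n)) (v : Fin n → V) :
    alternation (fun w => f (w ∘ τ)) v = ((Perm.sign τ : ℤ) : ℝ) * alternation f v := by
  unfold alternation
  rw [Finset.mul_sum, ← Equiv.sum_comp (Equiv.mulRight τ) (fun σ => ((Perm.sign τ : ℤ) : ℝ) *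
    (((Perm.sign σ : ℤ) : ℝ) * f (v ∘ σ)))]
  refine Finset.sum_congr rfl fun σ _ => ?_
  have h := sign_mul_self n τ
  have e : (v ∘ σ) ∘ τ = v ∘ (Equiv.mulRight τ σ) := rfl
  simp only [e, Equiv.coe_mulRight, Perm.sign_mul, Units.val_mul, Int.cast_mul]
  linear_combination (-((Perm.sign σ : ℤ) : ℝ) * f (v ∘ ⇑(σ * τ))) * h

lemma alternation_sum {n : ℕ} {ι : Type*} (s : Finset ι) (c : ι → ℝ)
    (f : ι → (Fin n → V) → ℝ) (v : Fin n → V) :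
    alternation (fun w => ∑ i ∈ s, c i * f i w) v = ∑ i ∈ s, c i * alternation (f i) v := by
  unfold alternation
  simp only [Finset.mul_sum]
  rw [Finset.sum_comm]
  exact Finset.sum_congr rfl fun i _ => Finset.sum_congr rfl fun σ _ => by ring

lemma alternation_sum_perm {n : ℕ} {ι : Type*} (s : Finset ι) (c : ι → ℝ) (τ : ι → Perm (Fin n))
    (f : (Fin n → V) → ℝ) (v : Fin n → V) :
    alternation (fun w => ∑ i ∈ s, c i * f (w ∘ τ i)) v =
      ∑ i ∈ s, c i * (((Perm.sign (τ i) : ℤ) : ℝ) * alternation f v) := by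
  rw [alternation_sum s c (fun i w => f (w ∘ τ i))]
  exact Finset.sum_congr rfl fun i _ => by rw [alternation_comp_perm]

lemma alternation_smul {n : ℕ} (c : ℝ) (f : (Fin n → V) → ℝ) (v : Fin n → V) :
    alternation (fun w => c * f w) v = c * alternation f v := by
  unfold alternation
  rw [Finset.mul_sum]
  exact Finset.sum_congr rfl fun σ _ => by ring

/-- Bridges index types such as `Fin (m + 1 + k)` and `Fin (m + k + 1)`, whose sizes agree only
propositionally. -/
lemma alternation_cast {n n' : ℕ} (h : n = n') (f : (Fin n → V) → ℝ) (v : Fin n' → V) :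
    alternation f (v ∘ Fin.cast h) = alternation (fun w => f (w ∘ Fin.cast h)) v := by
  subst h; rfl

/-- The permutation acting on the first block of indices. -/
def permLeft {m : ℕ} (k : ℕ) (τ : Perm (Fin m)) : Perm (Fin (m + k)) :=
  finSumFinEquiv.permCongr (Equiv.sumCongr τ 1)

/-- The permutation acting on the last block of indices. -/
def permRight (m : ℕ) {k : ℕ} (τ : Perm (Fin k)) : Perm (Fin (m + k)) :=
  finSumFinEquiv.permCongr (Equiv.sumCongr 1 τ)

/-- An inner permutation, extended by the identity on the other block, is absorbed by the outer
alternation. The two signs cancel, so each of the `m!` inner terms contributes the same amount. -/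
lemma alternation_left {m k : ℕ} (T : (Fin m → V) → ℝ) (g : (Fin k → V) → ℝ)
    (v : Fin (m + k) → V) :
    alternation (fun w => alternation T (w ∘ Fin.castAdd k) * g (w ∘ Fin.natAdd m)) v =
      m.factorial * alternation (fun w => T (w ∘ Fin.castAdd k) * g (w ∘ Fin.natAdd m)) v := by
  let F : (Fin (m + k) → V) → ℝ := fun w' => T (w' ∘ Fin.castAdd k) * g (w' ∘ Fin.natAdd m)
  have h1 : (fun w : Fin (m + k) → V =>
      alternation T (w ∘ Fin.castAdd k) * g (w ∘ Fin.natAdd m)) =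
      fun w => ∑ τ : Perm (Fin m), ((Perm.sign τ : ℤ) : ℝ) *
        F (w ∘ permLeft k τ) := by
    funext w
    unfold alternation
    rw [Finset.sum_mul]
    refine Finset.sum_congr rfl fun τ _ => ?_
    have e1 : (w ∘ permLeft k τ) ∘ Fin.castAdd k = (w ∘ Fin.castAdd k) ∘ τ := by
      funext j; simp [permLeft]
    have e2 : (w ∘ permLeft k τ) ∘ Fin.natAdd m = w ∘ Fin.natAdd m := by
      funext j; simp [permLeft]
    simp only [F, e1, e2]
    ring
  rw [h1, alternation_sum_perm]
  have h2 : ∀ τ : Perm (Fin m), Perm.sign (permLeft k τ) = Perm.sign τ := fun τ => by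
    simp [permLeft, Perm.sign_permCongr, Perm.sign_sumCongr]
  simp only [h2, ← mul_assoc, sign_mul_self, one_mul]
  simp [Fintype.card_perm, F]

lemma alternation_right {m k : ℕ} (T : (Fin m → V) → ℝ) (g : (Fin k → V) → ℝ)
    (v : Fin (m + k) → V) :
    alternation (fun w => T (w ∘ Fin.castAdd k) * alternation g (w ∘ Fin.natAdd m)) v =
      k.factorial * alternation (fun w => T (w ∘ Fin.castAdd k) * g (w ∘ Fin.natAdd m)) v := by
  let F : (Fin (m + k) → V) → ℝ := fun w' => T (w' ∘ Fin.castAdd k) * g (w' ∘ Fin.natAdd m)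
  have h1 : (fun w : Fin (m + k) → V =>
      T (w ∘ Fin.castAdd k) * alternation g (w ∘ Fin.natAdd m)) =
      fun w => ∑ τ : Perm (Fin k), ((Perm.sign τ : ℤ) : ℝ) *
        F (w ∘ permRight m τ) := by
    funext w
    unfold alternation
    rw [Finset.mul_sum]
    refine Finset.sum_congr rfl fun τ _ => ?_
    have e1 : (w ∘ permRight m τ) ∘ Fin.castAdd k = w ∘ Fin.castAdd k := by
      funext j; simp [permRight]
    have e2 : (w ∘ permRight m τ) ∘ Fin.natAdd m = (w ∘ Fin.natAdd m) ∘ τ := by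
      funext j; simp [permRight]
    simp only [F, e1, e2]
    ring
  rw [h1, alternation_sum_perm]
  have h2 : ∀ τ : Perm (Fin k), Perm.sign (permRight m τ) = Perm.sign τ := fun τ => by
    simp [permRight, Perm.sign_permCongr, Perm.sign_sumCongr]
  simp only [h2, ← mul_assoc, sign_mul_self, one_mul]
  simp [Fintype.card_perm, F]

/-- The absorption argument again, for the permutations fixing `0`, which are
`Perm.decomposeFin.symm (0, τ)`. -/
lemma alternation_tail {q : ℕ} (h : V → (Fin q → V) → ℝ) (v : Fin (q + 1) → V) :
    alternation (fun w => alternation (h (w 0)) (w ∘ Fin.succ)) v =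
      q.factorial * alternation (fun w => h (w 0) (w ∘ Fin.succ)) v := by
  let F : (Fin (q + 1) → V) → ℝ := fun w' => h (w' 0) (w' ∘ Fin.succ)
  have h1 : (fun w : Fin (q + 1) → V => alternation (h (w 0)) (w ∘ Fin.succ)) =
      fun w => ∑ τ : Perm (Fin q), ((Perm.sign τ : ℤ) : ℝ) *
        F (w ∘ Perm.decomposeFin.symm (0, τ)) := by
    funext w
    unfold alternation
    refine Finset.sum_congr rfl fun τ _ => ?_
    have e1 : (w ∘ Perm.decomposeFin.symm (0, τ)) 0 = w 0 := by simp
    have e2 : (w ∘ Perm.decomposeFin.symm (0, τ)) ∘ Fin.succ = (w ∘ Fin.succ) ∘ τ := by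
      funext j; simp
    simp only [F, e1, e2]
  rw [h1, alternation_sum_perm]
  simp only [Perm.decomposeFin.symm_sign, if_true, one_mul, ← mul_assoc, sign_mul_self]
  simp [Fintype.card_perm, F]

end Alternation

/-! ### The Leibniz rule on a vector space. -/

section Leibniz

open Equiv

variable {E : Type*} [NormedAddCommGroup E] [NormedSpace ℝ E]

lemma alternation_alternating {V : Type*} [AddCommGroup V] [Module ℝ V] [TopologicalSpace V]
    {n : ℕ} (a : V [⋀^Fin n]→L[ℝ] ℝ) (v : Fin n → V) :
    alternation (fun w => a w) v = n.factorial * a v := by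
  unfold alternation
  have : ∀ σ : Perm (Fin n), ((Perm.sign σ : ℤ) : ℝ) * a (v ∘ σ) = a v := fun σ => by
    have h := a.toAlternatingMap.map_perm v σ
    have h' : a (v ∘ σ) = ((Perm.sign σ : ℤ) : ℝ) * a v := by
      refine Eq.trans h ?_
      rw [Units.smul_def, zsmul_eq_mul]; rfl
    rw [h', ← mul_assoc, sign_mul_self, one_mul]
  simp [this, Fintype.card_perm]

lemma wedge_apply {V : Type*} [AddCommGroup V] [Module ℝ V] [TopologicalSpace V]
    [IsTopologicalAddGroup V] [ContinuousConstSMul ℝ V] {m k : ℕ} (a : V [⋀^Fin m]→L[ℝ] ℝ)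
    (b : V [⋀^Fin k]→L[ℝ] ℝ) (v : Fin (m + k) → V) :
    wedge a b v = ((m.factorial : ℝ) * k.factorial)⁻¹ *
      alternation (fun w => a (w ∘ Fin.castAdd k) * b (w ∘ Fin.natAdd m)) v := by
  unfold wedge alternation
  rw [ContinuousAlternatingMap.smul_apply, ContinuousMultilinearMap.alternatization_apply_apply,
    smul_eq_mul]
  congr 1
  refine Finset.sum_congr rfl fun σ _ => ?_
  rw [tensorForm_apply, Units.smul_def, zsmul_eq_mul]
  rfl

lemma wedge_add_left {m k : ℕ} (a a' : E [⋀^Fin m]→L[ℝ] ℝ) (b : E [⋀^Fin k]→L[ℝ] ℝ) :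
    wedge (a + a') b = wedge a b + wedge a' b := by
  ext v
  simp only [ContinuousAlternatingMap.add_apply, wedge_apply, alternation, ← mul_add,
    ← Finset.sum_add_distrib, add_mul]

lemma wedge_smul_left {m k : ℕ} (c : ℝ) (a : E [⋀^Fin m]→L[ℝ] ℝ) (b : E [⋀^Fin k]→L[ℝ] ℝ) :
    wedge (c • a) b = c • wedge a b := by
  ext v
  simp only [ContinuousAlternatingMap.smul_apply, wedge_apply, smul_eq_mul, mul_assoc,
    alternation_smul]
  ring

lemma wedge_add_right {m k : ℕ} (a : E [⋀^Fin m]→L[ℝ] ℝ) (b b' : E [⋀^Fin k]→L[ℝ] ℝ) :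
    wedge a (b + b') = wedge a b + wedge a b' := by
  ext v
  simp only [ContinuousAlternatingMap.add_apply, wedge_apply, alternation, ← mul_add,
    ← Finset.sum_add_distrib]

lemma wedge_smul_right {m k : ℕ} (c : ℝ) (a : E [⋀^Fin m]→L[ℝ] ℝ) (b : E [⋀^Fin k]→L[ℝ] ℝ) :
    wedge a (c • b) = c • wedge a b := by
  ext v
  simp only [ContinuousAlternatingMap.smul_apply, wedge_apply, smul_eq_mul, mul_left_comm _ c,
    alternation_smul]

/-- Comparison of the two descriptions of the antisymmetrization of a linear family of alternating
maps. -/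
lemma factorial_mul_alternatizeUncurryFin {p : ℕ} (A : E →L[ℝ] E [⋀^Fin p]→L[ℝ] ℝ)
    (v : Fin (p + 1) → E) :
    p.factorial * ContinuousAlternatingMap.alternatizeUncurryFin A v =
      alternation (fun w => A (w 0) (w ∘ Fin.succ)) v := by
  let F : (Fin (p + 1) → E) → ℝ := fun w' => A (w' 0) (w' ∘ Fin.succ)
  -- The term that singles out the argument `i` is `F` after the cycle bringing position `i` to the
  -- front, a permutation of sign `(-1)^i`.
  have h0 : (fun w => ContinuousAlternatingMap.alternatizeUncurryFin A w) =
      fun w => ∑ i : Fin (p + 1), (-1 : ℝ) ^ (i : ℕ) *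
        F (w ∘ (Fin.cycleRange i).symm) := by
    funext w
    rw [ContinuousAlternatingMap.alternatizeUncurryFin_apply]
    refine Finset.sum_congr rfl fun i _ => ?_
    have e1 : (w ∘ (Fin.cycleRange i).symm) 0 = w i := by simp [Fin.cycleRange_symm_zero]
    have e2 : (w ∘ (Fin.cycleRange i).symm) ∘ Fin.succ = i.removeNth w := by
      funext j; simp [Fin.cycleRange_symm_succ, Fin.removeNth]
    simp only [F, e1, e2]
    rw [zsmul_eq_mul]
    push_cast
    rfl
  -- Alternating a form that is already alternating multiplies it by `(p + 1)!`. Alternating the sum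
  -- in `h0` gives `p + 1` equal copies of the alternation of `F`; cancelling `p + 1` leaves `p!`.
  have h1 := alternation_alternating (ContinuousAlternatingMap.alternatizeUncurryFin A) v
  rw [h0, alternation_sum_perm] at h1
  have h2 : ∀ i : Fin (p + 1), ((Perm.sign (Fin.cycleRange i).symm : ℤ) : ℝ) = (-1) ^ (i : ℕ) :=
    fun i => by
      rw [Perm.sign_symm, Fin.sign_cycleRange]; simp
  simp only [h2, ← mul_assoc, ← pow_add, ← two_mul, pow_mul, neg_one_sq, one_pow, one_mul] at h1
  rw [Finset.sum_const, Finset.card_univ, Fintype.card_fin, nsmul_eq_mul, Nat.factorial_succ] at h1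
  push_cast at h1
  have h3 : ((p : ℝ) + 1) ≠ 0 := by positivity
  rw [mul_assoc] at h1
  exact (mul_left_cancel₀ h3 h1).symm

variable [FiniteDimensional ℝ E]

/-- The linear family `x ↦ A x ∧ b`. -/
def wedgeLeft {m k : ℕ} (A : E →L[ℝ] E [⋀^Fin m]→L[ℝ] ℝ) (b : E [⋀^Fin k]→L[ℝ] ℝ) :
    E →L[ℝ] E [⋀^Fin (m + k)]→L[ℝ] ℝ :=
  LinearMap.toContinuousLinearMap
    { toFun := fun x => wedge (A x) b
      map_add' := fun x y => by rw [map_add, wedge_add_left]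
      map_smul' := fun c x => by rw [map_smul, wedge_smul_left]; rfl }

/-- The linear family `x ↦ a ∧ B x`. -/
def wedgeRight {m k : ℕ} (a : E [⋀^Fin m]→L[ℝ] ℝ) (B : E →L[ℝ] E [⋀^Fin k]→L[ℝ] ℝ) :
    E →L[ℝ] E [⋀^Fin (m + k)]→L[ℝ] ℝ :=
  LinearMap.toContinuousLinearMap
    { toFun := fun x => wedge a (B x)
      map_add' := fun x y => by rw [map_add, wedge_add_right]
      map_smul' := fun c x => by rw [map_smul, wedge_smul_right]; rfl }

lemma wedgeLeft_apply {m k : ℕ} (A : E →L[ℝ] E [⋀^Fin m]→L[ℝ] ℝ) (b : E [⋀^Fin k]→L[ℝ] ℝ)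
    (x : E) : wedgeLeft A b x = wedge (A x) b := rfl

lemma wedgeRight_apply {m k : ℕ} (a : E [⋀^Fin m]→L[ℝ] ℝ) (B : E →L[ℝ] E [⋀^Fin k]→L[ℝ] ℝ)
    (x : E) : wedgeRight a B x = wedge a (B x) := rfl

/-- Both sides are multiples of one full alternation, that of `A (w 0) (…) * b (…)`, so only
factorials remain to be compared. The cast matches `m + 1 + k` with `m + k + 1`. -/
lemma alternatizeUncurryFin_wedgeLeft {m k : ℕ} (A : E →L[ℝ] E [⋀^Fin m]→L[ℝ] ℝ)
    (b : E [⋀^Fin k]→L[ℝ] ℝ) (v : Fin (m + k + 1) → E) :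
    ContinuousAlternatingMap.alternatizeUncurryFin (wedgeLeft A b) v =
      wedge (ContinuousAlternatingMap.alternatizeUncurryFin A) b
        (v ∘ Fin.cast (Nat.add_right_comm m 1 k)) := by
  have hm : (m.factorial : ℝ) ≠ 0 := by positivity
  have hk : (k.factorial : ℝ) ≠ 0 := by positivity
  have hmk : ((m + k).factorial : ℝ) ≠ 0 := by positivity
  have hm1 : ((m + 1).factorial : ℝ) ≠ 0 := by positivity
  have h1 := factorial_mul_alternatizeUncurryFin (wedgeLeft A b) v
  simp only [wedgeLeft_apply, wedge_apply, alternation_smul] at h1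
  rw [alternation_tail (fun x u => A x (u ∘ Fin.castAdd k) * b (u ∘ Fin.natAdd m))] at h1
  have h2 : ∀ w, ContinuousAlternatingMap.alternatizeUncurryFin A w =
      (m.factorial : ℝ)⁻¹ * alternation (fun w => A (w 0) (w ∘ Fin.succ)) w := fun w => by
    rw [← factorial_mul_alternatizeUncurryFin, inv_mul_cancel_left₀ hm]
  rw [wedge_apply]
  simp only [h2, mul_assoc, alternation_smul]
  rw [alternation_left (fun w : Fin (m + 1) → E => A (w 0) (w ∘ Fin.succ)) (fun w => b w),
    alternation_cast]
  have h3 : (fun w : Fin (m + k + 1) → E =>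
      A (((w ∘ Fin.cast (Nat.add_right_comm m 1 k)) ∘ Fin.castAdd k) 0)
        (((w ∘ Fin.cast (Nat.add_right_comm m 1 k)) ∘ Fin.castAdd k) ∘ Fin.succ) *
      b ((w ∘ Fin.cast (Nat.add_right_comm m 1 k)) ∘ Fin.natAdd (m + 1))) =
      fun w => A (w 0) ((w ∘ Fin.succ) ∘ Fin.castAdd k) * b ((w ∘ Fin.succ) ∘ Fin.natAdd m) := by
    funext w
    congr 2
    funext j
    simp only [Function.comp]
    congr 1
    ext
    simp
    omega
  rw [h3]
  generalize alternation (fun w : Fin (m + k + 1) → E =>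
    A (w 0) ((w ∘ Fin.succ) ∘ Fin.castAdd k) * b ((w ∘ Fin.succ) ∘ Fin.natAdd m)) v = z at h1 ⊢
  field_simp at h1 ⊢
  linarith

lemma alternatizeUncurryFin_wedgeRight {m k : ℕ} (a : E [⋀^Fin m]→L[ℝ] ℝ)
    (B : E →L[ℝ] E [⋀^Fin k]→L[ℝ] ℝ) (v : Fin (m + k + 1) → E) :
    ContinuousAlternatingMap.alternatizeUncurryFin (wedgeRight a B) v =
      (-1) ^ m * wedge a (ContinuousAlternatingMap.alternatizeUncurryFin B) v := by
  have hm : (m.factorial : ℝ) ≠ 0 := by positivity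
  have hk : (k.factorial : ℝ) ≠ 0 := by positivity
  have hmk : ((m + k).factorial : ℝ) ≠ 0 := by positivity
  have hm1 : ((k + 1).factorial : ℝ) ≠ 0 := by positivity
  have h1 := factorial_mul_alternatizeUncurryFin (wedgeRight a B) v
  simp only [wedgeRight_apply, wedge_apply, alternation_smul] at h1
  rw [alternation_tail (fun x u => a (u ∘ Fin.castAdd k) * B x (u ∘ Fin.natAdd m))] at h1
  have h2 : ∀ w, ContinuousAlternatingMap.alternatizeUncurryFin B w =
      (k.factorial : ℝ)⁻¹ * alternation (fun w => B (w 0) (w ∘ Fin.succ)) w := fun w => by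
    rw [← factorial_mul_alternatizeUncurryFin, inv_mul_cancel_left₀ hk]
  have h4 : wedge a (ContinuousAlternatingMap.alternatizeUncurryFin B) v =
      ((m.factorial : ℝ) * (k + 1).factorial)⁻¹ * ((k.factorial : ℝ)⁻¹ * ((k + 1).factorial *
      alternation (fun w : Fin (m + (k + 1)) → E => a (w ∘ Fin.castAdd (k + 1)) *
        B ((w ∘ Fin.natAdd m) 0) ((w ∘ Fin.natAdd m) ∘ Fin.succ)) v)) := by
    rw [wedge_apply]
    simp only [h2, mul_left_comm _ ((k.factorial : ℝ)⁻¹), alternation_smul]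
    rw [alternation_right (fun w => a w) (fun w : Fin (k + 1) → E => B (w 0) (w ∘ Fin.succ))]
  -- The argument fed to the linear slot of `B` stands at position `m` on the right and at position
  -- `0` on the left. The cycle carrying it past the `m` arguments of `a` has sign `(-1)^m`.
  let i : Fin (m + k + 1) := Fin.natAdd m (0 : Fin (k + 1))
  have h3 : (fun w : Fin (m + (k + 1)) → E => a (w ∘ Fin.castAdd (k + 1)) *
        B ((w ∘ Fin.natAdd m) 0) ((w ∘ Fin.natAdd m) ∘ Fin.succ)) =
      fun w => (fun w' : Fin (m + k + 1) → E => a ((w' ∘ Fin.succ) ∘ Fin.castAdd k) *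
        B (w' 0) ((w' ∘ Fin.succ) ∘ Fin.natAdd m)) (w ∘ (Fin.cycleRange i).symm) := by
    funext w
    have e1 : ((w ∘ (Fin.cycleRange i).symm) ∘ Fin.succ) ∘ Fin.castAdd k =
        w ∘ Fin.castAdd (k + 1) := by
      funext j
      simp only [Function.comp, Fin.cycleRange_symm_succ]
      congr 1
      rw [Fin.succAbove_of_castSucc_lt]
      · ext; simp
      · simp [i, Fin.lt_def]
    have e2 : (w ∘ (Fin.cycleRange i).symm) 0 = (w ∘ Fin.natAdd m) 0 := by
      simp [Fin.cycleRange_symm_zero, i]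
    have e3 : ((w ∘ (Fin.cycleRange i).symm) ∘ Fin.succ) ∘ Fin.natAdd m =
        (w ∘ Fin.natAdd m) ∘ Fin.succ := by
      funext j
      simp only [Function.comp, Fin.cycleRange_symm_succ]
      congr 1
      rw [Fin.succAbove_of_le_castSucc]
      · ext; simp; omega
      · simp [i, Fin.le_def]
    simp only [e1, e2, e3]
  rw [h4, h3]
  have h5 := alternation_comp_perm (fun w' : Fin (m + k + 1) → E =>
    a ((w' ∘ Fin.succ) ∘ Fin.castAdd k) * B (w' 0) ((w' ∘ Fin.succ) ∘ Fin.natAdd m))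
    (Fin.cycleRange i).symm v
  have h6 : ((Perm.sign (Fin.cycleRange i).symm : ℤ) : ℝ) = (-1) ^ m := by
    rw [Perm.sign_symm, Fin.sign_cycleRange]; simp [i]
  rw [h6] at h5
  erw [h5]
  generalize alternation (fun w' : Fin (m + k + 1) → E =>
    a ((w' ∘ Fin.succ) ∘ Fin.castAdd k) * B (w' 0) ((w' ∘ Fin.succ) ∘ Fin.natAdd m)) v = z at h1 ⊢
  have h7 : ((-1 : ℝ) ^ m) * (-1) ^ m = 1 := by rw [← mul_pow]; simp
  have h8 : (-1 : ℝ) ^ m * (((m.factorial : ℝ) * (k + 1).factorial)⁻¹ * ((k.factorial : ℝ)⁻¹ *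
    ((k + 1).factorial * ((-1) ^ m * z)))) =
    ((-1 : ℝ) ^ m * (-1) ^ m) * (((m.factorial : ℝ) * (k + 1).factorial)⁻¹ * ((k.factorial : ℝ)⁻¹ *
    ((k + 1).factorial * z))) := by ring
  rw [h8, h7]
  field_simp at h1 ⊢
  linarith

lemma hasFDerivAt_alternating {X : Type*} [NormedAddCommGroup X] [NormedSpace ℝ X] {p : ℕ}
    {f : X → E [⋀^Fin p]→L[ℝ] ℝ} {f' : X →L[ℝ] E [⋀^Fin p]→L[ℝ] ℝ} {x : X}
    (h : ∀ v : Fin p → E, HasFDerivAt (fun y => f y v)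
      ((ContinuousAlternatingMap.apply ℝ E ℝ v).comp f') x) : HasFDerivAt f f' x := by
  obtain ⟨g, hg⟩ := exists_reconstruction (Module.finBasis ℝ E) p
  have h1 : f = fun y => g (fun r => f y (fun i => Module.finBasis ℝ E (r i))) := by
    funext y; rw [hg]
  have h2 : f' = g.comp (ContinuousLinearMap.pi fun r =>
      (ContinuousAlternatingMap.apply ℝ E ℝ (fun i => Module.finBasis ℝ E (r i))).comp f') := by
    ext1 z
    exact (hg (f' z)).symm
  rw [h1, h2]
  exact g.hasFDerivAt.comp x (hasFDerivAt_pi.2 fun r => h _)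

lemma hasFDerivAt_wedge {m k : ℕ} {A : E → E [⋀^Fin m]→L[ℝ] ℝ} {B : E → E [⋀^Fin k]→L[ℝ] ℝ}
    {A' : E →L[ℝ] E [⋀^Fin m]→L[ℝ] ℝ} {B' : E →L[ℝ] E [⋀^Fin k]→L[ℝ] ℝ} {x : E}
    (hA : HasFDerivAt A A' x) (hB : HasFDerivAt B B' x) :
    HasFDerivAt (fun y => wedge (A y) (B y)) (wedgeLeft A' (B x) + wedgeRight (A x) B') x := by
  refine hasFDerivAt_alternating fun v => ?_
  simp only [wedge_apply, alternation]
  have hA1 := fun w => (ContinuousAlternatingMap.apply ℝ E ℝ (w : Fin m → E)).hasFDerivAt.comp x hA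
  have hB1 := fun w => (ContinuousAlternatingMap.apply ℝ E ℝ (w : Fin k → E)).hasFDerivAt.comp x hB
  have key := (HasFDerivAt.fun_sum (u := Finset.univ) fun (σ : Perm (Fin (m + k))) _ =>
    ((hA1 ((v ∘ σ) ∘ Fin.castAdd k)).mul (hB1 ((v ∘ σ) ∘ Fin.natAdd m))).const_mul
      ((Perm.sign σ : ℤ) : ℝ)).const_mul (((m.factorial : ℝ) * k.factorial)⁻¹)
  refine key.congr_fderiv ?_
  ext h
  simp only [ContinuousLinearMap.comp_apply, _root_.add_apply,
    ContinuousAlternatingMap.apply_apply, ContinuousAlternatingMap.add_apply, wedgeLeft_apply,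
    wedgeRight_apply, wedge_apply, alternation, _root_.smul_apply, smul_eq_mul,
    _root_.sum_apply, Function.comp_apply, ← mul_add, ← Finset.sum_add_distrib]
  congr 1
  exact Finset.sum_congr rfl fun σ _ => by ring

/-- The Leibniz rule on a vector space. -/
lemma extDeriv_wedge {m k : ℕ} {A : E → E [⋀^Fin m]→L[ℝ] ℝ} {B : E → E [⋀^Fin k]→L[ℝ] ℝ}
    {x : E} (hA : DifferentiableAt ℝ A x) (hB : DifferentiableAt ℝ B x)
    (v : Fin (m + k + 1) → E) :
    extDeriv (fun y => wedge (A y) (B y)) x v =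
      wedge (extDeriv A x) (B x) (v ∘ Fin.cast (Nat.add_right_comm m 1 k)) +
      (-1) ^ m * wedge (A x) (extDeriv B x) v := by
  unfold extDeriv
  rw [(hasFDerivAt_wedge hA.hasFDerivAt hB.hasFDerivAt).fderiv,
    ContinuousAlternatingMap.alternatizeUncurryFin_add, ContinuousAlternatingMap.add_apply,
    alternatizeUncurryFin_wedgeLeft, alternatizeUncurryFin_wedgeRight]

end Leibniz

/-! ### The Leibniz rule on a manifold. -/

section LeibnizForms

variable {n : ℕ} {M : Type*} [TopologicalSpace M] [ChartedSpace (EuclideanSpace ℝ (Fin n)) M]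
  [IsManifold (𝓡 n) ∞ M]

lemma wedge_comp {V W : Type*} [AddCommGroup V] [Module ℝ V] [TopologicalSpace V]
    [IsTopologicalAddGroup V] [ContinuousConstSMul ℝ V] [AddCommGroup W] [Module ℝ W]
    [TopologicalSpace W] [IsTopologicalAddGroup W] [ContinuousConstSMul ℝ W] {m k : ℕ}
    (a : V [⋀^Fin m]→L[ℝ] ℝ) (b : V [⋀^Fin k]→L[ℝ] ℝ) (f : W →L[ℝ] V) :
    (wedge a b).compContinuousLinearMap f =
      wedge (a.compContinuousLinearMap f) (b.compContinuousLinearMap f) := by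
  ext v
  rw [ContinuousAlternatingMap.compContinuousLinearMap_apply, wedge_apply, wedge_apply]
  rfl

lemma inChart_wedgeForm {m k : ℕ} (a : DForm n M m) (b : DForm n M k) (i : M)
    (y : EuclideanSpace ℝ (Fin n)) :
    inChart (wedgeForm a b) i y = wedge (inChart a i y) (inChart b i y) :=
  wedge_comp _ _ _

lemma IsSmoothForm.wedge {m k : ℕ} {a : DForm n M m} {b : DForm n M k} (ha : IsSmoothForm a)
    (hb : IsSmoothForm b) : IsSmoothForm (wedgeForm a b) := fun i y hy => by
  refine contDiffWithinAt_alternating fun v => ?_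
  simp only [inChart_wedgeForm, wedge_apply, alternation]
  refine contDiffWithinAt_const.mul (ContDiffWithinAt.sum fun σ _ => contDiffWithinAt_const.mul ?_)
  exact (contDiffWithinAt_alternating_apply (ha i y hy) fun _ => contDiffWithinAt_const).mul
    (contDiffWithinAt_alternating_apply (hb i y hy) fun _ => contDiffWithinAt_const)

/-- The Leibniz rule for differential forms on a manifold. -/
lemma dForm_wedgeForm {m k : ℕ} {a : DForm n M m} {b : DForm n M k} (ha : IsSmoothForm a)
    (hb : IsSmoothForm b) (x : M) (v : Fin (m + k + 1) → TangentSpace (𝓡 n) x) :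
    dForm (wedgeForm a b) x v =
      wedgeForm (dForm a) b x (v ∘ Fin.cast (Nat.add_right_comm m 1 k)) +
      (-1) ^ m * wedgeForm a (dForm b) x v := by
  have h : inChart (wedgeForm a b) x = fun y => wedge (inChart a x y) (inChart b x y) :=
    funext fun y => inChart_wedgeForm a b x y
  -- The chart derivative inverts the coordinate frame, so pulling a coordinate expression back at
  -- the centre point recovers the form.
  have key : ∀ {p : ℕ} (φ : DForm n M p), (inChart φ x (extChartAt (𝓡 n) x x)
      ).compContinuousLinearMap (chartDeriv x) = φ x := fun φ => by
    ext w
    refine form_congr φ (extChartAt_to_inv x) _ _ ?_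
    funext i
    have := mfderiv_comp x (mdifferentiableAt_symm x (mem_extChartAt_target (I := 𝓡 n) x))
      (mdifferentiableAt_chart x (mem_extChartAt_source (I := 𝓡 n) x))
    have e : (extChartAt (𝓡 n) x).symm ∘ extChartAt (𝓡 n) x =ᶠ[𝓝 x] id := by
      filter_upwards [(isOpen_extChartAt_source (I := 𝓡 n) x).mem_nhds
        (mem_extChartAt_source x)] with z hz
      exact (extChartAt (𝓡 n) x).left_inv hz
    have e' := e.mfderiv_eq (I := 𝓡 n) (I' := 𝓡 n)
    rw [mfderiv_id] at e'
    exact (DFunLike.congr_fun this (w i)).symm.trans (DFunLike.congr_fun e' (w i))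
  have h1 : dForm (wedgeForm a b) x v = extDeriv (fun y => wedge (inChart a x y) (inChart b x y))
      (extChartAt (𝓡 n) x x) (chartDeriv x ∘ v) := by
    simp only [dForm, h]; rfl
  rw [h1, extDeriv_wedge (ha.differentiableAt x) (hb.differentiableAt x)]
  have h2 : wedgeForm (dForm a) b x = (wedge (extDeriv (inChart a x) (extChartAt (𝓡 n) x x))
      (inChart b x (extChartAt (𝓡 n) x x))).compContinuousLinearMap (chartDeriv x) := by
    rw [wedge_comp, key]; rfl
  have h3 : wedgeForm a (dForm b) x = (wedge (inChart a x (extChartAt (𝓡 n) x x))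
      (extDeriv (inChart b x) (extChartAt (𝓡 n) x x))).compContinuousLinearMap (chartDeriv x) := by
    rw [wedge_comp, key]; rfl
  rw [h2, h3]
  rfl

end LeibnizForms

/-! ### Integration of top degree forms -/

section Integration

open MeasureTheory

variable {n : ℕ} {M : Type*} [TopologicalSpace M] [ChartedSpace (EuclideanSpace ℝ (Fin n)) M]

/-- Source of the Jacobian determinant in the change of variables. -/
lemma alternating_comp_det {n : ℕ} (a : EuclideanSpace ℝ (Fin n) [⋀^Fin n]→ₗ[ℝ] ℝ)
    (f : EuclideanSpace ℝ (Fin n) →L[ℝ] EuclideanSpace ℝ (Fin n)) :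
    a (fun i => f (EuclideanSpace.basisFun (Fin n) ℝ i)) =
      f.det * a (EuclideanSpace.basisFun (Fin n) ℝ) := by
  have h := a.eq_smul_basis_det (EuclideanSpace.basisFun (Fin n) ℝ).toBasis
  have h1 := (EuclideanSpace.basisFun (Fin n) ℝ).toBasis.det_comp (f : EuclideanSpace ℝ (Fin n)
    →ₗ[ℝ] EuclideanSpace ℝ (Fin n)) (EuclideanSpace.basisFun (Fin n) ℝ).toBasis
  rw [Module.Basis.det_self, mul_one] at h1
  conv_lhs => rw [h]
  simp only [AlternatingMap.smul_apply, smul_eq_mul, OrthonormalBasis.coe_toBasis] at h1 ⊢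
  rw [mul_comm]
  congr 1

lemma someVector_congr (o : ∀ x : M, Orientation ℝ (TangentSpace (𝓡 n) x) (Fin n)) {x x' : M}
    (h : x = x') (v v' : Fin n → EuclideanSpace ℝ (Fin n)) (hv : v = v') :
    ((o x).someVector : EuclideanSpace ℝ (Fin n) [⋀^Fin n]→ₗ[ℝ] ℝ) v =
      ((o x').someVector : EuclideanSpace ℝ (Fin n) [⋀^Fin n]→ₗ[ℝ] ℝ) v' := by
  subst h hv; rfl

/-- The integrand of a top degree form in a chart. -/
def chartIntegrand (o : ManifoldOrientation n M) (i : M) (φ : DForm n M n)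
    (y : EuclideanSpace ℝ (Fin n)) : ℝ :=
  frameSign o.orient i y * inChart φ i y (EuclideanSpace.basisFun (Fin n) ℝ)

/-- The integral of a top degree form over a chart domain. -/
def chartIntegral (o : ManifoldOrientation n M) (i : M) (φ : DForm n M n) : ℝ :=
  ∫ y in (extChartAt (𝓡 n) i).target, chartIntegrand o i φ y

lemma chartIntegrand_smul_fun (o : ManifoldOrientation n M) (i : M) (f : M → ℝ) (φ : DForm n M n)
    (y : EuclideanSpace ℝ (Fin n)) : chartIntegrand o i (fun x => f x • φ x) y =
      f ((extChartAt (𝓡 n) i).symm y) * chartIntegrand o i φ y := by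
  simp only [chartIntegrand, inChart_smul_fun, ContinuousAlternatingMap.smul_apply, smul_eq_mul]
  ring

lemma inChart_eq_zero {p : ℕ} {φ : DForm n M p} {i : M} {y : EuclideanSpace ℝ (Fin n)}
    (h : φ ((extChartAt (𝓡 n) i).symm y) = 0) : inChart φ i y = 0 := by
  unfold inChart
  rw [h]
  rfl

lemma extDeriv_zero_fun {E : Type*} [NormedAddCommGroup E] [NormedSpace ℝ E] {p : ℕ} (x : E) :
    extDeriv (fun _ : E => (0 : E [⋀^Fin p]→L[ℝ] ℝ)) x = 0 := by
  have h := extDeriv_fun_smul (x := x) (0 : ℝ) (fun _ : E => (0 : E [⋀^Fin p]→L[ℝ] ℝ))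
  rwa [zero_smul, zero_smul] at h

lemma chartIntegrand_eq_zero (o : ManifoldOrientation n M) (i : M) {φ : DForm n M n}
    {y : EuclideanSpace ℝ (Fin n)} (h : φ ((extChartAt (𝓡 n) i).symm y) = 0) :
    chartIntegrand o i φ y = 0 := by
  simp only [chartIntegrand, inChart, h]
  exact mul_zero _

/-- Forms with continuous coordinate expressions. -/
def IsContinuousForm {p : ℕ} (φ : DForm n M p) : Prop :=
  ∀ i : M, ContinuousOn (inChart φ i) (extChartAt (𝓡 n) i).target

lemma IsSmoothForm.isContinuousForm {p : ℕ} {φ : DForm n M p} (hφ : IsSmoothForm φ) :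
    IsContinuousForm φ := fun i => (hφ i).continuousOn

lemma IsContinuousForm.add {p : ℕ} {φ ψ : DForm n M p} (hφ : IsContinuousForm φ)
    (hψ : IsContinuousForm ψ) : IsContinuousForm (φ + ψ) := fun i => by
  rw [inChart_add]; exact (hφ i).add (hψ i)

lemma IsContinuousForm.smul {p : ℕ} (c : ℝ) {φ : DForm n M p} (hφ : IsContinuousForm φ) :
    IsContinuousForm (c • φ) := fun i => by
  rw [inChart_smul]; exact (hφ i).const_smul c

lemma IsContinuousForm.smul_fun {p : ℕ} {f : M → ℝ} (hf : Continuous f)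
    {φ : DForm n M p} (hφ : IsContinuousForm φ) :
    IsContinuousForm (fun x => f x • φ x : DForm n M p) := fun i =>
  ((hf.comp_continuousOn (continuousOn_extChartAt_symm i)).smul (hφ i)).congr
    fun y _ => inChart_smul_fun f φ i y

lemma continuousOn_frameSign (o : ManifoldOrientation n M) (i : M) :
    ContinuousOn (frameSign o.orient i) (extChartAt (𝓡 n) i).target := fun y hy =>
  (continuousAt_const.congr_of_eventuallyEq (o.locallyConstant i y hy)).continuousWithinAt

lemma IsContinuousForm.continuousOn_chartIntegrand (o : ManifoldOrientation n M) {φ : DForm n M n}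
    (hφ : IsContinuousForm φ) (i : M) :
    ContinuousOn (chartIntegrand o i φ) (extChartAt (𝓡 n) i).target :=
  (continuousOn_frameSign o i).mul
    ((ContinuousAlternatingMap.apply ℝ (EuclideanSpace ℝ (Fin n)) ℝ
      (EuclideanSpace.basisFun (Fin n) ℝ)).continuous.comp_continuousOn (hφ i))

lemma isCompact_chart_image {i : M} {K : Set M} (hK : IsCompact K)
    (hKi : K ⊆ (extChartAt (𝓡 n) i).source) : IsCompact (extChartAt (𝓡 n) i '' K) :=
  hK.image_of_continuousOn ((continuousOn_extChartAt i).mono hKi)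

lemma chart_image_subset {i : M} {K : Set M} (hKi : K ⊆ (extChartAt (𝓡 n) i).source) :
    extChartAt (𝓡 n) i '' K ⊆ (extChartAt (𝓡 n) i).target := by
  rintro _ ⟨x, hx, rfl⟩
  exact (extChartAt (𝓡 n) i).map_source (hKi hx)

lemma symm_notMem_of_notMem_image {i : M} {K : Set M} {y : EuclideanSpace ℝ (Fin n)}
    (hy : y ∈ (extChartAt (𝓡 n) i).target) (hyK : y ∉ extChartAt (𝓡 n) i '' K) :
    (extChartAt (𝓡 n) i).symm y ∉ K := fun h =>
  hyK ⟨_, h, (extChartAt (𝓡 n) i).right_inv hy⟩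

lemma IsContinuousForm.integrableOn_chartIntegrand (o : ManifoldOrientation n M) {φ : DForm n M n}
    (hφ : IsContinuousForm φ) {i : M} {K : Set M} (hK : IsCompact K)
    (hKi : K ⊆ (extChartAt (𝓡 n) i).source) (h0 : ∀ x ∉ K, φ x = 0) :
    IntegrableOn (chartIntegrand o i φ) (extChartAt (𝓡 n) i).target := by
  refine IntegrableOn.of_forall_sdiff_eq_zero (s := extChartAt (𝓡 n) i '' K) ?_
    (isOpen_extChartAt_target i).measurableSet ?_
  · exact ((hφ.continuousOn_chartIntegrand o i).mono
      (chart_image_subset hKi)).integrableOn_compact (isCompact_chart_image hK hKi)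
  · rintro y ⟨hy, hyK⟩
    exact chartIntegrand_eq_zero o i (h0 _ (symm_notMem_of_notMem_image hy hyK))

variable [IsManifold (𝓡 n) ∞ M]

lemma chartFrame_transition (i j : M) {y : EuclideanSpace ℝ (Fin n)}
    (hy : y ∈ (extChartAt (𝓡 n) i).target)
    (hj : (extChartAt (𝓡 n) i).symm y ∈ (extChartAt (𝓡 n) j).source)
    (v : EuclideanSpace ℝ (Fin n)) :
    (chartFrame i y v : EuclideanSpace ℝ (Fin n)) =
      chartFrame j (inCharts i j (id : M → M) y) (fderiv ℝ (inCharts i j (id : M → M)) y v) := by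
  have h := mfderiv_chartFrame (u := (id : M → M)) hy mdifferentiableAt_id hj v
  rw [mfderiv_id] at h
  exact h

lemma frameSign_transition (o : ∀ x : M, Orientation ℝ (TangentSpace (𝓡 n) x) (Fin n)) (i j : M)
    {y : EuclideanSpace ℝ (Fin n)} (hy : y ∈ (extChartAt (𝓡 n) i).target)
    (hj : (extChartAt (𝓡 n) i).symm y ∈ (extChartAt (𝓡 n) j).source) :
    frameSign o i y = SignType.sign (fderiv ℝ (inCharts i j (id : M → M)) y).det *
      frameSign o j (inCharts i j (id : M → M) y) := by
  have h1 := someVector_congr o (((extChartAt (𝓡 n) j).left_inv hj).symm)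
    (fun a => chartFrame i y (EuclideanSpace.basisFun (Fin n) ℝ a)) _
    (funext fun a => chartFrame_transition i j hy hj (EuclideanSpace.basisFun (Fin n) ℝ a))
  have h2 := alternating_comp_det
    (((o ((extChartAt (𝓡 n) j).symm (inCharts i j (id : M → M) y))).someVector :
      EuclideanSpace ℝ (Fin n) [⋀^Fin n]→ₗ[ℝ] ℝ).compLinearMap
      (chartFrame j (inCharts i j (id : M → M) y) :
        EuclideanSpace ℝ (Fin n) →L[ℝ] EuclideanSpace ℝ (Fin n)).toLinearMap)
    (fderiv ℝ (inCharts i j (id : M → M)) y)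
  have h3 := h1.trans h2
  unfold frameSign
  erw [h3]
  rw [sign_mul]
  push_cast
  rfl

/-- The form contributes the Jacobian determinant and the frame sign contributes its sign. Their
product is the absolute value that the change of variables formula requires. -/
lemma chartIntegrand_transition (o : ManifoldOrientation n M) (i j : M) (φ : DForm n M n)
    {y : EuclideanSpace ℝ (Fin n)} (hy : y ∈ (extChartAt (𝓡 n) i).target)
    (hj : (extChartAt (𝓡 n) i).symm y ∈ (extChartAt (𝓡 n) j).source) :
    chartIntegrand o i φ y = |(fderiv ℝ (inCharts i j (id : M → M)) y).det| *
      chartIntegrand o j φ (inCharts i j (id : M → M) y) := by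
  have h1 : inChart φ i y (EuclideanSpace.basisFun (Fin n) ℝ) =
      (fderiv ℝ (inCharts i j (id : M → M)) y).det *
        inChart φ j (inCharts i j (id : M → M) y) (EuclideanSpace.basisFun (Fin n) ℝ) := by
    rw [inChart_transition i j φ hy hj]
    exact alternating_comp_det (inChart φ j (inCharts i j (id : M → M) y)).toAlternatingMap _
  unfold chartIntegrand
  rw [h1, frameSign_transition o.orient i j hy hj, ← self_mul_sign]
  ring

/-- Both integrals reduce to the chart overlap, on which the transition map is injective with image
the opposite overlap; change of variables then applies. -/
lemma chartIntegral_eq_of_support (o : ManifoldOrientation n M) (i j : M) (φ : DForm n M n)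
    (h : ∀ x, φ x ≠ 0 → x ∈ (extChartAt (𝓡 n) i).source ∧ x ∈ (extChartAt (𝓡 n) j).source) :
    chartIntegral o i φ = chartIntegral o j φ := by
  have hopen : ∀ i j : M, IsOpen ((extChartAt (𝓡 n) i).target ∩
      (extChartAt (𝓡 n) i).symm ⁻¹' (extChartAt (𝓡 n) j).source) := fun i j =>
    (continuousOn_extChartAt_symm i).isOpen_inter_preimage (isOpen_extChartAt_target i)
      (isOpen_extChartAt_source j)
  have hred : ∀ i j : M, (∀ x, φ x ≠ 0 → x ∈ (extChartAt (𝓡 n) j).source) →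
      chartIntegral o i φ = ∫ y in (extChartAt (𝓡 n) i).target ∩
        (extChartAt (𝓡 n) i).symm ⁻¹' (extChartAt (𝓡 n) j).source, chartIntegrand o i φ y := by
    intro i j hj
    refine setIntegral_eq_of_subset_of_forall_sdiff_eq_zero
      (isOpen_extChartAt_target i).measurableSet inter_subset_left ?_
    rintro y ⟨hy, hy'⟩
    refine chartIntegrand_eq_zero o i ?_
    by_contra hne
    exact hy' ⟨hy, hj _ hne⟩
  rw [hred i j fun x hx => (h x hx).2, hred j i fun x hx => (h x hx).1]
  have himg : inCharts i j (id : M → M) '' ((extChartAt (𝓡 n) i).target ∩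
      (extChartAt (𝓡 n) i).symm ⁻¹' (extChartAt (𝓡 n) j).source) =
      (extChartAt (𝓡 n) j).target ∩
        (extChartAt (𝓡 n) j).symm ⁻¹' (extChartAt (𝓡 n) i).source := by
    apply Subset.antisymm
    · rintro _ ⟨y, ⟨hy, hy'⟩, rfl⟩
      refine ⟨(extChartAt (𝓡 n) j).map_source hy', ?_⟩
      simp only [inCharts, id, mem_preimage, (extChartAt (𝓡 n) j).left_inv hy']
      exact (extChartAt (𝓡 n) i).map_target hy
    · rintro z ⟨hz, hz'⟩
      refine ⟨extChartAt (𝓡 n) i ((extChartAt (𝓡 n) j).symm z),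
        ⟨(extChartAt (𝓡 n) i).map_source hz', ?_⟩, ?_⟩
      · simp only [mem_preimage, (extChartAt (𝓡 n) i).left_inv hz']
        exact (extChartAt (𝓡 n) j).map_target hz
      · simp only [inCharts, id, (extChartAt (𝓡 n) i).left_inv hz']
        exact (extChartAt (𝓡 n) j).right_inv hz
  rw [← himg, integral_image_eq_integral_abs_det_fderiv_smul volume (hopen i j).measurableSet
    (f' := fun y => fderiv ℝ (inCharts i j (id : M → M)) y)]
  · refine setIntegral_congr_fun (hopen i j).measurableSet fun y hy => ?_
    rw [smul_eq_mul]
    exact chartIntegrand_transition o i j φ hy.1 hy.2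
  · rintro y ⟨hy, hy'⟩
    have := contDiffAt_inCharts (u := (id : M → M)) hy contMDiffAt_id hy'
    exact (this.differentiableAt (by simp)).hasFDerivAt.hasFDerivWithinAt
  · rintro y ⟨hy, hy'⟩ z ⟨hz, hz'⟩ hyz
    have := (extChartAt (𝓡 n) j).injOn hy' hz' hyz
    exact (extChartAt (𝓡 n) i).symm.injOn hy hz this

/-- Integration by parts against the constant function `1`. -/
lemma hasCompactSupport_integral_fderiv {E : Type*} [NormedAddCommGroup E] [NormedSpace ℝ E]
    [FiniteDimensional ℝ E] [MeasurableSpace E] [BorelSpace E] (μ : Measure E)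
    [μ.IsAddHaarMeasure] {f : E → ℝ} (hf : ContDiff ℝ 1 f) (hc : HasCompactSupport f) (v : E) :
    ∫ x, fderiv ℝ f x v ∂μ = 0 := by
  have hd : Continuous fun x => fderiv ℝ f x v := (hf.continuous_fderiv (by simp)).clm_apply
    continuous_const
  have hdc : HasCompactSupport fun x => fderiv ℝ f x v := hc.fderiv_apply (𝕜 := ℝ) v
  have := integral_mul_fderiv_eq_neg_fderiv_mul_of_integrable (μ := μ) (f := fun _ => (1 : ℝ))
    (g := f) (v := v) (by simp) (by simpa using hd.integrable_of_hasCompactSupport hdc)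
    (by simpa using hf.continuous.integrable_of_hasCompactSupport hc)
    (fun x _ => differentiableAt_const _) (fun x _ => hf.differentiable (by simp) x)
  simpa using this

/-- Stokes' theorem on Euclidean space: evaluated on fixed vectors, the exterior derivative is a
signed sum of directional derivatives of compactly supported functions. -/
lemma integral_extDeriv {p : ℕ} {w : EuclideanSpace ℝ (Fin (p + 1)) →
    EuclideanSpace ℝ (Fin (p + 1)) [⋀^Fin p]→L[ℝ] ℝ} (hw : ContDiff ℝ 1 w)
    (hc : HasCompactSupport w) (v : Fin (p + 1) → EuclideanSpace ℝ (Fin (p + 1))) :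
    ∫ y, extDeriv w y v = 0 := by
  have h1 : ∀ y, extDeriv w y v = ∑ i : Fin (p + 1), (-1 : ℝ) ^ (i : ℕ) *
      fderiv ℝ (fun z => w z (i.removeNth v)) y (v i) := fun y => by
    rw [extDeriv_apply (hw.differentiable (by simp) y) v]
    refine Finset.sum_congr rfl fun i _ => ?_
    rw [zsmul_eq_mul]
    push_cast
    rfl
  have h2 : ∀ u : Fin p → EuclideanSpace ℝ (Fin (p + 1)), ContDiff ℝ 1 (fun z => w z u) := fun u =>
    (ContinuousAlternatingMap.apply ℝ (EuclideanSpace ℝ (Fin (p + 1))) ℝ u).contDiff.comp hw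
  have h3 : ∀ u : Fin p → EuclideanSpace ℝ (Fin (p + 1)), HasCompactSupport (fun z => w z u) :=
    fun u => hc.comp_left (g := fun a : EuclideanSpace ℝ (Fin (p + 1)) [⋀^Fin p]→L[ℝ] ℝ => a u) rfl
  simp only [h1]
  rw [integral_finsetSum]
  · refine Finset.sum_eq_zero fun i _ => ?_
    rw [integral_const_mul, hasCompactSupport_integral_fderiv volume (h2 _) (h3 _), mul_zero]
  · intro i _
    refine Integrable.const_mul (Continuous.integrable_of_hasCompactSupport ?_ ?_) _
    · exact ((h2 _).continuous_fderiv (by simp)).clm_apply continuous_const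
    · exact (h3 _).fderiv_apply (𝕜 := ℝ) _

/-- Stokes' theorem for a form supported in one chart. -/
lemma chartIntegral_dForm {p : ℕ} {M : Type*} [TopologicalSpace M] [T2Space M]
    [ChartedSpace (EuclideanSpace ℝ (Fin (p + 1))) M] [IsManifold (𝓡 (p + 1)) ∞ M]
    (o : ManifoldOrientation (p + 1) M) (i : M) {β : DForm (p + 1) M p} (hβ : IsSmoothForm β)
    {K : Set M} (hK : IsCompact K) (hKi : K ⊆ (extChartAt (𝓡 (p + 1)) i).source)
    (h0 : ∀ x ∉ K, β x = 0) : chartIntegral o i (dForm β) = 0 := by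
  classical
  set T := (extChartAt (𝓡 (p + 1)) i).target with hT
  have hTo : IsOpen T := isOpen_extChartAt_target i
  set K' := extChartAt (𝓡 (p + 1)) i '' K
  have hK' : IsCompact K' := isCompact_chart_image hK hKi
  -- The coordinate expression extended by zero, with the orientation sign built in. The sign is
  -- locally constant, hence harmless for smoothness, and it factors out of the exterior derivative.
  let w : EuclideanSpace ℝ (Fin (p + 1)) → EuclideanSpace ℝ (Fin (p + 1)) [⋀^Fin p]→L[ℝ] ℝ :=
    fun y => if y ∈ T then frameSign o.orient i y • inChart β i y else 0
  have hw0 : ∀ y ∉ K', w y = 0 := fun y hy => by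
    by_cases hyT : y ∈ T
    · have : β ((extChartAt (𝓡 (p + 1)) i).symm y) = 0 := h0 _ (symm_notMem_of_notMem_image hyT hy)
      simp only [w, if_pos hyT, inChart, this]
      exact smul_zero _
    · simp only [w, if_neg hyT]
  have hwT : ∀ y ∈ T, w =ᶠ[𝓝 y] fun z => frameSign o.orient i y • inChart β i z := fun y hy => by
    filter_upwards [hTo.mem_nhds hy, o.locallyConstant i y hy] with z hz hz'
    simp only [w, if_pos hz, hz']
  have hwN : ∀ y ∉ T, w =ᶠ[𝓝 y] fun _ => 0 := fun y hy => by
    have : y ∉ K' := fun h => hy (chart_image_subset hKi h)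
    filter_upwards [hK'.isClosed.isOpen_compl.mem_nhds this] with z hz
    exact hw0 z hz
  have hsmooth : ContDiff ℝ 1 w := contDiff_iff_contDiffAt.2 fun y => by
    by_cases hy : y ∈ T
    · refine ContDiffAt.congr_of_eventuallyEq ?_ (hwT y hy)
      exact ContDiffAt.const_smul _ ((hβ.contDiffAt i hy).of_le (WithTop.coe_le_coe.2 le_top))
    · exact contDiffAt_const.congr_of_eventuallyEq (hwN y hy)
  have hcs : HasCompactSupport w := HasCompactSupport.intro hK' hw0
  have key := integral_extDeriv hsmooth hcs (EuclideanSpace.basisFun (Fin (p + 1)) ℝ)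
  rw [← key]
  symm
  rw [← setIntegral_eq_integral_of_forall_compl_eq_zero (s := T)]
  · refine setIntegral_congr_fun hTo.measurableSet fun y hy => ?_
    rw [(hwT y hy).extDeriv_eq]
    change extDeriv (frameSign o.orient i y • inChart β i) y _ = _
    rw [extDeriv_smul, chartIntegrand, inChart_dForm hβ i hy]
    rfl
  · intro y hy
    rw [(hwN y hy).extDeriv_eq, extDeriv_zero_fun]
    rfl

end Integration

/-! ### Integration over a compact manifold and Stokes' theorem. -/

section CompactIntegration

open MeasureTheory

variable {n : ℕ} {M : Type*} [TopologicalSpace M] [ChartedSpace (EuclideanSpace ℝ (Fin n)) M]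
  [IsManifold (𝓡 n) ∞ M] [T2Space M] [CompactSpace M]

variable (n M) in
lemma chartPartition_subordinate (i : M) :
    tsupport (chartPartition n M i) ⊆ (extChartAt (𝓡 n) i).source := by
  rw [extChartAt_source]
  exact (SmoothPartitionOfUnity.exists_isSubordinate_chartAt_source (𝓡 n) M).choose_spec i

variable (n M) in
lemma chartPartition_finite : {i : M | (Function.support (chartPartition n M i)).Nonempty}.Finite :=
  (chartPartition n M).locallyFinite.finite_nonempty_of_compact

variable (n M) in
/-- The finite set of indices of nonzero functions in the partition of unity. -/
def chartIndices : Finset M := (chartPartition_finite n M).toFinset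

lemma chartPartition_eq_zero {i : M} (hi : i ∉ chartIndices n M) (x : M) :
    chartPartition n M i x = 0 := by
  by_contra h
  exact hi ((chartPartition_finite n M).mem_toFinset.2 ⟨x, h⟩)

lemma chartPartition_sum (x : M) : ∑ i ∈ chartIndices n M, chartPartition n M i x = 1 := by
  rw [← (chartPartition n M).sum_eq_one (mem_univ x)]
  refine (finsum_eq_sum_of_support_subset _ fun i hi => ?_).symm
  by_contra h
  exact hi (chartPartition_eq_zero h x)

lemma integral_eq_sum (o : ManifoldOrientation n M) (φ : DForm n M n) :
    integral o φ = ∑ i ∈ chartIndices n M,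
      chartIntegral o i (fun x => chartPartition n M i x • φ x) := by
  unfold integral
  rw [finsum_eq_sum_of_support_subset (s := chartIndices n M)]
  · refine Finset.sum_congr rfl fun i _ => ?_
    unfold chartIntegral
    congr 1
    funext y
    rw [chartIntegrand_smul_fun, chartIntegrand]
    ring
  · intro i hi
    by_contra h
    refine hi ?_
    simp only [chartPartition_eq_zero (fun h' => h (Finset.mem_coe.2 h'))]
    simp

lemma integrableOn_chartPartition (o : ManifoldOrientation n M) {φ : DForm n M n}
    (hφ : IsContinuousForm φ) (i : M) :
    IntegrableOn (chartIntegrand o i (fun x => chartPartition n M i x • φ x))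
      (extChartAt (𝓡 n) i).target := by
  refine (hφ.smul_fun (chartPartition n M i).contMDiff.continuous).integrableOn_chartIntegrand o
    (isClosed_tsupport (chartPartition n M i)).isCompact (chartPartition_subordinate n M i) ?_
  intro x hx
  rw [image_eq_zero_of_notMem_tsupport hx, zero_smul]

lemma chartIntegrand_add (o : ManifoldOrientation n M) (i : M) (φ ψ : DForm n M n)
    (y : EuclideanSpace ℝ (Fin n)) :
    chartIntegrand o i (φ + ψ) y = chartIntegrand o i φ y + chartIntegrand o i ψ y := by
  simp only [chartIntegrand, inChart_add, Pi.add_apply, ContinuousAlternatingMap.add_apply, mul_add]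

lemma chartIntegrand_smul (o : ManifoldOrientation n M) (i : M) (c : ℝ) (φ : DForm n M n)
    (y : EuclideanSpace ℝ (Fin n)) :
    chartIntegrand o i (c • φ) y = c * chartIntegrand o i φ y :=
  chartIntegrand_smul_fun o i (fun _ => c) φ y

lemma integral_add (o : ManifoldOrientation n M) {φ ψ : DForm n M n} (hφ : IsContinuousForm φ)
    (hψ : IsContinuousForm ψ) : integral o (φ + ψ) = integral o φ + integral o ψ := by
  simp only [integral_eq_sum, ← Finset.sum_add_distrib]
  refine Finset.sum_congr rfl fun i _ => ?_
  have h : (fun x => chartPartition n M i x • (φ + ψ) x : DForm n M n) =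
      (fun x => chartPartition n M i x • φ x) + fun x => chartPartition n M i x • ψ x := by
    funext x; exact smul_add _ _ _
  rw [h]
  simp only [chartIntegral, chartIntegrand_add]
  exact MeasureTheory.integral_add (integrableOn_chartPartition o hφ i)
    (integrableOn_chartPartition o hψ i)

lemma integral_smul (o : ManifoldOrientation n M) (c : ℝ) (φ : DForm n M n) :
    integral o (c • φ) = c * integral o φ := by
  simp only [integral_eq_sum, Finset.mul_sum]
  refine Finset.sum_congr rfl fun i _ => ?_
  have h : (fun x => chartPartition n M i x • (c • φ) x : DForm n M n) =
      c • (fun x => chartPartition n M i x • φ x : DForm n M n) := by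
    funext x; exact smul_comm (chartPartition n M i x) c (φ x)
  rw [h]
  simp only [chartIntegral, chartIntegrand_smul]
  exact integral_const_mul _ _

lemma integral_sub (o : ManifoldOrientation n M) {φ ψ : DForm n M n} (hφ : IsContinuousForm φ)
    (hψ : IsContinuousForm ψ) : integral o (φ - ψ) = integral o φ - integral o ψ := by
  rw [sub_eq_add_neg, ← neg_one_smul ℝ ψ, integral_add o hφ (hψ.smul _), integral_smul]
  ring

/-- The integral of a form supported in a chart domain can be computed in that chart. -/
lemma integral_eq_chartIntegral (o : ManifoldOrientation n M) {φ : DForm n M n}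
    (hφ : IsContinuousForm φ) {j : M} {K : Set M} (hK : IsCompact K)
    (hKj : K ⊆ (extChartAt (𝓡 n) j).source) (h0 : ∀ x ∉ K, φ x = 0) :
    integral o φ = chartIntegral o j φ := by
  have hK0 : ∀ (f : M → ℝ), ∀ x ∉ K, f x • φ x = 0 := fun f x hx => by rw [h0 x hx, smul_zero]
  rw [integral_eq_sum]
  -- Each piece `ρ_i φ` lives in both chart domains, so it can be moved to chart `j`, where the
  -- functions `ρ_i` sum to one under a single integral.
  have h1 : ∀ i ∈ chartIndices n M, chartIntegral o i (fun x => chartPartition n M i x • φ x) =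
      chartIntegral o j (fun x => chartPartition n M i x • φ x) := fun i _ => by
    refine chartIntegral_eq_of_support o i j _ fun x hx => ⟨?_, ?_⟩
    · refine chartPartition_subordinate n M i (subset_tsupport _ ?_)
      rw [Function.mem_support]
      intro h
      exact hx (by rw [h, zero_smul])
    · by_contra h
      exact hx (hK0 _ x fun h' => h (hKj h'))
  rw [Finset.sum_congr rfl h1]
  unfold chartIntegral
  rw [← integral_finsetSum]
  · congr 1
    funext y
    simp only [chartIntegrand_smul_fun]
    rw [← Finset.sum_mul, chartPartition_sum, one_mul]
  · intro i _
    exact (hφ.smul_fun (chartPartition n M i).contMDiff.continuous).integrableOn_chartIntegrand o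
      hK hKj (hK0 _)

lemma dForm_sum {ι : Type*} {p : ℕ} (s : Finset ι) (φ : ι → DForm n M p)
    (h : ∀ i ∈ s, IsSmoothForm (φ i)) :
    IsSmoothForm (∑ i ∈ s, φ i) ∧ dForm (∑ i ∈ s, φ i) = ∑ i ∈ s, dForm (φ i) := by
  classical
  induction s using Finset.induction_on with
  | empty => exact ⟨by simpa using isSmoothForm_zero, by simpa using dForm_zero⟩
  | insert a s ha ih =>
    have ih' := ih fun i hi => h i (Finset.mem_insert_of_mem hi)
    have h' := h a (Finset.mem_insert_self a s)
    simp only [Finset.sum_insert ha]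
    exact ⟨h'.add ih'.1, by rw [dForm_add h' ih'.1, ih'.2]⟩

lemma integral_zero (o : ManifoldOrientation n M) : integral o (0 : DForm n M n) = 0 := by
  have := integral_smul o 0 (0 : DForm n M n)
  rwa [zero_smul, zero_mul] at this

lemma integral_sum (o : ManifoldOrientation n M) {ι : Type*} (s : Finset ι) (φ : ι → DForm n M n)
    (h : ∀ i ∈ s, IsSmoothForm (φ i)) :
    integral o (∑ i ∈ s, φ i) = ∑ i ∈ s, integral o (φ i) := by
  classical
  induction s using Finset.induction_on with
  | empty => simpa using integral_zero o
  | insert a s ha ih =>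
    have hs := fun i hi => h i (Finset.mem_insert_of_mem hi)
    simp only [Finset.sum_insert ha]
    rw [integral_add o (h a (Finset.mem_insert_self a s)).isContinuousForm
      (dForm_sum s φ hs).1.isContinuousForm, ih hs]

/-- Stokes' theorem on a closed manifold. -/
lemma integral_dForm {p : ℕ} {M : Type*} [TopologicalSpace M] [T2Space M] [CompactSpace M]
    [ChartedSpace (EuclideanSpace ℝ (Fin (p + 1))) M] [IsManifold (𝓡 (p + 1)) ∞ M]
    (o : ManifoldOrientation (p + 1) M) {β : DForm (p + 1) M p} (hβ : IsSmoothForm β) :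
    integral o (dForm β) = 0 := by
  let φ : M → DForm (p + 1) M p := fun i x => chartPartition (p + 1) M i x • β x
  have hφ : ∀ i, IsSmoothForm (φ i) := fun i => hβ.smul_fun (chartPartition (p + 1) M i).contMDiff
  have hsum : β = ∑ i ∈ chartIndices (p + 1) M, φ i := by
    funext x
    rw [Finset.sum_apply, ← Finset.sum_smul, chartPartition_sum, one_smul]
  rw [hsum, (dForm_sum _ φ fun i _ => hφ i).2, integral_sum o _ _ fun i _ => (hφ i).dForm]
  refine Finset.sum_eq_zero fun i _ => ?_
  have hK := (isClosed_tsupport (chartPartition (p + 1) M i)).isCompact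
  have h0 : ∀ x ∉ tsupport (chartPartition (p + 1) M i), φ i x = 0 := fun x hx => by
    simp only [φ]
    rw [image_eq_zero_of_notMem_tsupport hx, zero_smul]
  -- Outside the closed support the form vanishes on a neighbourhood, hence its exterior derivative
  -- vanishes too.
  have h1 : ∀ x ∉ tsupport (chartPartition (p + 1) M i), dForm (φ i) x = 0 := fun x hx => by
    have e : inChart (φ i) x =ᶠ[𝓝 (extChartAt (𝓡 (p + 1)) x x)] fun _ => 0 := by
      have := eventually_mem_chart (u := (id : M → M)) x
        (mem_extChartAt_target (I := 𝓡 (p + 1)) x) continuousAt_id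
        (isClosed_tsupport (chartPartition (p + 1) M i)).isOpen_compl
        (by rw [id, extChartAt_to_inv x]; exact hx)
      filter_upwards [this] with z hz
      exact inChart_eq_zero (h0 _ hz.2)
    simp only [dForm, e.extDeriv_eq]
    ext v
    rw [extDeriv_zero_fun]
    rfl
  rw [integral_eq_chartIntegral o (hφ i).dForm.isContinuousForm hK
    (chartPartition_subordinate (p + 1) M i) h1]
  exact chartIntegral_dForm o i (hφ i) hK (chartPartition_subordinate (p + 1) M i) h0

end CompactIntegration

/-! ### The pointwise inequality -/

section Pointwise

open Equiv

/-- The inequality of arithmetic and geometric means for the numbers `s j ^ 2` with weights `1/k`.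
Both sides are nonnegative, so they are compared through their squares; the equality case is that of
the means. -/
lemma prod_le_of_sum_sq {k : ℕ} (hk : k ≠ 0) (s : Fin k → ℝ) (hs : ∀ j, 0 ≤ s j) :
    ∏ j, s j ≤ (√k ^ k)⁻¹ * √(∑ j, s j ^ 2) ^ k ∧
      (∏ j, s j = (√k ^ k)⁻¹ * √(∑ j, s j ^ 2) ^ k →
        ∀ j, s j ^ 2 = (k : ℝ)⁻¹ * ∑ j, s j ^ 2) := by
  have hk' : (0 : ℝ) < k := by positivity
  set N := ∑ j, s j ^ 2 with hN
  have hN0 : 0 ≤ N := Finset.sum_nonneg fun j _ => sq_nonneg _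
  have hw : ∀ i ∈ (Finset.univ : Finset (Fin k)), (0 : ℝ) < (fun _ => (k : ℝ)⁻¹) i :=
    fun i _ => inv_pos.2 hk'
  have hw' : ∑ i : Fin k, (fun _ => (k : ℝ)⁻¹) i = 1 := by
    simp [mul_inv_cancel₀ hk'.ne']
  have hz : ∀ i ∈ (Finset.univ : Finset (Fin k)), 0 ≤ s i ^ 2 := fun i _ => sq_nonneg _
  have hmean : ∑ i : Fin k, (k : ℝ)⁻¹ * s i ^ 2 = (k : ℝ)⁻¹ * N := by rw [← Finset.mul_sum]
  have h1 := Real.geom_mean_le_arith_mean_weighted Finset.univ (fun _ => (k : ℝ)⁻¹)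
    (fun i => s i ^ 2) (fun i hi => (hw i hi).le) hw' hz
  have h2 := Real.geom_mean_eq_arith_mean_weighted_iff_of_pos' Finset.univ (fun _ => (k : ℝ)⁻¹)
    (fun i => s i ^ 2) hw hw' hz
  simp only [hmean] at h1 h2
  set G := ∏ i, (s i ^ 2) ^ (k : ℝ)⁻¹ with hG
  have hG0 : 0 ≤ G := Finset.prod_nonneg fun i _ => Real.rpow_nonneg (sq_nonneg _) _
  have hGk : G ^ k = (∏ j, s j) ^ 2 := by
    rw [hG, ← Finset.prod_pow, ← Finset.prod_pow]
    exact Finset.prod_congr rfl fun i _ => Real.rpow_inv_natCast_pow (sq_nonneg _) hk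
  have hr : (√k ^ k)⁻¹ * √N ^ k = (√N / √k) ^ k := by rw [div_pow]; ring
  have hr2 : ((√N / √k) ^ k) ^ 2 = ((k : ℝ)⁻¹ * N) ^ k := by
    rw [← pow_mul, mul_comm k 2, pow_mul, div_pow, Real.sq_sqrt hN0, Real.sq_sqrt hk'.le]
    congr 1; ring
  have hr0 : 0 ≤ (√N / √k) ^ k := by positivity
  have hP0 : 0 ≤ ∏ j, s j := Finset.prod_nonneg fun j _ => hs j
  rw [hr]
  constructor
  · refine (sq_le_sq₀ hP0 hr0).1 ?_
    rw [hr2, ← hGk]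
    exact pow_le_pow_left₀ hG0 h1 k
  · intro h j
    refine h2.1 ?_ j (Finset.mem_univ j)
    have : G ^ k = ((k : ℝ)⁻¹ * N) ^ k := by rw [hGk, h, hr2]
    exact (pow_left_inj₀ hG0 (by positivity) hk).1 this

/-- A permutation that puts a vector of the first block into `b` contributes zero. The others
permute the two blocks separately; there are `m! k!` of them, all contributing equally, which
cancels the normalization of the wedge. -/
lemma wedge_apply_block {V : Type*} [AddCommGroup V] [Module ℝ V] [TopologicalSpace V]
    [IsTopologicalAddGroup V] [ContinuousConstSMul ℝ V] {m k : ℕ} (a : V [⋀^Fin m]→L[ℝ] ℝ)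
    (b : V [⋀^Fin k]→L[ℝ] ℝ) (v : Fin (m + k) → V)
    (h : ∀ (w : Fin k → V) (j : Fin k) (i : Fin m), w j = v (Fin.castAdd k i) → b w = 0) :
    wedge a b v = a (v ∘ Fin.castAdd k) * b (v ∘ Fin.natAdd m) := by
  have hm : (m.factorial : ℝ) ≠ 0 := by positivity
  have hk : (k.factorial : ℝ) ≠ 0 := by positivity
  have hperm : ∀ {n : ℕ} (a : V [⋀^Fin n]→L[ℝ] ℝ) (τ : Perm (Fin n)) (w : Fin n → V),
      a (w ∘ τ) = ((Perm.sign τ : ℤ) : ℝ) * a w := fun a τ w => by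
    refine (a.toAlternatingMap.map_perm w τ).trans ?_
    rw [Units.smul_def, zsmul_eq_mul]; rfl
  rw [wedge_apply]
  have key : alternation (fun w => a (w ∘ Fin.castAdd k) * b (w ∘ Fin.natAdd m)) v =
      ∑ q : Perm (Fin m) × Perm (Fin k), a (v ∘ Fin.castAdd k) * b (v ∘ Fin.natAdd m) := by
    unfold alternation
    symm
    refine Finset.sum_of_injOn
      (fun q : Perm (Fin m) × Perm (Fin k) => finSumFinEquiv.permCongr (Equiv.sumCongr q.1 q.2))
      ?_ (fun _ _ => Finset.mem_coe.2 (Finset.mem_univ _)) ?_ ?_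
    · intro q _ q' _ hq
      exact Perm.sumCongrHom_injective (finSumFinEquiv.permCongr.injective hq)
    · intro σ _ hσ
      suffices ∃ j i, σ (Fin.natAdd m j) = Fin.castAdd k i by
        obtain ⟨j, i, hij⟩ := this
        have : b ((v ∘ σ) ∘ Fin.natAdd m) = 0 := h _ j i (by simp [hij])
        simp only [this, mul_zero]
      -- If `σ` maps the last block into itself, finiteness makes it preserve the first block too,
      -- so it comes from a pair of permutations.
      by_contra! hne
      refine hσ ?_
      have hmaps : Set.MapsTo (finSumFinEquiv.permCongr.symm σ) (Set.range Sum.inr)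
          (Set.range (Sum.inr : Fin k → Fin m ⊕ Fin k)) := by
        rintro _ ⟨j, rfl⟩
        rcases hx : finSumFinEquiv.permCongr.symm σ (Sum.inr j) with i | i
        · exfalso
          refine hne j i ?_
          have := congrArg finSumFinEquiv hx
          simpa using this
        · exact ⟨i, rfl⟩
      obtain ⟨q, hq⟩ := Perm.mem_sumCongrHom_range_of_perm_mapsTo_inl
        ((Perm.perm_mapsTo_inl_iff_mapsTo_inr _).2 hmaps)
      refine ⟨q, Finset.mem_coe.2 (Finset.mem_univ _), ?_⟩
      have := congrArg finSumFinEquiv.permCongr hq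
      rw [Equiv.apply_symm_apply] at this
      exact this
    · rintro ⟨τ, τ'⟩ _
      have e1 : (v ∘ finSumFinEquiv.permCongr (Equiv.sumCongr τ τ')) ∘ Fin.castAdd k =
          (v ∘ Fin.castAdd k) ∘ τ := by
        funext j; simp
      have e2 : (v ∘ finSumFinEquiv.permCongr (Equiv.sumCongr τ τ')) ∘ Fin.natAdd m =
          (v ∘ Fin.natAdd m) ∘ τ' := by
        funext j; simp
      simp only [e1, e2, hperm, Perm.sign_permCongr, Perm.sign_sumCongr]
      have h1 := sign_mul_self m τ
      have h2 := sign_mul_self k τ'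
      push_cast
      linear_combination (-(a (v ∘ Fin.castAdd k)) * b (v ∘ Fin.natAdd m)) *
        (h1 + ((Perm.sign τ : ℤ) : ℝ) * ((Perm.sign τ : ℤ) : ℝ) * h2)
  rw [key]
  simp only [Finset.sum_const, Finset.card_univ, Fintype.card_prod, Fintype.card_perm,
    Fintype.card_fin, nsmul_eq_mul]
  push_cast
  field_simp

variable {V W : Type*} [NormedAddCommGroup V] [InnerProductSpace ℝ V] [FiniteDimensional ℝ V]
  [NormedAddCommGroup W] [InnerProductSpace ℝ W] [FiniteDimensional ℝ W]

/-- Both sums are the trace of `A^* A`. Hence `normDu` may be computed in whichever orthonormal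
basis is adapted to the problem. -/
lemma sum_norm_sq_apply {ι ι' : Type*} [Fintype ι] [Fintype ι'] (A : V →ₗ[ℝ] W)
    (b : OrthonormalBasis ι ℝ V) (b' : OrthonormalBasis ι' ℝ V) :
    ∑ i, ‖A (b i)‖ ^ 2 = ∑ i, ‖A (b' i)‖ ^ 2 := by
  have h : ∀ v, ‖A v‖ ^ 2 = inner ℝ v ((A.adjoint ∘ₗ A) v) := fun v => by
    rw [LinearMap.comp_apply, LinearMap.adjoint_inner_right, real_inner_self_eq_norm_sq]
  simp only [h]
  rw [← LinearMap.trace_eq_sum_inner, ← LinearMap.trace_eq_sum_inner]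

/-- The spectral theorem for `S = B^* B`, where `B` is `A` restricted to `K`: eigenvectors of `S`
have orthogonal images, with squared norms the eigenvalues. If these all equal `c`, then `S` is `c`
times the identity. -/
lemma exists_orthonormal_diagonalization {k : ℕ} (K : Submodule ℝ V)
    (hK : Module.finrank ℝ K = k) (A : V →ₗ[ℝ] W) :
    ∃ f : OrthonormalBasis (Fin k) ℝ K, (Pairwise fun i j => inner ℝ (A (f i)) (A (f j)) = 0) ∧
      ∀ c : ℝ, (∀ j, ‖A (f j)‖ ^ 2 = c) → ∀ x y : K, inner ℝ (A x) (A y) = c * inner ℝ x y := by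
  let B : K →ₗ[ℝ] W := A ∘ₗ K.subtype
  let S : K →ₗ[ℝ] K := B.adjoint ∘ₗ B
  have hin : ∀ x y : K, inner ℝ (A x) (A y) = inner ℝ x (S y) := fun x y => by
    rw [LinearMap.comp_apply, LinearMap.adjoint_inner_right]; rfl
  have hS : S.IsSymmetric := fun x y => by
    rw [← hin, real_inner_comm, ← hin, real_inner_comm]
  refine ⟨hS.eigenvectorBasis hK, fun i j hij => ?_, fun c hc x y => ?_⟩
  · beta_reduce
    rw [hin, hS.apply_eigenvectorBasis, inner_smul_right,
      (hS.eigenvectorBasis hK).orthonormal.2 hij, mul_zero]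
  · have h1 : S = c • LinearMap.id := by
      refine (hS.eigenvectorBasis hK).toBasis.ext fun j => ?_
      have h2 := hc j
      rw [← real_inner_self_eq_norm_sq, hin, hS.apply_eigenvectorBasis, inner_smul_right,
        real_inner_self_eq_norm_sq, (hS.eigenvectorBasis hK).orthonormal.1] at h2
      rw [OrthonormalBasis.coe_toBasis, hS.apply_eigenvectorBasis]
      simp only [LinearMap.smul_apply, LinearMap.id_apply]
      congr 1
      simpa using h2
    rw [hin, h1, LinearMap.smul_apply, LinearMap.id_apply, inner_smul_right]

/-- A top degree form is determined by its value on an orthonormal basis. -/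
lemma eq_smul_volumeForm {n : ℕ} [Fact (Module.finrank ℝ V = n)] (o : Orientation ℝ V (Fin n))
    (t : V [⋀^Fin n]→ₗ[ℝ] ℝ) (B : OrthonormalBasis (Fin n) ℝ V) :
    ∃ c : ℝ, t = c • o.volumeForm ∧ |c| = |t B| := by
  have h1 := o.abs_volumeForm_apply_of_orthonormal B
  have h2 : o.volumeForm B * o.volumeForm B = 1 := by
    rw [← abs_mul_abs_self, h1, one_mul]
  have ht := t.eq_smul_basis_det B.toBasis
  have hv := o.volumeForm.eq_smul_basis_det B.toBasis
  rw [OrthonormalBasis.coe_toBasis] at ht hv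
  refine ⟨t B * o.volumeForm B, ?_, by rw [abs_mul, h1, mul_one]⟩
  rw [hv]
  nth_rw 1 [ht]
  rw [smul_smul, AlternatingMap.smul_apply, ← OrthonormalBasis.coe_toBasis,
    Module.Basis.det_self, smul_eq_mul, mul_one, mul_assoc, OrthonormalBasis.coe_toBasis,
    h2, mul_one]

/-- The linear algebra behind the calibration bound. A basis adapted to `ker A` and to the singular
directions of `A` on its complement turns the wedge into a product, controlled by the bound on `a`
and the inequality of the means. -/
theorem calibrated_wedge {m k : ℕ} (hk : k ≠ 0) [Fact (Module.finrank ℝ V = m + k)]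
    [Fact (Module.finrank ℝ W = k)] (oV : Orientation ℝ V (Fin (m + k)))
    (oW : Orientation ℝ W (Fin k)) (A : V →L[ℝ] W) (a : V [⋀^Fin m]→L[ℝ] ℝ)
    (ha : ∀ e : Fin m → V, Orthonormal ℝ e → |a e| ≤ 1) (b : V [⋀^Fin k]→L[ℝ] ℝ)
    (hb : ∀ v, b v = oW.volumeForm (A ∘ v)) {ι : Type*} [Fintype ι] (e : OrthonormalBasis ι ℝ V) :
    ∃ c : ℝ, (wedge a b).toAlternatingMap = c • oV.volumeForm ∧
      |c| ≤ (√k ^ k)⁻¹ * √(∑ i, ‖A (e i)‖ ^ 2) ^ k ∧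
      (c = (√k ^ k)⁻¹ * √(∑ i, ‖A (e i)‖ ^ 2) ^ k → ∀ v w : V,
        inner ℝ (A v) (A w) = (k : ℝ)⁻¹ * √(∑ i, ‖A (e i)‖ ^ 2) ^ 2 *
          inner ℝ (A.kerᗮ.starProjection v) (A.kerᗮ.starProjection w)) := by
  have hk' : (0 : ℝ) < k := by positivity
  set N := ∑ i, ‖A (e i)‖ ^ 2 with hN
  have hN0 : 0 ≤ N := Finset.sum_nonneg fun j _ => sq_nonneg _
  by_cases hsurj : Function.Surjective A
  swap
  -- The image of any `k` vectors fails to span `W`, so it is linearly dependent and the volume form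
  -- kills it.
  · have hb0 : b = 0 := by
      ext v
      rw [hb]
      refine oW.volumeForm.map_linearDependent _ fun hli => hsurj ?_
      have hspan := hli.span_eq_top_of_card_eq_finrank'
        (by rw [Fintype.card_fin]; exact (Fact.out : Module.finrank ℝ W = k).symm)
      have : LinearMap.range A.toLinearMap = ⊤ := by
        rw [eq_top_iff, ← hspan, Submodule.span_le]
        rintro _ ⟨i, rfl⟩
        exact ⟨v i, rfl⟩
      exact LinearMap.range_eq_top.1 this
    refine ⟨0, ?_, by rw [abs_zero]; positivity, fun h v w => ?_⟩
    · rw [hb0]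
      ext v
      have : wedge a (0 : V [⋀^Fin k]→L[ℝ] ℝ) = 0 := by
        have := wedge_smul_right 0 a (0 : V [⋀^Fin k]→L[ℝ] ℝ)
        rwa [zero_smul, zero_smul] at this
      rw [this, zero_smul]
      rfl
    -- Here `c = 0`, so equality forces `N = 0` and then `A = 0`; both sides of the conformality
    -- equation vanish.
    · have h1 : √N = 0 := by
        have : √N ^ k = 0 := by
          rcases mul_eq_zero.1 h.symm with h' | h'
          · exact absurd h' (by positivity)
          · exact h'
        exact pow_eq_zero_iff hk |>.1 this
      have h2 : N = 0 := (Real.sqrt_eq_zero hN0).1 h1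
      have h3 : ∀ i, A (e i) = 0 := fun i => by
        have := (Finset.sum_eq_zero_iff_of_nonneg fun j _ => sq_nonneg _).1 h2 i (Finset.mem_univ i)
        simpa using this
      have h4 : A.toLinearMap = 0 := e.toBasis.ext fun i => by simpa using h3 i
      have h5 : ∀ x, A x = 0 := fun x => LinearMap.congr_fun h4 x
      rw [h5, inner_zero_left, h1]
      simp
  · have hrk : Module.finrank ℝ A.kerᗮ = k ∧ Module.finrank ℝ A.ker = m := by
      have h1 := LinearMap.finrank_range_add_finrank_ker A.toLinearMap
      rw [LinearMap.range_eq_top.2 hsurj, finrank_top, (Fact.out : Module.finrank ℝ W = k),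
        (Fact.out : Module.finrank ℝ V = m + k)] at h1
      have h2 := Submodule.finrank_add_finrank_orthogonal A.ker
      rw [(Fact.out : Module.finrank ℝ V = m + k)] at h2
      have h3 : Module.finrank ℝ A.ker = m := by
        have : Module.finrank ℝ A.ker = Module.finrank ℝ (LinearMap.ker A.toLinearMap) := rfl
        omega
      exact ⟨by omega, h3⟩
    obtain ⟨f, hf1, hf2⟩ := exists_orthonormal_diagonalization A.kerᗮ hrk.1 A.toLinearMap
    let g : OrthonormalBasis (Fin m) ℝ A.ker :=
      (stdOrthonormalBasis ℝ A.ker).reindex (finCongr hrk.2)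
    let v : Fin m ⊕ Fin k → V := Sum.elim (fun i => (g i : V)) (fun j => (f j : V))
    have hg : Orthonormal ℝ fun i => (g i : V) :=
      g.orthonormal.comp_linearIsometry A.ker.subtypeₗᵢ
    have hf : Orthonormal ℝ fun i => (f i : V) :=
      f.orthonormal.comp_linearIsometry A.kerᗮ.subtypeₗᵢ
    have hgf : ∀ i j, inner ℝ (g i : V) (f j : V) = 0 := fun i j =>
      Submodule.inner_right_of_mem_orthogonal (g i).2 (f j).2
    have hv : Orthonormal ℝ v := by
      constructor
      · rintro (i | j)
        · exact hg.1 i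
        · exact hf.1 j
      · rintro (i | i) (j | j) hij
        · exact hg.2 fun h => hij (by rw [h])
        · exact hgf i j
        · exact (real_inner_comm _ _).trans (hgf j i)
        · exact hf.2 fun h => hij (by rw [h])
    have hv' : Orthonormal ℝ (v ∘ finSumFinEquiv.symm) :=
      hv.comp _ finSumFinEquiv.symm.injective
    obtain ⟨B, hB⟩ := Orthonormal.exists_orthonormalBasis_extension_of_card_eq
      (by rw [Fintype.card_fin]; exact (Fact.out : Module.finrank ℝ V = m + k))
      (v := v ∘ finSumFinEquiv.symm) (s := Set.univ)
      (hv'.comp (fun x : univ => x.1) Subtype.val_injective)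
    have hB1 : ∀ i, B (Fin.castAdd k i) = (g i : V) := fun i => by
      rw [hB _ (Set.mem_univ _)]; simp [v]
    have hB2 : ∀ j, B (Fin.natAdd m j) = (f j : V) := fun i => by
      rw [hB _ (Set.mem_univ _)]; simp [v]
    have hAg : ∀ i, A (g i) = 0 := fun i => (g i).2
    have hsum : N = ∑ j, ‖A (f j)‖ ^ 2 := by
      rw [hN]
      refine (sum_norm_sq_apply A.toLinearMap e B).trans ?_
      rw [Fin.sum_univ_add]
      simp [hB1, hB2]
    have hblock : wedge a b B = a (fun i => (g i : V)) * b (fun j => (f j : V)) := by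
      rw [wedge_apply_block]
      · congr 2
        · funext i; exact hB1 i
        · funext j; exact hB2 j
      -- A first-block vector lies in `ker A`, so it puts a zero argument into the volume form.
      · intro w j i hji
        rw [hb]
        refine oW.volumeForm.map_coord_zero j ?_
        rw [Function.comp_apply, hji, hB1, hAg]
    have hbf : |b (fun j => (f j : V))| = ∏ j, ‖A (f j)‖ := by
      rw [hb]
      exact oW.abs_volumeForm_apply_of_pairwise_orthogonal hf1
    obtain ⟨c, hc, hc'⟩ := eq_smul_volumeForm oV (wedge a b).toAlternatingMap B
    have hc1 : |c| = |a (fun i => (g i : V))| * ∏ j, ‖A (f j)‖ := by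
      rw [hc', ← hbf, ← abs_mul]
      exact congrArg abs hblock
    have hP : 0 ≤ ∏ j, ‖A (f j)‖ := Finset.prod_nonneg fun j _ => norm_nonneg _
    have hc2 : |c| ≤ ∏ j, ‖A (f j)‖ := by
      rw [hc1]
      exact mul_le_of_le_one_left hP (ha _ hg)
    obtain ⟨hle, heq⟩ := prod_le_of_sum_sq hk (fun j => ‖A (f j)‖) fun j => norm_nonneg _
    rw [← hsum] at hle heq
    refine ⟨c, hc, hc2.trans hle, fun hceq x y => ?_⟩
    -- Equality for `c` squeezes the product between its two bounds, so the equality case of the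
    -- means applies.
    have h1 : ∏ j, ‖A (f j)‖ = (√k ^ k)⁻¹ * √N ^ k :=
      le_antisymm hle (by rw [← hceq]; exact (le_abs_self c).trans hc2)
    have h2 := hf2 _ (heq h1)
    -- `A` sees only horizontal parts, which lets the identity on `(ker A)ᗮ` extend to all of `V`.
    have hproj : ∀ x : V, A x = A (A.kerᗮ.starProjection x) := fun x => by
      have : x - A.kerᗮ.starProjection x ∈ A.ker := by
        have := Submodule.sub_starProjection_mem_orthogonal (K := A.kerᗮ) x
        rwa [Submodule.orthogonal_orthogonal] at this
      have h3 : A (x - A.kerᗮ.starProjection x) = 0 := this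
      rw [map_sub, sub_eq_zero] at h3
      exact h3
    rw [hproj x, hproj y, Real.sq_sqrt hN0]
    exact h2 ⟨_, Submodule.starProjection_apply_mem _ x⟩ ⟨_, Submodule.starProjection_apply_mem _ y⟩

end Pointwise

/-! ### The metric in coordinates -/

section MatrixSmooth

variable {X : Type*} [NormedAddCommGroup X] [NormedSpace ℝ X] {n : ℕ} {r : ℕ∞ω}

lemma contDiffOn_det {G : X → Matrix (Fin n) (Fin n) ℝ} {s : Set X}
    (h : ∀ a b, ContDiffOn ℝ r (fun z => G z a b) s) : ContDiffOn ℝ r (fun z => (G z).det) s := by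
  simp only [Matrix.det_apply']
  exact ContDiffOn.sum fun σ _ => contDiffOn_const.mul (contDiffOn_prod fun i _ => h _ _)

/-- Cramer's rule: the entries are cofactors divided by the determinant. -/
lemma contDiffOn_inv {G : X → Matrix (Fin n) (Fin n) ℝ} {s : Set X}
    (h : ∀ a b, ContDiffOn ℝ r (fun z => G z a b) s) (h0 : ∀ z ∈ s, (G z).det ≠ 0) (a b : Fin n) :
    ContDiffOn ℝ r (fun z => (G z)⁻¹ a b) s := by
  simp only [Matrix.inv_def, Matrix.smul_apply, Matrix.adjugate_apply, Ring.inverse_eq_inv',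
    smul_eq_mul]
  refine ((contDiffOn_det h).inv h0).mul (contDiffOn_det fun c d => ?_)
  by_cases hc : c = b
  · subst hc
    simp only [Matrix.updateRow_self]
    exact contDiffOn_const
  · simp only [Matrix.updateRow_ne hc]
    exact h c d

end MatrixSmooth

/-! ### Gram matrices, volume and the norm of a linear map. -/

section Gram

variable {V W : Type*} [NormedAddCommGroup V] [InnerProductSpace ℝ V]
  [NormedAddCommGroup W] [InnerProductSpace ℝ W] {n : ℕ}

/-- The Gram matrix of a family of vectors. -/
def gramMatrix (f : Fin n → V) : Matrix (Fin n) (Fin n) ℝ :=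
  Matrix.of fun a b => inner ℝ (f a) (f b)

lemma gramMatrix_apply_eq (A : V →ₗ[ℝ] W) (e : OrthonormalBasis (Fin n) ℝ V) (f : Fin n → V) :
    gramMatrix (fun a => A (f a)) =
      (e.toBasis.toMatrix f).transpose * gramMatrix (fun a => A (e a)) * e.toBasis.toMatrix f := by
  have h : ∀ a, A (f a) = ∑ c, e.toBasis.toMatrix f c a • A (e c) := fun a => by
    conv_lhs => rw [← e.toBasis.sum_toMatrix_smul_self f a]
    rw [map_sum]
    simp
  ext a b
  simp only [gramMatrix, Matrix.of_apply, Matrix.mul_apply, Matrix.transpose_apply]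
  rw [h a, h b, sum_inner]
  simp only [inner_sum, inner_smul_left, inner_smul_right, Finset.sum_mul, starRingEnd_apply,
    star_trivial]
  rw [Finset.sum_comm]
  exact Finset.sum_congr rfl fun c _ => Finset.sum_congr rfl fun d _ => by ring

lemma gramMatrix_orthonormal (e : OrthonormalBasis (Fin n) ℝ V) :
    gramMatrix (fun a => e a) = 1 := by
  ext a b
  rw [gramMatrix, Matrix.of_apply, Matrix.one_apply]
  exact orthonormal_iff_ite.1 e.orthonormal a b

lemma gramMatrix_eq (e : OrthonormalBasis (Fin n) ℝ V) (f : Fin n → V) :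
    gramMatrix f = (e.toBasis.toMatrix f).transpose * e.toBasis.toMatrix f := by
  have := gramMatrix_apply_eq (LinearMap.id : V →ₗ[ℝ] V) e f
  simp only [LinearMap.id_apply, gramMatrix_orthonormal, Matrix.mul_one] at this
  exact this

/-- With `P` the matrix of `f` in an orthonormal basis, the Gram matrix is `Pᵀ P`, while the volume
of `f` is `± det P`. -/
lemma sq_volumeForm_eq_det_gramMatrix [Fact (Module.finrank ℝ V = n)] (o : Orientation ℝ V (Fin n))
    (e : OrthonormalBasis (Fin n) ℝ V) (f : Fin n → V) :
    o.volumeForm f ^ 2 = (gramMatrix f).det := by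
  rw [gramMatrix_eq e f, Matrix.det_mul, Matrix.det_transpose, ← sq_abs,
    o.volumeForm_robust' e, sq_abs, Module.Basis.det_apply, sq]

/-- Expresses `|A|²` in an arbitrary frame. In the coordinate frame this shows smooth dependence on
the point, which orthonormal bases chosen pointwise do not. -/
lemma sum_norm_sq_eq_trace (A : V →ₗ[ℝ] W) (e : OrthonormalBasis (Fin n) ℝ V) (f : Fin n → V)
    (hf : (gramMatrix f).det ≠ 0) :
    ∑ i, ‖A (e i)‖ ^ 2 = ((gramMatrix f)⁻¹ * gramMatrix (fun a => A (f a))).trace := by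
  have hG := gramMatrix_eq e f
  have hH := gramMatrix_apply_eq A e f
  set P := e.toBasis.toMatrix f
  set Q := gramMatrix (fun a => A (e a)) with hQ
  have hP : IsUnit P.det := by
    rw [isUnit_iff_ne_zero]
    intro h
    rw [hG, Matrix.det_mul, h, mul_zero] at hf
    exact hf rfl
  have hP' : IsUnit P.transpose.det := by rwa [Matrix.det_transpose]
  rw [hH, hG, Matrix.mul_inv_rev]
  have h1 : P⁻¹ * P.transpose⁻¹ * (P.transpose * Q * P) = P⁻¹ * (Q * P) := by
    rw [Matrix.mul_assoc P⁻¹, Matrix.mul_assoc P.transpose Q P,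
      Matrix.nonsing_inv_mul_cancel_left _ _ hP']
  rw [h1, Matrix.trace_mul_comm, Matrix.mul_assoc, Matrix.mul_nonsing_inv _ hP, Matrix.mul_one,
    Matrix.trace]
  exact Finset.sum_congr rfl fun i _ => (real_inner_self_eq_norm_sq _).symm

/-- `frameSign` uses an arbitrary representative of the orientation ray; the volume form represents
the same ray. Positive dimension provides an orthonormal basis inducing the orientation. -/
lemma sign_someVector [Fact (Module.finrank ℝ V = n)] (hn : 0 < n) (o : Orientation ℝ V (Fin n))
    (f : Fin n → V) : SignType.sign (o.someVector f) = SignType.sign (o.volumeForm f) := by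
  have h1 := o.volumeForm_robust _ (o.finOrthonormalBasis_orientation hn Fact.out)
  have h2 : SameRay ℝ o.someVector o.volumeForm := by
    rw [h1, ← ray_eq_iff o.someVector_ne_zero (Module.Basis.det_ne_zero _), o.someVector_ray]
    exact (o.finOrthonormalBasis_orientation hn Fact.out).symm
  obtain ⟨r, s, hr, hs, h⟩ := h2.exists_pos o.someVector_ne_zero
    (by rw [h1]; exact Module.Basis.det_ne_zero _)
  have h3 : r * o.someVector f = s * o.volumeForm f :=
    congrArg (fun t : V [⋀^Fin n]→ₗ[ℝ] ℝ => t f) h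
  have h4 := congrArg SignType.sign h3
  rwa [sign_mul, sign_mul, sign_pos hr, sign_pos hs, one_mul, one_mul] at h4

end Gram

/-! ### The coordinate frame and the density of the volume form. -/

section Metric

variable {n : ℕ} {M : Type*} [TopologicalSpace M] [ChartedSpace (EuclideanSpace ℝ (Fin n)) M]
  [IsManifold (𝓡 n) ∞ M]

lemma mfderiv_extChartAt_chartFrame (i : M) {y : EuclideanSpace ℝ (Fin n)}
    (hy : y ∈ (extChartAt (𝓡 n) i).target) (v : EuclideanSpace ℝ (Fin n)) :
    mfderiv (𝓡 n) 𝓘(ℝ, EuclideanSpace ℝ (Fin n)) (extChartAt (𝓡 n) i)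
      ((extChartAt (𝓡 n) i).symm y) (chartFrame i y v) = v := by
  have hs := (extChartAt (𝓡 n) i).map_target hy
  have h := mfderiv_comp y (mdifferentiableAt_chart i hs) (mdifferentiableAt_symm i hy)
  have e : extChartAt (𝓡 n) i ∘ (extChartAt (𝓡 n) i).symm =ᶠ[𝓝 y] id := by
    filter_upwards [(isOpen_extChartAt_target (I := 𝓡 n) i).mem_nhds hy] with z hz
    exact (extChartAt (𝓡 n) i).right_inv hz
  have e' := e.mfderiv_eq (I := 𝓘(ℝ, EuclideanSpace ℝ (Fin n)))
    (I' := 𝓘(ℝ, EuclideanSpace ℝ (Fin n)))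
  rw [mfderiv_id] at e'
  exact (DFunLike.congr_fun h v).symm.trans (DFunLike.congr_fun e' v)

lemma chartFrame_injective (i : M) {y : EuclideanSpace ℝ (Fin n)}
    (hy : y ∈ (extChartAt (𝓡 n) i).target) : Function.Injective (chartFrame i y) :=
  Function.LeftInverse.injective (mfderiv_extChartAt_chartFrame i hy)

lemma eq_of_inChart_eq {p : ℕ} {φ η : DForm n M p} (i : M) {y : EuclideanSpace ℝ (Fin n)}
    (hy : y ∈ (extChartAt (𝓡 n) i).target) (h : inChart φ i y = inChart η i y) :
    φ ((extChartAt (𝓡 n) i).symm y) = η ((extChartAt (𝓡 n) i).symm y) := by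
  have hsurj : Function.Surjective (chartFrame i y) :=
    LinearMap.surjective_of_injective (V := EuclideanSpace ℝ (Fin n))
      (f := (chartFrame i y : EuclideanSpace ℝ (Fin n) →L[ℝ] EuclideanSpace ℝ (Fin n)).toLinearMap)
      (chartFrame_injective i hy)
  ext v
  choose w hw using fun a => hsurj (v a)
  obtain rfl : (fun a => chartFrame i y (w a)) = v := funext hw
  exact DFunLike.congr_fun h w

/-- The coordinate frame `∂₁, …, ∂ₙ` at a point of a chart. -/
def coordFrame (i : M) (y : EuclideanSpace ℝ (Fin n)) (a : Fin n) :
    TangentSpace (𝓡 n) ((extChartAt (𝓡 n) i).symm y) :=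
  chartFrame i y (EuclideanSpace.basisFun (Fin n) ℝ a)

lemma coordFrame_linearIndependent (i : M) {y : EuclideanSpace ℝ (Fin n)}
    (hy : y ∈ (extChartAt (𝓡 n) i).target) : LinearIndependent ℝ (coordFrame i y) := by
  have h := (EuclideanSpace.basisFun (Fin n) ℝ).toBasis.linearIndependent.map'
    (chartFrame i y).toLinearMap (LinearMap.ker_eq_bot.2 (chartFrame_injective i hy))
  rw [OrthonormalBasis.coe_toBasis] at h
  exact h

variable [RiemannianBundle (fun x : M => TangentSpace (𝓡 n) x)]

/-- The coordinate frame is a basis, so its determinant in an orthonormal basis is a unit. -/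
lemma volForm_coordFrame_ne_zero (o : ManifoldOrientation n M) (i : M)
    {y : EuclideanSpace ℝ (Fin n)} (hy : y ∈ (extChartAt (𝓡 n) i).target) :
    (o.orient ((extChartAt (𝓡 n) i).symm y)).volumeForm (coordFrame i y) ≠ 0 := by
  set x := (extChartAt (𝓡 n) i).symm y
  let e : OrthonormalBasis (Fin n) ℝ (TangentSpace (𝓡 n) x) :=
    (stdOrthonormalBasis ℝ (TangentSpace (𝓡 n) x)).reindex (finCongr Fact.out)
  intro h
  rw [← abs_eq_zero, (o.orient x).volumeForm_robust' e, abs_eq_zero] at h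
  have hli := coordFrame_linearIndependent i hy
  have hu := (e.toBasis.isUnit_det
    (basisOfLinearIndependentOfCardEqFinrank' (coordFrame i y) hli (by
      rw [Fintype.card_fin]; exact (Fact.out : Module.finrank ℝ (TangentSpace (𝓡 n) x) = n).symm)))
  rw [coe_basisOfLinearIndependentOfCardEqFinrank'] at hu
  exact hu.ne_zero h

lemma det_gramMatrix_pos (o : ManifoldOrientation n M) (i : M)
    {y : EuclideanSpace ℝ (Fin n)} (hy : y ∈ (extChartAt (𝓡 n) i).target) :
    0 < (gramMatrix (coordFrame i y)).det := by
  let e : OrthonormalBasis (Fin n) ℝ (TangentSpace (𝓡 n) ((extChartAt (𝓡 n) i).symm y)) :=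
    (stdOrthonormalBasis ℝ _).reindex (finCongr Fact.out)
  rw [← sq_volumeForm_eq_det_gramMatrix (o.orient _) e]
  exact sq_pos_iff.2 (volForm_coordFrame_ne_zero o i hy)

lemma frameSign_eq (hn : 0 < n) (o : ManifoldOrientation n M) (i : M)
    (y : EuclideanSpace ℝ (Fin n)) : frameSign o.orient i y =
      SignType.sign ((o.orient ((extChartAt (𝓡 n) i).symm y)).volumeForm (coordFrame i y)) := by
  unfold frameSign
  rw [← sign_someVector hn]
  rfl

/-- The Riemannian volume form has coordinate density `√(det g)`. -/
lemma chartIntegrand_volForm (hn : 0 < n) (o : ManifoldOrientation n M) (i : M)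
    (y : EuclideanSpace ℝ (Fin n)) :
    chartIntegrand o i (volForm o) y = √(gramMatrix (coordFrame i y)).det := by
  let e : OrthonormalBasis (Fin n) ℝ (TangentSpace (𝓡 n) ((extChartAt (𝓡 n) i).symm y)) :=
    (stdOrthonormalBasis ℝ _).reindex (finCongr Fact.out)
  rw [← sq_volumeForm_eq_det_gramMatrix (o.orient _) e, Real.sqrt_sq_eq_abs, chartIntegrand,
    frameSign_eq hn]
  exact (mul_comm _ _).trans (self_mul_sign _)

/-- The tangent map of `G`, applied to a constant vector field, is a smooth map to the tangent
bundle, and the metric is smooth. The general parameter space `X` covers both inverse charts and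
families depending on time. -/
lemma contDiffOn_inner_mfderiv [IsContMDiffRiemannianBundle (𝓡 n) ∞ (EuclideanSpace ℝ (Fin n))
    (fun x : M => TangentSpace (𝓡 n) x)]
    {X : Type*} [NormedAddCommGroup X] [NormedSpace ℝ X] {G : X → M} {U : Set X} (hU : IsOpen U)
    (hG : ContMDiffOn 𝓘(ℝ, X) (𝓡 n) ∞ G U) (w w' : X) :
    ContDiffOn ℝ ∞ (fun z => inner ℝ (mfderiv 𝓘(ℝ, X) (𝓡 n) G z w)
      (mfderiv 𝓘(ℝ, X) (𝓡 n) G z w')) U := by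
  have key : ∀ w : X, ContMDiffOn 𝓘(ℝ, X) ((𝓡 n).prod 𝓘(ℝ, EuclideanSpace ℝ (Fin n))) ∞
      (fun z => (⟨G z, mfderiv 𝓘(ℝ, X) (𝓡 n) G z w⟩ : TangentBundle (𝓡 n) M)) U := fun w => by
    have h1 := hG.contMDiffOn_tangentMapWithin (m := ∞) (by simp) hU.uniqueMDiffOn
    have h2 : ContMDiffOn 𝓘(ℝ, X) (𝓘(ℝ, X).prod 𝓘(ℝ, X)) ∞
        (fun z => (⟨z, w⟩ : TangentBundle 𝓘(ℝ, X) X)) U :=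
      contMDiffOn_vectorSpace_iff_contDiffOn.2 contDiffOn_const
    refine (h1.comp h2 fun z hz => hz).congr fun z hz => ?_
    simp only [Function.comp, tangentMapWithin]
    rw [mfderivWithin_of_isOpen hU hz]
  rw [← contMDiffOn_iff_contDiffOn]
  exact (key w).inner_bundle (key w')

end Metric

/-! ### Smoothness of the volume form and of the energy density. -/

section Energy

variable {n l : ℕ} {M : Type*} [TopologicalSpace M] [ChartedSpace (EuclideanSpace ℝ (Fin n)) M]
  [IsManifold (𝓡 n) ∞ M]
  [RiemannianBundle (fun x : M => TangentSpace (𝓡 n) x)]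
  [IsContMDiffRiemannianBundle (𝓡 n) ∞ (EuclideanSpace ℝ (Fin n))
    (fun x : M => TangentSpace (𝓡 n) x)]
  {L : Type*} [TopologicalSpace L] [ChartedSpace (EuclideanSpace ℝ (Fin l)) L]
  [IsManifold (𝓡 l) ∞ L]
  [RiemannianBundle (fun x : L => TangentSpace (𝓡 l) x)]
  [IsContMDiffRiemannianBundle (𝓡 l) ∞ (EuclideanSpace ℝ (Fin l))
    (fun x : L => TangentSpace (𝓡 l) x)]

lemma contDiffOn_gramMatrix (i : M) (a b : Fin n) :
    ContDiffOn ℝ ∞ (fun y => gramMatrix (coordFrame i y) a b) (extChartAt (𝓡 n) i).target :=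
  contDiffOn_inner_mfderiv (isOpen_extChartAt_target i) (contMDiffOn_extChartAt_symm i) _ _

lemma contDiffOn_sqrt_det (o : ManifoldOrientation n M) (i : M) :
    ContDiffOn ℝ ∞ (fun y => √(gramMatrix (coordFrame i y)).det) (extChartAt (𝓡 n) i).target :=
  (contDiffOn_det (contDiffOn_gramMatrix i)).sqrt fun _ hy => (det_gramMatrix_pos o i hy).ne'

/-- The Riemannian volume form is smooth. -/
lemma isSmoothForm_volForm (hn : 0 < n) (o : ManifoldOrientation n M) :
    IsSmoothForm (volForm o) := fun i y hy => by
  refine contDiffWithinAt_alternating fun v => ?_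
  have h1 : ∀ z, inChart (volForm o) i z v = inChart (volForm o) i z
      (EuclideanSpace.basisFun (Fin n) ℝ) * (EuclideanSpace.basisFun (Fin n) ℝ).toBasis.det v :=
    fun z => by
      have := (inChart (volForm o) i z).toAlternatingMap.eq_smul_basis_det
        (EuclideanSpace.basisFun (Fin n) ℝ).toBasis
      rw [OrthonormalBasis.coe_toBasis] at this
      exact congrArg (fun t : EuclideanSpace ℝ (Fin n) [⋀^Fin n]→ₗ[ℝ] ℝ => t v) this
  have h2 : ∀ᶠ z in 𝓝 y, inChart (volForm o) i z (EuclideanSpace.basisFun (Fin n) ℝ) =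
      frameSign o.orient i y * √(gramMatrix (coordFrame i z)).det := by
    filter_upwards [(isOpen_extChartAt_target i).mem_nhds hy, o.locallyConstant i y hy]
      with z hz hz'
    rw [← hz', ← chartIntegrand_volForm hn, chartIntegrand, ← mul_assoc]
    -- The volume form does not vanish on the coordinate frame, so the sign is `1` or `-1`.
    have h3 : frameSign o.orient i z * frameSign o.orient i z = 1 := by
      rw [frameSign_eq hn]
      rcases lt_or_gt_of_ne (volForm_coordFrame_ne_zero o i hz) with h | h
      · rw [sign_neg h]; simp
      · rw [sign_pos h]; simp
    rw [h3, one_mul]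
  have h3 : ContDiffAt ℝ ∞ (fun z => frameSign o.orient i y *
      √(gramMatrix (coordFrame i z)).det) y :=
    contDiffAt_const.mul ((contDiffOn_sqrt_det o i).contDiffAt
      ((isOpen_extChartAt_target i).mem_nhds hy))
  simp only [h1]
  exact ((h3.congr_of_eventuallyEq h2).mul contDiffAt_const).contDiffWithinAt

lemma contMDiffOn_comp_symm {F : ℝ → M → L} {U : Set ℝ}
    (hF : ContMDiffOn (𝓘(ℝ, ℝ).prod (𝓡 n)) (𝓡 l) ∞ (fun p : ℝ × M => F p.1 p.2) (U ×ˢ univ))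
    (i : M) : ContMDiffOn 𝓘(ℝ, ℝ × EuclideanSpace ℝ (Fin n)) (𝓡 l) ∞
      (fun p : ℝ × EuclideanSpace ℝ (Fin n) => F p.1 ((extChartAt (𝓡 n) i).symm p.2))
      (U ×ˢ (extChartAt (𝓡 n) i).target) := by
  have h1 : ContMDiffOn 𝓘(ℝ, ℝ × EuclideanSpace ℝ (Fin n)) 𝓘(ℝ, ℝ) ∞
      (fun p : ℝ × EuclideanSpace ℝ (Fin n) => p.1) (U ×ˢ (extChartAt (𝓡 n) i).target) :=
    contDiff_fst.contMDiff.contMDiffOn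
  have h2 : ContMDiffOn 𝓘(ℝ, ℝ × EuclideanSpace ℝ (Fin n)) (𝓡 n) ∞
      (fun p : ℝ × EuclideanSpace ℝ (Fin n) => (extChartAt (𝓡 n) i).symm p.2)
      (U ×ˢ (extChartAt (𝓡 n) i).target) :=
    (contMDiffOn_extChartAt_symm i).comp (f := fun p : ℝ × EuclideanSpace ℝ (Fin n) => p.2)
      contDiff_snd.contMDiff.contMDiffOn fun p hp => hp.2
  exact hF.comp (h1.prodMk h2) fun p hp => ⟨hp.1, mem_univ _⟩

/-- Writes the derivative of the single map `F t` as a partial derivative of the joint map, which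
makes its dependence on `(t, y)` smooth. -/
lemma mfderiv_coordFrame {F : ℝ → M → L} {U : Set ℝ} (hU : IsOpen U)
    (hF : ContMDiffOn (𝓘(ℝ, ℝ).prod (𝓡 n)) (𝓡 l) ∞ (fun p : ℝ × M => F p.1 p.2) (U ×ˢ univ))
    (i : M) {t : ℝ} (ht : t ∈ U) {y : EuclideanSpace ℝ (Fin n)}
    (hy : y ∈ (extChartAt (𝓡 n) i).target) (a : Fin n) :
    mfderiv (𝓡 n) (𝓡 l) (F t) ((extChartAt (𝓡 n) i).symm y) (coordFrame i y a) =
      mfderiv 𝓘(ℝ, ℝ × EuclideanSpace ℝ (Fin n)) (𝓡 l)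
        (fun p : ℝ × EuclideanSpace ℝ (Fin n) => F p.1 ((extChartAt (𝓡 n) i).symm p.2)) (t, y)
        (0, EuclideanSpace.basisFun (Fin n) ℝ a) := by
  have hopen : IsOpen (U ×ˢ (extChartAt (𝓡 n) i).target) := hU.prod (isOpen_extChartAt_target i)
  have h1 := ((contMDiffOn_comp_symm hF i).contMDiffAt (x := (t, y))
    (hopen.mem_nhds ⟨ht, hy⟩)).mdifferentiableAt
    (by simp)
  have h2 : MDifferentiableAt (𝓡 n) (𝓡 l) (F t) ((extChartAt (𝓡 n) i).symm y) := by
    have hF' := (hF.contMDiffAt (x := (t, (extChartAt (𝓡 n) i).symm y))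
      ((hU.prod isOpen_univ).mem_nhds ⟨ht, mem_univ _⟩)).mdifferentiableAt (by simp)
    exact hF'.comp (f := fun x : M => (t, x)) _
      (mdifferentiableAt_const.prodMk mdifferentiableAt_id)
  have h3 : HasFDerivAt (fun z : EuclideanSpace ℝ (Fin n) => (t, z))
      (ContinuousLinearMap.inr ℝ ℝ (EuclideanSpace ℝ (Fin n))) y :=
    hasFDerivAt_prodMk_right t y
  have e1 := mfderiv_comp y h2 (mdifferentiableAt_symm i hy)
  have e2 := mfderiv_comp (f := fun z : EuclideanSpace ℝ (Fin n) => (t, z)) y h1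
    h3.differentiableAt.mdifferentiableAt
  rw [mfderiv_eq_fderiv, h3.fderiv] at e2
  exact (DFunLike.congr_fun e1 _).symm.trans (DFunLike.congr_fun e2 _)

/-- The energy density of a smooth family of maps is smooth in coordinates. -/
lemma exists_contDiffOn_normDu_sq (o : ManifoldOrientation n M) {F : ℝ → M → L} {U : Set ℝ}
    (hU : IsOpen U)
    (hF : ContMDiffOn (𝓘(ℝ, ℝ).prod (𝓡 n)) (𝓡 l) ∞ (fun p : ℝ × M => F p.1 p.2) (U ×ˢ univ))
    (i : M) : ∃ K : ℝ × EuclideanSpace ℝ (Fin n) → ℝ,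
      ContDiffOn ℝ ∞ K (U ×ˢ (extChartAt (𝓡 n) i).target) ∧
      ∀ t ∈ U, ∀ y ∈ (extChartAt (𝓡 n) i).target,
        normDu n l (F t) ((extChartAt (𝓡 n) i).symm y) ^ 2 = K (t, y) := by
  have hopen : IsOpen (U ×ˢ (extChartAt (𝓡 n) i).target) := hU.prod (isOpen_extChartAt_target i)
  let H : ℝ × EuclideanSpace ℝ (Fin n) → Fin n → Fin n → ℝ := fun p a b => inner ℝ
    (mfderiv 𝓘(ℝ, ℝ × EuclideanSpace ℝ (Fin n)) (𝓡 l)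
      (fun p : ℝ × EuclideanSpace ℝ (Fin n) => F p.1 ((extChartAt (𝓡 n) i).symm p.2)) p
        (0, EuclideanSpace.basisFun (Fin n) ℝ a))
    (mfderiv 𝓘(ℝ, ℝ × EuclideanSpace ℝ (Fin n)) (𝓡 l)
      (fun p : ℝ × EuclideanSpace ℝ (Fin n) => F p.1 ((extChartAt (𝓡 n) i).symm p.2)) p
        (0, EuclideanSpace.basisFun (Fin n) ℝ b))
  -- The witness is `tr (G⁻¹ H)`, with `G` the Gram matrix of the coordinate frame and `H` that of
  -- its image. The squared norm is used because the norm itself may fail to be smooth where the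
  -- differential vanishes.
  refine ⟨fun p => ∑ a, ∑ b, (gramMatrix (coordFrame i p.2))⁻¹ a b * H p b a, ?_, ?_⟩
  · refine ContDiffOn.sum fun a _ => ContDiffOn.sum fun b _ => ContDiffOn.mul ?_ ?_
    · exact (contDiffOn_inv (contDiffOn_gramMatrix i)
        (fun z hz => (det_gramMatrix_pos o i hz).ne') a b).comp contDiffOn_snd fun p hp => hp.2
    · exact contDiffOn_inner_mfderiv hopen (contMDiffOn_comp_symm hF i) _ _
  · intro t ht y hy
    set x := (extChartAt (𝓡 n) i).symm y
    have hfr : Module.finrank ℝ (TangentSpace (𝓡 n) x) = n := Fact.out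
    let e : OrthonormalBasis (Fin n) ℝ (TangentSpace (𝓡 n) x) :=
      (stdOrthonormalBasis ℝ (TangentSpace (𝓡 n) x)).reindex (finCongr hfr)
    have h1 := sum_norm_sq_eq_trace (mfderiv (𝓡 n) (𝓡 l) (F t) x).toLinearMap e (coordFrame i y)
      (det_gramMatrix_pos o i hy).ne'
    have h2 : ∑ j, ‖mfderiv (𝓡 n) (𝓡 l) (F t) x
        (stdOrthonormalBasis ℝ (TangentSpace (𝓡 n) x) j)‖ ^ 2 = ∑ j, ‖mfderiv (𝓡 n) (𝓡 l) (F t) x (e j)‖ ^ 2 :=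
      sum_norm_sq_apply (mfderiv (𝓡 n) (𝓡 l) (F t) x).toLinearMap _ e
    unfold normDu
    rw [Real.sq_sqrt (Finset.sum_nonneg fun j _ => sq_nonneg _), h2]
    refine h1.trans ?_
    rw [Matrix.trace]
    refine Finset.sum_congr rfl fun a _ => ?_
    rw [Matrix.diag_apply, Matrix.mul_apply]
    refine Finset.sum_congr rfl fun b _ => ?_
    congr 1
    simp only [gramMatrix, Matrix.of_apply, H]
    have h3 := mfderiv_coordFrame hU hF i ht hy a
    have h4 := mfderiv_coordFrame hU hF i ht hy b
    erw [← h3, ← h4]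
    rfl

lemma normDu_nonneg (u : M → L) (x : M) : 0 ≤ normDu n l u x := Real.sqrt_nonneg _

lemma continuousOn_normDu (o : ManifoldOrientation n M) {u : M → L}
    (hu : ContMDiff (𝓡 n) (𝓡 l) ∞ u) (i : M) :
    ContinuousOn (fun y => normDu n l u ((extChartAt (𝓡 n) i).symm y))
      (extChartAt (𝓡 n) i).target := by
  obtain ⟨K, hK, hKe⟩ := exists_contDiffOn_normDu_sq o (F := fun _ => u) isOpen_univ
    (hu.comp contMDiff_snd).contMDiffOn i
  have h : ∀ y ∈ (extChartAt (𝓡 n) i).target,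
      normDu n l u ((extChartAt (𝓡 n) i).symm y) = √(K (0, y)) := fun y hy => by
    rw [← hKe 0 (mem_univ _) y hy, Real.sqrt_sq (normDu_nonneg u _)]
  refine ContinuousOn.congr ?_ h
  refine (hK.continuousOn.comp (Continuous.prodMk_right 0).continuousOn fun y hy => ?_).sqrt
  exact ⟨mem_univ _, hy⟩

lemma isContinuousForm_energy (hn : 0 < n) (o : ManifoldOrientation n M) {u : M → L}
    (hu : ContMDiff (𝓡 n) (𝓡 l) ∞ u) (k : ℕ) :
    IsContinuousForm (fun x => normDu n l u x ^ k • volForm o x : DForm n M n) := fun i =>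
  (((continuousOn_normDu o hu i).pow k).smul
    ((isSmoothForm_volForm hn o i).continuousOn)).congr fun y _ =>
      inChart_smul_fun (fun x => normDu n l u x ^ k) (volForm o) i y

end Energy

/-! ### De Rham classes -/

section Cohomology

variable {n l : ℕ} {M : Type*} [TopologicalSpace M] [ChartedSpace (EuclideanSpace ℝ (Fin n)) M]
  {L : Type*} [TopologicalSpace L] [ChartedSpace (EuclideanSpace ℝ (Fin l)) L]

lemma representative_mem {p : ℕ} (c : DeRham n M p) : representative c ∈ closedForms n M p :=
  Subtype.prop _

lemma representative_deRhamClass_sub_mem {p : ℕ} {φ : DForm n M p} (h : φ ∈ closedForms n M p) :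
    representative (deRhamClass φ) - φ ∈ exactForms n M p := by
  have h1 := (Submodule.Quotient.mk_surjective _ (deRhamClass φ)).choose_spec
  rw [deRhamClass, dif_pos h, Submodule.Quotient.eq] at h1
  rw [deRhamClass, dif_pos h]
  exact h1

/-- More than `n` tangent vectors are linearly dependent, so the exterior derivative is zero for
degree reasons. -/
lemma mem_closedForms_of_lt {p : ℕ} (hp : n < p + 1) {φ : DForm n M p} (h : IsSmoothForm φ) :
    φ ∈ closedForms n M p := by
  refine ⟨h, funext fun x => ?_⟩
  ext v
  refine (dForm φ x).toAlternatingMap.map_linearDependent v fun hv => ?_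
  have := hv.fintype_card_le_finrank
  rw [Fintype.card_fin] at this
  have h' : Module.finrank ℝ (TangentSpace (𝓡 n) x) = n := finrank_euclideanSpace_fin
  omega

lemma wedgeForm_add_left {m k : ℕ} (a a' : DForm n M m) (b : DForm n M k) :
    wedgeForm (a + a') b = wedgeForm a b + wedgeForm a' b :=
  funext fun x => wedge_add_left (E := EuclideanSpace ℝ (Fin n)) (a x) (a' x) (b x)

lemma wedgeForm_add_right {m k : ℕ} (a : DForm n M m) (b b' : DForm n M k) :
    wedgeForm a (b + b') = wedgeForm a b + wedgeForm a b' :=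
  funext fun x => wedge_add_right (E := EuclideanSpace ℝ (Fin n)) (a x) (b x) (b' x)

lemma wedgeForm_smul_left {m k : ℕ} (c : ℝ) (a : DForm n M m) (b : DForm n M k) :
    wedgeForm (c • a) b = c • wedgeForm a b :=
  funext fun x => wedge_smul_left (E := EuclideanSpace ℝ (Fin n)) c (a x) (b x)

lemma wedgeForm_smul_right {m k : ℕ} (c : ℝ) (a : DForm n M m) (b : DForm n M k) :
    wedgeForm a (c • b) = c • wedgeForm a b :=
  funext fun x => wedge_smul_right (E := EuclideanSpace ℝ (Fin n)) c (a x) (b x)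

lemma wedgeForm_zero_left {m k : ℕ} (b : DForm n M k) : wedgeForm (0 : DForm n M m) b = 0 := by
  have := wedgeForm_smul_left 0 (0 : DForm n M m) b
  rwa [zero_smul, zero_smul] at this

lemma wedgeForm_zero_right {m k : ℕ} (a : DForm n M m) : wedgeForm a (0 : DForm n M k) = 0 := by
  have := wedgeForm_smul_right 0 a (0 : DForm n M k)
  rwa [zero_smul, zero_smul] at this

lemma pullbackForm_add {p : ℕ} (u : M → L) (φ ψ : DForm l L p) :
    (pullbackForm u (φ + ψ) : DForm n M p) = pullbackForm u φ + pullbackForm u ψ := rfl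

variable [IsManifold (𝓡 n) ∞ M] [IsManifold (𝓡 l) ∞ L]

lemma IsSmoothForm.of_mem_exactForms {p : ℕ} {β : DForm n M p} (hβ : β ∈ exactForms n M p) :
    IsSmoothForm β := by
  cases p with
  | zero =>
    rw [show β = 0 from hβ]
    exact isSmoothForm_zero
  | succ p =>
    obtain ⟨γ, hγ, rfl⟩ := hβ
    exact hγ.dForm

lemma pullbackForm_mem_exactForms {p : ℕ} {u : M → L} (hu : ContMDiff (𝓡 n) (𝓡 l) ∞ u)
    {β : DForm l L p} (hβ : β ∈ exactForms l L p) : pullbackForm u β ∈ exactForms n M p := by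
  cases p with
  | zero =>
    rw [show β = 0 from hβ]
    exact Submodule.zero_mem _
  | succ p =>
    obtain ⟨γ, hγ, rfl⟩ := hβ
    exact ⟨pullbackForm u γ, hγ.pullback hu, dForm_pullbackForm hu hγ⟩

lemma pullbackForm_mem_closedForms {p : ℕ} {u : M → L} (hu : ContMDiff (𝓡 n) (𝓡 l) ∞ u)
    {φ : DForm l L p} (hφ : φ ∈ closedForms l L p) : pullbackForm u φ ∈ closedForms n M p := by
  refine ⟨hφ.1.pullback hu, ?_⟩
  rw [dForm_pullbackForm hu hφ.1, hφ.2]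
  rfl

variable [T2Space M] [CompactSpace M]

/-- Stokes' theorem when the dimension is only propositionally `p + 1`, as for `m + k + 1` against
`m + 1 + k` in the Leibniz rule. -/
lemma integral_of_eq_dForm {p : ℕ} (h : p + 1 = n) (o : ManifoldOrientation n M) {β : DForm n M p}
    (hβ : IsSmoothForm β) {ψ : DForm n M n}
    (hψ : ∀ x v, ψ x v = dForm β x (v ∘ Fin.cast h)) : integral o ψ = 0 := by
  subst h
  have : ψ = dForm β := by
    funext x; ext v; exact hψ x v
  rw [this]
  exact integral_dForm o hβ

lemma integral_of_mem_exactForms (o : ManifoldOrientation n M) {β : DForm n M n}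
    (hβ : β ∈ exactForms n M n) : integral o β = 0 := by
  cases n with
  | zero =>
    rw [show β = 0 from hβ]
    exact integral_zero o
  | succ p =>
    obtain ⟨γ, hγ, rfl⟩ := hβ
    exact integral_dForm o hγ

end Cohomology

/-! ### The topological energy as an integral. -/

section WedgeIntegral

variable {m k : ℕ} {M : Type*} [TopologicalSpace M]
  [ChartedSpace (EuclideanSpace ℝ (Fin (m + k))) M] [IsManifold (𝓡 (m + k)) ∞ M]
  [T2Space M] [CompactSpace M]

/-- If `a = dc` and `db = 0`, then `a ∧ b = d(c ∧ b)` and Stokes' theorem applies. In degree zero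
the only exact form is `0`. -/
lemma integral_wedgeForm_exact_left (o : ManifoldOrientation (m + k) M) {a : DForm (m + k) M m}
    (ha : a ∈ exactForms (m + k) M m) {b : DForm (m + k) M k} (hb : b ∈ closedForms (m + k) M k) :
    integral o (wedgeForm a b) = 0 := by
  cases m with
  | zero =>
    rw [show a = 0 from ha, wedgeForm_zero_left]
    exact integral_zero o
  | succ m =>
    obtain ⟨c, hc, rfl⟩ := ha
    refine integral_of_eq_dForm (Nat.add_right_comm m k 1) o (hc.wedge hb.1) fun x v => ?_
    rw [dForm_wedgeForm hc hb.1, hb.2, wedgeForm_zero_right]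
    change _ = _ + _ * (0 : ℝ)
    rw [mul_zero, add_zero]
    rfl

lemma integral_wedgeForm_exact_right (o : ManifoldOrientation (m + k) M) {a : DForm (m + k) M m}
    (ha : a ∈ closedForms (m + k) M m) {b : DForm (m + k) M k} (hb : b ∈ exactForms (m + k) M k) :
    integral o (wedgeForm a b) = 0 := by
  cases k with
  | zero =>
    rw [show b = 0 from hb, wedgeForm_zero_right]
    exact integral_zero o
  | succ k =>
    obtain ⟨c, hc, rfl⟩ := hb
    have h := integral_of_eq_dForm (ψ := (-1 : ℝ) ^ m • wedgeForm a (dForm c)) rfl o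
      (ha.1.wedge hc) fun x v => by
        change _ = dForm (wedgeForm a c) x v
        rw [dForm_wedgeForm ha.1 hc, ha.2, wedgeForm_zero_left]
        exact (zero_add _).symm
    rw [integral_smul] at h
    exact (mul_eq_zero.1 h).resolve_left (pow_ne_zero _ (by norm_num))

variable {L : Type*} [TopologicalSpace L] [ChartedSpace (EuclideanSpace ℝ (Fin k)) L]
  [IsManifold (𝓡 k) ∞ L]
  [RiemannianBundle (fun x : L => TangentSpace (𝓡 k) x)]
  [IsContMDiffRiemannianBundle (𝓡 k) ∞ (EuclideanSpace ℝ (Fin k))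
    (fun x : L => TangentSpace (𝓡 k) x)]

lemma volForm_mem_closedForms (hk : 0 < k) (oL : ManifoldOrientation k L) :
    volForm oL ∈ closedForms k L k :=
  mem_closedForms_of_lt (Nat.lt_succ_self k) (isSmoothForm_volForm hk oL)

/-- `([α] ∪ u^*[vol_L]) · [M] = ∫_M α ∧ u^* vol_L`. -/
lemma topologicalEnergy_eq (hk : 0 < k) (oM : ManifoldOrientation (m + k) M)
    (oL : ManifoldOrientation k L) {α : DForm (m + k) M m} (hα : α ∈ closedForms (m + k) M m)
    {u : M → L} (hu : ContMDiff (𝓡 (m + k)) (𝓡 k) ∞ u) :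
    topologicalEnergy oM oL α u = integral oM (wedgeForm α (pullbackForm u (volForm oL))) := by
  set w := volForm oL
  have hw : w ∈ closedForms k L k := volForm_mem_closedForms hk oL
  -- Four choices of representative are hidden in the cohomological number: for `α`, for `vol_L`,
  -- for its pullback and for the cup product. Each costs an exact form (`ε`, `δ`, `ζ`, `θ`); `ζ`
  -- also absorbs the pullback of `δ`.
  obtain ⟨ε, hε, e1⟩ : ∃ ε ∈ exactForms (m + k) M m, representative (deRhamClass α) = α + ε :=
    ⟨_, representative_deRhamClass_sub_mem hα, by abel⟩
  obtain ⟨δ, hδ, e2⟩ : ∃ δ ∈ exactForms k L k, representative (deRhamClass w) = w + δ :=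
    ⟨_, representative_deRhamClass_sub_mem hw, by abel⟩
  have hb := representative_mem (deRhamClass w)
  have hub := pullbackForm_mem_closedForms hu hb
  obtain ⟨ζ, hζ, e3⟩ : ∃ ζ ∈ exactForms (m + k) M k,
      representative (deRhamClass (pullbackForm u (representative (deRhamClass w)))) =
        pullbackForm u w + ζ := by
    refine ⟨_, Submodule.add_mem _ (pullbackForm_mem_exactForms hu hδ)
      (representative_deRhamClass_sub_mem hub), ?_⟩
    rw [← add_assoc, ← pullbackForm_add, ← e2]
    abel
  have huw := pullbackForm_mem_closedForms hu hw
  have hc : α + ε ∈ closedForms (m + k) M m := e1 ▸ representative_mem (deRhamClass α)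
  have hd : pullbackForm u w + ζ ∈ closedForms (m + k) M k := e3 ▸ representative_mem _
  have hsζ := IsSmoothForm.of_mem_exactForms hζ
  have hsε := IsSmoothForm.of_mem_exactForms hε
  have hcl : wedgeForm (α + ε) (pullbackForm u w + ζ) ∈ closedForms (m + k) M (m + k) :=
    mem_closedForms_of_lt (Nat.lt_succ_self _) (hc.1.wedge hd.1)
  obtain ⟨θ, hθ, e4⟩ : ∃ θ ∈ exactForms (m + k) M (m + k),
      representative (deRhamClass (wedgeForm (α + ε) (pullbackForm u w + ζ))) =
        wedgeForm (α + ε) (pullbackForm u w + ζ) + θ :=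
    ⟨_, representative_deRhamClass_sub_mem hcl, by abel⟩
  unfold topologicalEnergy evalFundamental cup pullbackClass
  rw [e3, e1, e4, integral_add oM hcl.1.isContinuousForm
      (IsSmoothForm.of_mem_exactForms hθ).isContinuousForm, integral_of_mem_exactForms oM hθ,
    wedgeForm_add_left, integral_add oM (hα.1.wedge hd.1).isContinuousForm
      (hsε.wedge hd.1).isContinuousForm, integral_wedgeForm_exact_left oM hε hd,
    wedgeForm_add_right, integral_add oM (hα.1.wedge huw.1).isContinuousForm
      (hα.1.wedge hsζ).isContinuousForm, integral_wedgeForm_exact_right oM hα hζ, add_zero,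
    add_zero, add_zero]

end WedgeIntegral

/-! ### Local primitives of top degree forms -/

section Primitive

open MeasureTheory

/-- A compactly supported smooth function is, on any given ball, the directional derivative of a
smooth function. -/
lemma exists_lineDeriv_eq {E : Type*} [NormedAddCommGroup E] [NormedSpace ℝ E] [MeasurableSpace E]
    [BorelSpace E] {f : E → ℝ} (hf : ContDiff ℝ ∞ f) (hc : HasCompactSupport f) {e : E}
    (he : ‖e‖ = 1) (R : ℝ) :
    ∃ F : E → ℝ, ContDiff ℝ ∞ F ∧ ∀ y ∈ Metric.ball (0 : E) R, fderiv ℝ F y e = f y := by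
  obtain ⟨R₀, hR₀⟩ := hc.isCompact.isBounded.subset_closedBall 0
  -- Large enough that `y - T e` leaves the support of `f` for every `y` in the ball of radius `R`.
  set T := max 0 (R + R₀)
  have hT0 : 0 ≤ T := le_max_left _ _
  have hT : R + R₀ ≤ T := le_max_right _ _
  -- Length measure on the segment from `0` to `T e`. Convolution with it gives `F y = ∫_0^T f (y -
  -- s e) ds`, and smoothness of `F` follows from that of convolutions.
  let μ : Measure E := (volume.restrict (Ioc 0 T)).map fun s : ℝ => s • e
  have hmeas : Measurable fun s : ℝ => s • e := (continuous_id.smul continuous_const).measurable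
  have hfin : IsFiniteMeasure (volume.restrict (Ioc 0 T)) :=
    ⟨by rw [Measure.restrict_apply_univ]; exact measure_Ioc_lt_top⟩
  have hfinμ : IsFiniteMeasure μ := Measure.isFiniteMeasure_map _ _
  let F : E → ℝ := convolution (fun _ => (1 : ℝ)) f (ContinuousLinearMap.mul ℝ ℝ) μ
  have hF : ContDiff ℝ ∞ F :=
    hc.contDiff_convolution_right _ (locallyIntegrable_const _) hf
  have hFe : ∀ y, F y = ∫ s in (0 : ℝ)..T, f (y - s • e) := fun y => by
    simp only [F, convolution_def, ContinuousLinearMap.mul_apply', one_mul]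
    have hcont : Continuous fun t : E => f (y - t) := by
      have := hf.continuous
      fun_prop
    rw [integral_map hmeas.aemeasurable hcont.aestronglyMeasurable,
      intervalIntegral.integral_of_le hT0]
  refine ⟨F, hF, fun y hy => ?_⟩
  set g : ℝ → ℝ := fun s => f (y + s • e)
  have hg : Continuous g := hf.continuous.comp (by fun_prop)
  -- Along the line `F (y + t e)` is the integral of `g` over `[t - T, t]`, with derivative `g 0 - g
  -- (-T)` at `t = 0`; the second term vanishes by the choice of `T`.
  have h1 : ∀ t : ℝ, F (y + t • e) = (∫ s in (0 : ℝ)..t, g s) - ∫ s in (0 : ℝ)..(t - T), g s :=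
    fun t => by
      rw [hFe, intervalIntegral.integral_interval_sub_left (hg.intervalIntegrable _ _)
        (hg.intervalIntegrable _ _)]
      have h2 : ∀ s, f (y + t • e - s • e) = g (t - s) := fun s => by
        simp only [g, sub_smul]; congr 1; abel
      simp only [h2]
      rw [intervalIntegral.integral_comp_sub_left, sub_zero]
  have h3 : g (0 - T) = 0 := by
    by_contra h
    have h4 := hR₀ (subset_tsupport f h)
    rw [mem_closedBall_zero_iff] at h4
    rw [mem_ball_zero_iff] at hy
    have h5 : ‖(0 - T) • e‖ ≤ ‖y + (0 - T) • e‖ + ‖y‖ := by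
      have := norm_sub_le (y + (0 - T) • e) y
      rwa [add_sub_cancel_left] at this
    rw [norm_smul, he, mul_one, zero_sub, norm_neg, Real.norm_of_nonneg hT0] at h5
    rw [zero_sub] at h4
    linarith
  have h6 : HasDerivAt (fun t : ℝ => F (y + t • e)) (f y) 0 := by
    have a1 := (hg.integral_hasStrictDerivAt 0 0).hasDerivAt
    have a2 := ((hg.integral_hasStrictDerivAt 0 (0 - T)).hasDerivAt).comp (0 : ℝ)
      ((hasDerivAt_id (0 : ℝ)).sub_const T)
    rw [h3, zero_mul] at a2
    have := a1.sub a2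
    simp only [sub_zero] at this
    have hg0 : g 0 = f y := by simp [g]
    rw [hg0] at this
    exact this.congr_of_eventuallyEq (Eventually.of_forall h1)
  have h7 := ((hF.differentiable (by simp) y).hasFDerivAt.hasLineDerivAt e)
  exact HasDerivAt.unique h7 h6

variable {k : ℕ}

/-- The determinant as a continuous alternating form on Euclidean space. -/
def detForm (k : ℕ) : EuclideanSpace ℝ (Fin k) [⋀^Fin k]→L[ℝ] ℝ :=
  { (EuclideanSpace.basisFun (Fin k) ℝ).toBasis.det with
    cont := by
      change Continuous fun v : Fin k → EuclideanSpace ℝ (Fin k) =>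
        ((EuclideanSpace.basisFun (Fin k) ℝ).toBasis.toMatrix v).det
      refine Continuous.matrix_det (continuous_matrix fun i j => ?_)
      simp only [Module.Basis.toMatrix_apply, OrthonormalBasis.coe_toBasis_repr_apply,
        EuclideanSpace.basisFun_repr]
      fun_prop }

lemma eq_smul_detForm (a : EuclideanSpace ℝ (Fin k) [⋀^Fin k]→L[ℝ] ℝ) :
    a = a (EuclideanSpace.basisFun (Fin k) ℝ) • detForm k := by
  ext v
  have := a.toAlternatingMap.eq_smul_basis_det (EuclideanSpace.basisFun (Fin k) ℝ).toBasis
  rw [OrthonormalBasis.coe_toBasis] at this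
  exact congrArg (fun t : EuclideanSpace ℝ (Fin k) [⋀^Fin k]→ₗ[ℝ] ℝ => t v) this

lemma detForm_basisFun : detForm k (EuclideanSpace.basisFun (Fin k) ℝ) = 1 := by
  have := (EuclideanSpace.basisFun (Fin k) ℝ).toBasis.det_self
  rw [OrthonormalBasis.coe_toBasis] at this
  exact this

/-- The identity `d(F ι_{e₀} det) = (∂₀F) det`, which reduces finding a primitive of a top degree
form to solving `∂₀F = f`. -/
lemma extDeriv_smul_curryLeft {F : EuclideanSpace ℝ (Fin (k + 1)) → ℝ}
    {y : EuclideanSpace ℝ (Fin (k + 1))} (hF : DifferentiableAt ℝ F y) :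
    extDeriv (fun z => F z •
        (detForm (k + 1)).curryLeft (EuclideanSpace.basisFun (Fin (k + 1)) ℝ 0)) y =
      fderiv ℝ F y (EuclideanSpace.basisFun (Fin (k + 1)) ℝ 0) • detForm (k + 1) := by
  set b := EuclideanSpace.basisFun (Fin (k + 1)) ℝ
  set c := (detForm (k + 1)).curryLeft (b 0)
  rw [eq_smul_detForm (extDeriv _ y)]
  congr 1
  refine (extDeriv_apply (hF.smul (differentiableAt_const c)) b).trans ?_
  have h : ∀ i : Fin (k + 1), fderiv ℝ (fun z => (F z • c) (i.removeNth b)) y (b i) =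
      fderiv ℝ F y (b i) * c (i.removeNth b) := fun i => by
    simp only [ContinuousAlternatingMap.smul_apply, smul_eq_mul]
    rw [fderiv_mul_const hF]
    simp [mul_comm]
  refine (Finset.sum_congr rfl fun i _ => congrArg _ (h i)).trans ?_
  rw [Fin.sum_univ_succ]
  have h0 : c ((0 : Fin (k + 1)).removeNth b) = 1 := by
    simp only [c, ContinuousAlternatingMap.curryLeft_apply_apply]
    rw [← detForm_basisFun]
    congr 1
    funext i
    refine Fin.cases ?_ (fun j => ?_) i <;> simp [Fin.tail, b]
  -- Omitting an index other than `0` leaves `e₀` among the arguments, so `e₀` appears twice in the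
  -- determinant.
  have hs : ∀ i : Fin k, c (i.succ.removeNth b) = 0 := fun i => by
    simp only [c, ContinuousAlternatingMap.curryLeft_apply_apply]
    cases k with
    | zero => exact i.elim0
    | succ k =>
      refine (detForm (k + 1 + 1)).map_eq_zero_of_eq _ (i := 0) (j := 1) ?_ (by simp)
      simp [Fin.removeNth]
  simp only [h0, hs]
  simp

variable {L : Type*} [TopologicalSpace L] [T2Space L]
  [ChartedSpace (EuclideanSpace ℝ (Fin (k + 1))) L] [IsManifold (𝓡 (k + 1)) ∞ L]

/-- A smooth form of top degree is locally the exterior derivative of a globally defined smooth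
form. -/
lemma exists_eventually_dForm_eq {w : DForm (k + 1) L (k + 1)} (hw : IsSmoothForm w) (q : L) :
    ∃ η : DForm (k + 1) L k, IsSmoothForm η ∧ ∀ᶠ x in 𝓝 q, dForm η x = w x := by
  set b := EuclideanSpace.basisFun (Fin (k + 1)) ℝ
  set T := (extChartAt (𝓡 (k + 1)) q).target with hT
  have hTo : IsOpen T := isOpen_extChartAt_target q
  set y₀ := extChartAt (𝓡 (k + 1)) q q
  have hy₀ : y₀ ∈ T := mem_extChartAt_target q
  obtain ⟨r, hr, hrT⟩ := Metric.nhds_basis_closedBall.mem_iff.1 (hTo.mem_nhds hy₀)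
  -- The cutoff makes the coefficient of `w` compactly supported in the chart without changing it on
  -- the ball of radius `r / 2`.
  let χ : ContDiffBump y₀ := ⟨r / 2, r, by positivity, by linarith⟩
  let f : EuclideanSpace ℝ (Fin (k + 1)) → ℝ := fun y => χ y * inChart w q y b
  have hf : ContDiff ℝ ∞ f := contDiff_iff_contDiffAt.2 fun y => by
    by_cases hy : y ∈ T
    · exact χ.contDiff.contDiffAt.mul (contDiffAt_alternating_apply (hw.contDiffAt q hy)
        fun _ => contDiffAt_const)
    · have hy' : y ∉ tsupport χ := fun h => hy (hrT (by rwa [χ.tsupport_eq] at h))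
      refine contDiffAt_const (c := (0 : ℝ)) |>.congr_of_eventuallyEq ?_
      filter_upwards [(isClosed_tsupport χ).isOpen_compl.mem_nhds hy'] with z hz
      simp only [f, image_eq_zero_of_notMem_tsupport hz, zero_mul]
  have hfc : HasCompactSupport f := χ.hasCompactSupport.mul_right
  -- The radius `‖y₀‖ + r` is needed because the ball in `exists_lineDeriv_eq` is centred at the
  -- origin.
  obtain ⟨F, hF, hFf⟩ := exists_lineDeriv_eq hf hfc (e := b 0) (b.orthonormal.1 0) (‖y₀‖ + r)
  let η₀ : EuclideanSpace ℝ (Fin (k + 1)) → EuclideanSpace ℝ (Fin (k + 1)) [⋀^Fin k]→L[ℝ] ℝ :=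
    fun z => F z • (detForm (k + 1)).curryLeft (b 0)
  have hη₀ : ContDiff ℝ ∞ η₀ := hF.smul contDiff_const
  have hdη₀ : ∀ y ∈ Metric.ball y₀ (r / 2), extDeriv η₀ y = inChart w q y := fun y hy => by
    have h1 : y ∈ Metric.ball (0 : EuclideanSpace ℝ (Fin (k + 1))) (‖y₀‖ + r) := by
      rw [mem_ball_zero_iff]
      rw [mem_ball_iff_norm] at hy
      have := norm_le_norm_add_norm_sub' y y₀
      linarith
    have h2 : χ y = 1 := χ.one_of_mem_closedBall (Metric.ball_subset_closedBall hy)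
    refine (extDeriv_smul_curryLeft (hF.differentiable (by simp) y)).trans ?_
    rw [hFf y h1, eq_smul_detForm (inChart w q y)]
    simp only [f, h2, one_mul]
    rfl
  -- A second cutoff, on the manifold, lets the local primitive be extended by zero to a global
  -- smooth form.
  obtain ⟨β, -, hβ⟩ := (SmoothBumpFunction.nhds_basis_tsupport (I := 𝓡 (k + 1)) q).mem_iff.1
    (extChartAt_source_mem_nhds (I := 𝓡 (k + 1)) q)
  let η : DForm (k + 1) L k := fun x =>
    β x • (η₀ (extChartAt (𝓡 (k + 1)) q x)).compContinuousLinearMap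
    (mfderiv (𝓡 (k + 1)) 𝓘(ℝ, EuclideanSpace ℝ (Fin (k + 1))) (extChartAt (𝓡 (k + 1)) q) x)
  have hη : ∀ y ∈ T, inChart η q y = β ((extChartAt (𝓡 (k + 1)) q).symm y) • η₀ y := fun y hy => by
    ext v
    have h1 : (fun a => mfderiv (𝓡 (k + 1)) 𝓘(ℝ, EuclideanSpace ℝ (Fin (k + 1)))
        (extChartAt (𝓡 (k + 1)) q) ((extChartAt (𝓡 (k + 1)) q).symm y)
          (chartFrame q y (v a))) = v :=
      funext fun a => mfderiv_extChartAt_chartFrame q hy (v a)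
    change _ * η₀ (extChartAt (𝓡 (k + 1)) q ((extChartAt (𝓡 (k + 1)) q).symm y))
      (fun a => mfderiv (𝓡 (k + 1)) 𝓘(ℝ, EuclideanSpace ℝ (Fin (k + 1)))
        (extChartAt (𝓡 (k + 1)) q) ((extChartAt (𝓡 (k + 1)) q).symm y) (chartFrame q y (v a))) = _
    rw [h1, (extChartAt (𝓡 (k + 1)) q).right_inv hy]
    rfl
  have hηs : IsSmoothForm η := isSmoothForm_of_contDiffAt fun x => by
    by_cases hx : x ∈ tsupport β
    · refine ⟨q, hβ hx, ?_⟩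
      have hxT := (extChartAt (𝓡 (k + 1)) q).map_source (hβ hx)
      have h1 : ContDiffAt ℝ ∞ (fun y => β ((extChartAt (𝓡 (k + 1)) q).symm y) • η₀ y)
          (extChartAt (𝓡 (k + 1)) q x) := by
        have h2 : ContDiffAt ℝ ∞ (fun y => β ((extChartAt (𝓡 (k + 1)) q).symm y))
            (extChartAt (𝓡 (k + 1)) q x) :=
          (β.contMDiff.contMDiffAt.comp _ (contMDiffAt_symm q hxT)).contDiffAt
        exact h2.smul hη₀.contDiffAt
      refine h1.congr_of_eventuallyEq ?_
      filter_upwards [hTo.mem_nhds hxT] with z hz using hη z hz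
    · refine ⟨x, mem_extChartAt_source x, ?_⟩
      refine contDiffAt_const (c := 0) |>.congr_of_eventuallyEq ?_
      have := eventually_mem_chart (u := (id : L → L)) x
        (mem_extChartAt_target (I := 𝓡 (k + 1)) x) continuousAt_id
        (isClosed_tsupport β).isOpen_compl (by rw [id, extChartAt_to_inv x]; exact hx)
      filter_upwards [this] with z hz
      refine inChart_eq_zero ?_
      have h0 : β ((extChartAt (𝓡 (k + 1)) x).symm z) = 0 := image_eq_zero_of_notMem_tsupport hz.2
      exact smul_eq_zero_of_left h0 _
  refine ⟨η, hηs, ?_⟩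
  have hc : ContinuousAt (extChartAt (𝓡 (k + 1)) q) q := continuousAt_extChartAt q
  filter_upwards [extChartAt_source_mem_nhds (I := 𝓡 (k + 1)) q,
    hc.preimage_mem_nhds (Metric.ball_mem_nhds y₀ (half_pos hr)),
    β.eventuallyEq_one.eventually_nhds] with x hx hx1 hx2
  have hxT := (extChartAt (𝓡 (k + 1)) q).map_source hx
  have key := eq_of_inChart_eq (φ := dForm η) (η := w) q hxT (by
    rw [inChart_dForm hηs q hxT, ← hdη₀ _ hx1]
    refine Filter.EventuallyEq.extDeriv_eq ?_
    have h1 : ContinuousAt (extChartAt (𝓡 (k + 1)) q).symm (extChartAt (𝓡 (k + 1)) q x) :=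
      (mdifferentiableAt_symm q hxT).continuousAt
    rw [ContinuousAt, (extChartAt (𝓡 (k + 1)) q).left_inv hx] at h1
    filter_upwards [hTo.mem_nhds hxT, h1.eventually hx2] with z hz hz'
    rw [hη z hz, hz']
    exact one_smul _ _)
  rwa [(extChartAt (𝓡 (k + 1)) q).left_inv hx] at key

end Primitive

/-! ### Homotopy invariance -/

section Perturbation

variable {n l : ℕ} {M : Type*} [TopologicalSpace M] [ChartedSpace (EuclideanSpace ℝ (Fin n)) M]
  [T2Space M] [CompactSpace M]
  {L : Type*} [TopologicalSpace L] [ChartedSpace (EuclideanSpace ℝ (Fin l)) L]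

open Classical in
/-- The map `ψ⁻¹ (ψ ∘ v + d)` on `K`, where `ψ` is the chart around `q`, and `v` elsewhere. -/
def perturb (q : L) (K : Set M) (v : M → L) (d : M → EuclideanSpace ℝ (Fin l)) (p : M) : L :=
  if p ∈ K then (extChartAt (𝓡 l) q).symm (extChartAt (𝓡 l) q (v p) + d p) else v p

lemma perturb_of_mem_source {q : L} {K : Set M} {v : M → L} {d : M → EuclideanSpace ℝ (Fin l)}
    (hd : ∀ p ∉ K, d p = 0) {p : M} (hp : v p ∈ (extChartAt (𝓡 l) q).source) :
    perturb q K v d p = (extChartAt (𝓡 l) q).symm (extChartAt (𝓡 l) q (v p) + d p) := by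
  by_cases h : p ∈ K
  · exact if_pos h
  · rw [hd p h, add_zero, (extChartAt (𝓡 l) q).left_inv hp]
    exact if_neg h

lemma perturb_of_notMem {q : L} {K : Set M} {v : M → L} {d : M → EuclideanSpace ℝ (Fin l)}
    {p : M} (hp : p ∉ K) : perturb q K v d p = v p := if_neg hp

/-- Small perturbations in a chart of maps close to `f` are close to `f`. -/
lemma exists_perturb_mem (f : C(M, L)) (q : L) {K : Set M} (hK : IsCompact K)
    (hf : MapsTo f K (extChartAt (𝓡 l) q).source) {W : Set C(M, L)} (hW : W ∈ 𝓝 f) :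
    ∃ U ∈ 𝓝 f, ∃ δ > 0, ∀ v ∈ U, MapsTo v K (extChartAt (𝓡 l) q).source ∧
      ∀ d : M → EuclideanSpace ℝ (Fin l), Continuous d → (∀ p ∉ K, d p = 0) → (∀ p, ‖d p‖ < δ) →
        (∀ p ∈ K, extChartAt (𝓡 l) q (v p) + d p ∈ (extChartAt (𝓡 l) q).target) ∧
        ∃ v' ∈ W, ∀ p, v' p = perturb q K v d p := by
  set ψ := extChartAt (𝓡 l) q
  have hso : IsOpen ψ.source := isOpen_extChartAt_source q
  have hto : IsOpen ψ.target := isOpen_extChartAt_target q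
  have hψ : ∀ x ∈ ψ.source, ContinuousAt ψ x := fun x hx => continuousAt_extChartAt' hx
  have hψs : ∀ y ∈ ψ.target, ContinuousAt ψ.symm y := fun y hy => continuousAt_extChartAt_symm'' hy
  -- The pairs `(v, d)` for which the perturbation stays in the chart. On this space `perturb` is
  -- jointly continuous, so it defines a continuous map into `C(M, L)` sending `(f, 0)` to `f`.
  let X := {z : C(M, L) × C(M, EuclideanSpace ℝ (Fin l)) // MapsTo z.1 K ψ.source ∧
    (∀ p ∉ K, z.2 p = 0) ∧ ∀ p ∈ K, ψ (z.1 p) + z.2 p ∈ ψ.target}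
  have hev : Continuous fun a : X × M => a.1.1.1 a.2 :=
    continuous_eval.comp (((continuous_fst.comp continuous_subtype_val).comp continuous_fst).prodMk
      continuous_snd)
  have hed : Continuous fun a : X × M => a.1.1.2 a.2 :=
    continuous_eval.comp (((continuous_snd.comp continuous_subtype_val).comp continuous_fst).prodMk
      continuous_snd)
  have hcont : Continuous fun a : X × M => perturb q K a.1.1.1 a.1.1.2 a.2 := by
    refine continuous_iff_continuousAt.2 fun a => ?_
    by_cases ha : a.2 ∈ K
    · have h1 : ∀ᶠ b : X × M in 𝓝 a, perturb q K b.1.1.1 b.1.1.2 b.2 =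
          ψ.symm (ψ (b.1.1.1 b.2) + b.1.1.2 b.2) := by
        filter_upwards [hev.continuousAt.preimage_mem_nhds (hso.mem_nhds (a.1.2.1 ha))] with b hb
        exact perturb_of_mem_source b.1.2.2.1 hb
      refine ContinuousAt.congr ?_ (h1.mono fun _ h => h.symm)
      refine ContinuousAt.comp (f := fun b : X × M => ψ (b.1.1.1 b.2) + b.1.1.2 b.2)
        (hψs _ (a.1.2.2.2 _ ha)) ?_
      exact (ContinuousAt.comp (f := fun b : X × M => b.1.1.1 b.2) (hψ _ (a.1.2.1 ha))
        hev.continuousAt).add hed.continuousAt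
    · have h1 : ∀ᶠ b : X × M in 𝓝 a, perturb q K b.1.1.1 b.1.1.2 b.2 = b.1.1.1 b.2 := by
        filter_upwards [continuous_snd.continuousAt.preimage_mem_nhds
          (hK.isClosed.isOpen_compl.mem_nhds ha)] with b hb
        exact perturb_of_notMem hb
      exact hev.continuousAt.congr (h1.mono fun _ h => h.symm)
  let Φ : X → C(M, L) := fun z => ⟨fun p => perturb q K z.1.1 z.1.2 p,
    hcont.comp (Continuous.prodMk_right z)⟩
  have hΦ : Continuous Φ := ContinuousMap.continuous_of_continuous_uncurry Φ hcont
  have hf0 : MapsTo f K ψ.source ∧ (∀ p ∉ K, (0 : C(M, EuclideanSpace ℝ (Fin l))) p = 0) ∧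
      ∀ p ∈ K, ψ (f p) + (0 : C(M, EuclideanSpace ℝ (Fin l))) p ∈ ψ.target :=
    ⟨hf, fun _ _ => rfl, fun p hp => by
      rw [ContinuousMap.zero_apply, add_zero]; exact ψ.map_source (hf hp)⟩
  have hΦf : Φ ⟨(f, 0), hf0⟩ = f := ContinuousMap.ext fun p => by
    by_cases hp : p ∈ K
    · have := perturb_of_mem_source (K := K) (v := f) (d := fun _ => 0) (fun _ _ => rfl) (hf hp)
      refine this.trans ?_
      rw [add_zero]
      exact ψ.left_inv (hf hp)
    · exact perturb_of_notMem hp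
  have h1 : Φ ⁻¹' W ∈ 𝓝 (⟨(f, 0), hf0⟩ : X) := hΦ.continuousAt.preimage_mem_nhds (by rwa [hΦf])
  obtain ⟨S, hS, hSW⟩ := mem_nhds_subtype _ _ _ |>.1 h1
  -- Compactness of `K` turns pointwise conditions that are open near each `(f, 0, p)` into one
  -- neighbourhood of `(f, 0)`.
  have h2 : ∀ᶠ z : C(M, L) × C(M, EuclideanSpace ℝ (Fin l)) in 𝓝 (f, 0),
      ∀ p ∈ K, z.1 p ∈ ψ.source ∧ ψ (z.1 p) + z.2 p ∈ ψ.target := by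
    refine hK.eventually_forall_of_forall_eventually fun p hp => ?_
    have c1 : Continuous fun a : (C(M, L) × C(M, EuclideanSpace ℝ (Fin l))) × M => a.1.1 a.2 :=
      continuous_eval.comp ((continuous_fst.comp continuous_fst).prodMk continuous_snd)
    have c2 : Continuous fun a : (C(M, L) × C(M, EuclideanSpace ℝ (Fin l))) × M => a.1.2 a.2 :=
      continuous_eval.comp ((continuous_snd.comp continuous_fst).prodMk continuous_snd)
    have c3 : ContinuousAt (fun a : (C(M, L) × C(M, EuclideanSpace ℝ (Fin l))) × M =>
        ψ (a.1.1 a.2) + a.1.2 a.2) ((f, 0), p) :=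
      (ContinuousAt.comp (f := fun a : (C(M, L) × C(M, EuclideanSpace ℝ (Fin l))) × M => a.1.1 a.2)
        (hψ _ (hf hp)) c1.continuousAt).add c2.continuousAt
    have c4 : ∀ᶠ a : (C(M, L) × C(M, EuclideanSpace ℝ (Fin l))) × M in 𝓝 ((f, 0), p),
        a.1.1 a.2 ∈ ψ.source := c1.continuousAt.preimage_mem_nhds (hso.mem_nhds (hf hp))
    exact c4.and (c3.preimage_mem_nhds (hto.mem_nhds (hf0.2.2 p hp)))
  obtain ⟨U, hU, D, hD, hUD⟩ := mem_nhds_prod_iff.1 (Filter.inter_mem hS h2)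
  obtain ⟨δ, hδ, hδD⟩ := Metric.mem_nhds_iff.1 hD
  have h0 : (0 : C(M, EuclideanSpace ℝ (Fin l))) ∈ D := mem_of_mem_nhds hD
  refine ⟨U, hU, δ, hδ, fun v hv => ⟨fun p hp => ((hUD (show (v,
    (0 : C(M, EuclideanSpace ℝ (Fin l)))) ∈ U ×ˢ D from ⟨hv, h0⟩)).2 p hp).1, ?_⟩⟩
  intro d hd hd0 hdδ
  have hdD : (⟨d, hd⟩ : C(M, EuclideanSpace ℝ (Fin l))) ∈ D := hδD (by
    rw [mem_ball_zero_iff]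
    exact (ContinuousMap.norm_lt_iff _ hδ).2 hdδ)
  obtain ⟨k1, k2⟩ := hUD (show (v, (⟨d, hd⟩ : C(M, EuclideanSpace ℝ (Fin l)))) ∈ U ×ˢ D from
    ⟨hv, hdD⟩)
  refine ⟨fun p hp => (k2 p hp).2, ?_⟩
  exact ⟨Φ ⟨(v, ⟨d, hd⟩), fun p hp => (k2 p hp).1, hd0, fun p hp => (k2 p hp).2⟩, hSW k1,
    fun p => rfl⟩

variable [IsManifold (𝓡 n) ∞ M] [IsManifold (𝓡 l) ∞ L]

lemma contMDiffAt_perturb {q : L} {K : Set M} {v : M → L} {d : M → EuclideanSpace ℝ (Fin l)} {p : M}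
    (hd : ∀ p ∉ K, d p = 0) (hv : ContinuousAt v p) (hp : v p ∈ (extChartAt (𝓡 l) q).source)
    (ht : extChartAt (𝓡 l) q (v p) + d p ∈ (extChartAt (𝓡 l) q).target)
    (hs : ContMDiffAt (𝓡 n) 𝓘(ℝ, EuclideanSpace ℝ (Fin l)) ∞
      (fun x => extChartAt (𝓡 l) q (v x) + d x) p) :
    ContMDiffAt (𝓡 n) (𝓡 l) ∞ (perturb q K v d) p := by
  refine ContMDiffAt.congr_of_eventuallyEq (f := fun x =>
    (extChartAt (𝓡 l) q).symm (extChartAt (𝓡 l) q (v x) + d x)) ?_ ?_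
  · exact (contMDiffAt_symm q ht).comp p hs
  · filter_upwards [hv.preimage_mem_nhds ((isOpen_extChartAt_source q).mem_nhds hp)] with x hx
    exact perturb_of_mem_source hd hx

lemma perturb_eventuallyEq {q : L} {K : Set M} (hK : IsClosed K) {v : M → L}
    {d : M → EuclideanSpace ℝ (Fin l)} {p : M} (hp : p ∉ K) : perturb q K v d =ᶠ[𝓝 p] v := by
  filter_upwards [hK.isOpen_compl.mem_nhds hp] with x hx using perturb_of_notMem hx

/-- Compact manifolds are covered by the sets where finitely many bump functions, with prescribed
small supports, are equal to one. -/
lemma exists_bump_cover (O : M → Set M) (hO : ∀ x, O x ∈ 𝓝 x) :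
    ∃ (s : Finset M) (χ : M → M → ℝ), (∀ i, ContMDiff (𝓡 n) 𝓘(ℝ, ℝ) ∞ (χ i) ∧
      (∀ p, ‖χ i p‖ ≤ 1) ∧ tsupport (χ i) ⊆ O i) ∧ ∀ p, ∃ i ∈ s, χ i =ᶠ[𝓝 p] fun _ => 1 := by
  have h : ∀ x : M, ∃ χ : SmoothBumpFunction (𝓡 n) x, tsupport χ ⊆ O x := fun x => by
    obtain ⟨χ, -, hχ⟩ := (SmoothBumpFunction.nhds_basis_tsupport (I := 𝓡 n) x).mem_iff.1 (hO x)
    exact ⟨χ, hχ⟩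
  choose χ hχ using h
  obtain ⟨s, hs⟩ := CompactSpace.elim_nhds_subcover
    (fun x => {p | (χ x : M → ℝ) =ᶠ[𝓝 p] fun _ => 1})
    fun x => (χ x).eventuallyEq_one.eventually_nhds
  refine ⟨s, fun i => χ i, fun i => ⟨(χ i).contMDiff, fun p => ?_, hχ i⟩, fun p => ?_⟩
  · rw [Real.norm_of_nonneg (χ i).nonneg]
    exact (χ i).le_one
  · have := hs.ge (mem_univ p)
    simp only [mem_iUnion, exists_prop] at this
    exact this

lemma continuous_smul_chart {χ : M → ℝ} (hχ : Continuous χ) {q : L} {v : M → L} (hv : Continuous v)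
    (h : MapsTo v (tsupport χ) (extChartAt (𝓡 l) q).source) :
    Continuous fun p => χ p • extChartAt (𝓡 l) q (v p) := by
  refine continuous_iff_continuousAt.2 fun p => ?_
  by_cases hp : p ∈ tsupport χ
  · exact hχ.continuousAt.smul ((continuousAt_extChartAt' (h hp)).comp hv.continuousAt)
  · refine continuousAt_const (y := 0) |>.congr ?_
    filter_upwards [(isClosed_tsupport χ).isOpen_compl.mem_nhds hp] with x hx
    rw [image_eq_zero_of_notMem_tsupport hx, zero_smul]

/-- Smooth maps are dense among continuous maps. -/
lemma exists_contMDiff_mem (f : C(M, L)) {W : Set C(M, L)} (hW : W ∈ 𝓝 f) :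
    ∃ v ∈ W, ContMDiff (𝓡 n) (𝓡 l) ∞ v := by
  classical
  obtain ⟨s, χ, hχ, hcov⟩ := exists_bump_cover (n := n)
    (fun x => f ⁻¹' (extChartAt (𝓡 l) (f x)).source)
    fun x => f.continuous.continuousAt.preimage_mem_nhds (extChartAt_source_mem_nhds (f x))
  -- Smoothing proceeds one bump function at a time. The claim is quantified over all neighbourhoods
  -- `W`, so that earlier steps can be made as small as the next perturbation demands.
  have key : ∀ t : Finset M, ∀ W ∈ 𝓝 f, ∃ v ∈ W, ∀ p, (∃ i ∈ t, χ i =ᶠ[𝓝 p] fun _ => 1) →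
      ContMDiffAt (𝓡 n) (𝓡 l) ∞ v p := by
    intro t
    induction t using Finset.induction_on with
    | empty => exact fun W hW => ⟨f, mem_of_mem_nhds hW, fun p ⟨i, hi, _⟩ => by simp at hi⟩
    | insert a t _ ih =>
      intro W hW
      set K := tsupport (χ a)
      have hKc : IsClosed K := isClosed_tsupport _
      obtain ⟨U, hU, δ, hδ, hUd⟩ := exists_perturb_mem f (f a) hKc.isCompact (hχ a).2.2 hW
      obtain ⟨v, hv, hvs⟩ := ih U hU
      obtain ⟨hvK, hd⟩ := hUd v hv
      set ψ := extChartAt (𝓡 l) (f a)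
      have hgc := continuous_smul_chart (hχ a).1.continuous v.continuous hvK
      obtain ⟨h, hh, hhs⟩ := hgc.exists_contMDiff_approx (𝓡 n) ⊤ (continuous_const (y := δ))
        fun _ => hδ
      -- Only the cut-off map `χ · ψ ∘ v` is globally defined, so that is what `h` approximates.
      -- Where `χ = 1` the perturbed coordinate expression is `h`; where `v` was already smooth it
      -- remains so.
      set d : M → EuclideanSpace ℝ (Fin l) := fun p => h p - χ a p • ψ (v p)
      have hd0 : ∀ p ∉ K, d p = 0 := fun p hp => by
        have h1 : χ a p = 0 := image_eq_zero_of_notMem_tsupport hp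
        have h2 : h p = 0 := by
          by_contra h3
          exact hhs h3 (by simp only [h1, zero_smul])
        simp only [d, h1, h2, zero_smul, sub_zero]
      obtain ⟨ht, v', hv'W, hv'⟩ := hd d (h.contMDiff.continuous.sub hgc) hd0 fun p => by
        rw [← dist_eq_norm]; exact hh p
      have hfun : (v' : M → L) = perturb (f a) K v d := funext hv'
      refine ⟨v', hv'W, fun p hp => ?_⟩
      rw [hfun]
      by_cases hpK : p ∈ K
      · refine contMDiffAt_perturb hd0 v.continuous.continuousAt (hvK hpK) (ht p hpK) ?_
        obtain ⟨i, hi, hip⟩ := hp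
        rcases Finset.mem_insert.1 hi with rfl | hi
        · refine h.contMDiff.contMDiffAt.congr_of_eventuallyEq ?_
          filter_upwards [hip] with x hx
          simp only [d, hx, one_smul]
          abel
        · have h1 : ContMDiffAt (𝓡 n) 𝓘(ℝ, EuclideanSpace ℝ (Fin l)) ∞ (fun x => ψ (v x)) p :=
            (contMDiffAt_chart (f a) (hvK hpK)).comp p (hvs p ⟨i, hi, hip⟩)
          exact h1.add (h.contMDiff.contMDiffAt.sub ((hχ a).1.contMDiffAt.smul h1))
      · refine ContMDiffAt.congr_of_eventuallyEq ?_ (perturb_eventuallyEq hKc hpK)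
        obtain ⟨i, hi, hip⟩ := hp
        rcases Finset.mem_insert.1 hi with rfl | hi
        · refine absurd (subset_tsupport _ ?_) hpK
          rw [Function.mem_support, hip.eq_of_nhds]
          exact one_ne_zero
        · exact hvs p ⟨i, hi, hip⟩
  obtain ⟨v, hv, hvs⟩ := key s W hW
  exact ⟨v, hv, fun p => hvs p (hcov p)⟩

/-- A functional on smooth maps that does not change under modifications inside small open sets of
the target is constant on all smooth maps close to a given continuous map. -/
lemma exists_nhds_eq_of_local {I : C(M, L) → ℝ}
    (hI : ∀ q : L, ∃ V ∈ 𝓝 q, ∀ u u' : C(M, L), ContMDiff (𝓡 n) (𝓡 l) ∞ u →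
      ContMDiff (𝓡 n) (𝓡 l) ∞ u' → (∀ x, u =ᶠ[𝓝 x] u' ∨ (u x ∈ V ∧ u' x ∈ V)) → I u = I u')
    (f : C(M, L)) : ∃ U ∈ 𝓝 f, ∀ u ∈ U, ∀ u' ∈ U, ContMDiff (𝓡 n) (𝓡 l) ∞ u →
      ContMDiff (𝓡 n) (𝓡 l) ∞ u' → I u = I u' := by
  classical
  choose V hV hIV using hI
  obtain ⟨s, χ, hχ, hcov⟩ := exists_bump_cover (n := n)
    (fun x => f ⁻¹' (interior (V (f x)) ∩ (extChartAt (𝓡 l) (f x)).source))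
    fun x => f.continuous.continuousAt.preimage_mem_nhds
      (Filter.inter_mem (interior_mem_nhds.2 (hV _)) (extChartAt_source_mem_nhds (f x)))
  -- Starting from `u`, produce a smooth `v` near `f` with the same value of `I` that agrees with
  -- `u'` wherever a bump function of `t` equals `1`. The alternative `u p = u' p` records that
  -- existing agreement is kept.
  have key : ∀ t : Finset M, ∀ W ∈ 𝓝 f, ∃ U ∈ 𝓝 f, ∀ u ∈ U, ∀ u' ∈ U,
      ContMDiff (𝓡 n) (𝓡 l) ∞ u → ContMDiff (𝓡 n) (𝓡 l) ∞ u' →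
      ∃ v ∈ W, ContMDiff (𝓡 n) (𝓡 l) ∞ v ∧ I v = I u ∧
        ∀ p, (u p = u' p ∨ ∃ i ∈ t, χ i p = 1) → v p = u' p := by
    intro t
    induction t using Finset.induction_on with
    | empty => exact fun W hW => ⟨W, hW, fun u hu u' _ hus _ =>
        ⟨u, hu, hus, rfl, fun p hp => hp.resolve_right fun ⟨i, hi, _⟩ => by simp at hi⟩⟩
    | insert a t _ ih =>
      intro W hW
      set K := tsupport (χ a)
      have hKc : IsClosed K := isClosed_tsupport _
      have hfK : MapsTo f K (extChartAt (𝓡 l) (f a)).source := fun p hp => ((hχ a).2.2 hp).2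
      let S : Set C(M, L) := {g | MapsTo g K (interior (V (f a)))}
      have hS : S ∈ 𝓝 f :=
        (ContinuousMap.isOpen_setOfPred_mapsTo hKc.isCompact isOpen_interior).mem_nhds
        fun p hp => ((hχ a).2.2 hp).1
      obtain ⟨U₁, hU₁, δ, hδ, hUd⟩ := exists_perturb_mem f (f a) hKc.isCompact hfK
        (Filter.inter_mem hW hS)
      set ψ := extChartAt (𝓡 l) (f a)
      -- Both `v` and `u'` will be `δ / 2`-close to `f` in the chart, hence less than `δ` apart.
      let U₂ : Set C(M, L) := {g | ∀ p ∈ K, g p ∈ ψ.source ∧ ‖ψ (g p) - ψ (f p)‖ < δ / 2}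
      have hU₂ : U₂ ∈ 𝓝 f := by
        refine hKc.isCompact.eventually_forall_of_forall_eventually fun p hp => ?_
        have c1 : Continuous fun a : C(M, L) × M => a.1 a.2 := continuous_eval
        have c2 : ContinuousAt (fun a : C(M, L) × M => ψ (a.1 a.2) - ψ (f a.2)) (f, p) :=
          (ContinuousAt.comp (f := fun a : C(M, L) × M => a.1 a.2)
            (continuousAt_extChartAt' (hfK hp)) c1.continuousAt).sub
            (ContinuousAt.comp (f := fun a : C(M, L) × M => f a.2)
            (continuousAt_extChartAt' (hfK hp)) (f.continuous.comp continuous_snd).continuousAt)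
        have c3 : ∀ᶠ a : C(M, L) × M in 𝓝 (f, p), a.1 a.2 ∈ ψ.source :=
          c1.continuousAt.preimage_mem_nhds ((isOpen_extChartAt_source (f a)).mem_nhds (hfK hp))
        have c4 := c2.norm.eventually (gt_mem_nhds (show ‖ψ (f p) - ψ (f p)‖ < δ / 2 by
          rw [sub_self, norm_zero]; exact half_pos hδ))
        exact c3.and c4
      obtain ⟨U₃, hU₃, ih⟩ := ih _ (Filter.inter_mem hU₁ (Filter.inter_mem hS hU₂))
      refine ⟨U₃ ∩ U₂, Filter.inter_mem hU₃ hU₂, fun u hu u' hu' hus hus' => ?_⟩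
      obtain ⟨v, ⟨hv1, hv2, hv3⟩, hvs, hvI, hvp⟩ := ih u hu.1 u' hu'.1 hus hus'
      obtain ⟨hvK, hd⟩ := hUd v hv1
      have hu'K : MapsTo u' K ψ.source := fun p hp => (hu'.2 p hp).1
      -- In the chart, `v` is moved by the fraction `χ` of the way to `u'`: fully where `χ = 1`, and
      -- not at all where the two already agree.
      set d : M → EuclideanSpace ℝ (Fin l) := fun p => χ a p • ψ (u' p) - χ a p • ψ (v p)
      have hd0 : ∀ p ∉ K, d p = 0 := fun p hp => by
        have h1 : χ a p = 0 := image_eq_zero_of_notMem_tsupport hp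
        simp only [d, h1, zero_smul, sub_zero]
      have hdδ : ∀ p, ‖d p‖ < δ := fun p => by
        by_cases hp : p ∈ K
        · have h1 := (hu'.2 p hp).2
          have h2 := (hv3 p hp).2
          have h3 := norm_sub_le_norm_sub_add_norm_sub (ψ (u' p)) (ψ (f p)) (ψ (v p))
          rw [norm_sub_rev (ψ (f p))] at h3
          simp only [d]
          rw [← smul_sub, norm_smul]
          calc ‖χ a p‖ * ‖ψ (u' p) - ψ (v p)‖ ≤ 1 * ‖ψ (u' p) - ψ (v p)‖ := by
                gcongr; exact (hχ a).2.1 p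
            _ < δ := by linarith
        · rw [hd0 p hp, norm_zero]; exact hδ
      obtain ⟨ht, v', ⟨hv'W, hv'S⟩, hv'⟩ := hd d ((continuous_smul_chart (hχ a).1.continuous
        u'.continuous hu'K).sub (continuous_smul_chart (hχ a).1.continuous v.continuous hvK))
        hd0 hdδ
      have hfun : (v' : M → L) = perturb (f a) K v d := funext hv'
      have hv's : ContMDiff (𝓡 n) (𝓡 l) ∞ v' := fun p => by
        rw [hfun]
        by_cases hp : p ∈ K
        · refine contMDiffAt_perturb hd0 v.continuous.continuousAt (hvK hp) (ht p hp) ?_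
          have h1 : ContMDiffAt (𝓡 n) 𝓘(ℝ, EuclideanSpace ℝ (Fin l)) ∞ (fun x => ψ (v x)) p :=
            (contMDiffAt_chart (f a) (hvK hp)).comp p (hvs p)
          have h2 : ContMDiffAt (𝓡 n) 𝓘(ℝ, EuclideanSpace ℝ (Fin l)) ∞ (fun x => ψ (u' x)) p :=
            (contMDiffAt_chart (f a) (hu'K hp)).comp p (hus' p)
          exact h1.add (((hχ a).1.contMDiffAt.smul h2).sub ((hχ a).1.contMDiffAt.smul h1))
        · exact (hvs p).congr_of_eventuallyEq (perturb_eventuallyEq hKc hp)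
      refine ⟨v', hv'W, hv's, ?_, fun p hp => ?_⟩
      · rw [← hvI]
        -- On `K` both maps take values in `V (f a)`, and off `K` they agree locally, so `I` does
        -- not notice the change.
        refine hIV (f a) v' v hv's hvs fun x => ?_
        by_cases hx : x ∈ K
        · exact Or.inr ⟨interior_subset (hv'S hx), interior_subset (hv2 hx)⟩
        · left
          rw [hfun]
          exact perturb_eventuallyEq hKc hx
      · rw [hv' p]
        by_cases hpK : p ∈ K
        · rw [perturb_of_mem_source hd0 (hvK hpK)]
          have h1 : ψ (v p) + d p = ψ (u' p) := by
            have h2 : v p = u' p ∨ χ a p = 1 := by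
              rcases hp with hp | ⟨i, hi, hip⟩
              · exact Or.inl (hvp p (Or.inl hp))
              · rcases Finset.mem_insert.1 hi with rfl | hi
                · exact Or.inr hip
                · exact Or.inl (hvp p (Or.inr ⟨i, hi, hip⟩))
            rcases h2 with h2 | h2
            · simp only [d, h2, sub_self, add_zero]
            · simp only [d, h2, one_smul]
              abel
          rw [h1]
          exact ψ.left_inv (hu'K hpK)
        · rw [perturb_of_notMem hpK]
          refine hvp p (hp.imp_right ?_)
          rintro ⟨i, hi, hip⟩
          rcases Finset.mem_insert.1 hi with rfl | hi
          · refine absurd (subset_tsupport _ ?_) hpK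
            rw [Function.mem_support, hip]
            exact one_ne_zero
          · exact ⟨i, hi, hip⟩
  obtain ⟨U, hU, h⟩ := key s univ Filter.univ_mem
  refine ⟨U, hU, fun u hu u' hu' hus hus' => ?_⟩
  obtain ⟨v, -, -, hvI, hvp⟩ := h u hu u' hu' hus hus'
  have : v = u' := ContinuousMap.ext fun p => hvp p (Or.inr (by
    obtain ⟨i, hi, hip⟩ := hcov p
    exact ⟨i, hi, hip.eq_of_nhds⟩))
  rw [← hvI, this]

/-- A functional on smooth maps that does not change under modifications inside small open sets of
the target is homotopy invariant. -/
lemma eq_of_homotopic_of_local {I : C(M, L) → ℝ}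
    (hI : ∀ q : L, ∃ V ∈ 𝓝 q, ∀ u u' : C(M, L), ContMDiff (𝓡 n) (𝓡 l) ∞ u →
      ContMDiff (𝓡 n) (𝓡 l) ∞ u' → (∀ x, u =ᶠ[𝓝 x] u' ∨ (u x ∈ V ∧ u' x ∈ V)) → I u = I u')
    {u u' : C(M, L)} (hu : ContMDiff (𝓡 n) (𝓡 l) ∞ u) (hu' : ContMDiff (𝓡 n) (𝓡 l) ∞ u')
    (h : u.Homotopic u') : I u = I u' := by
  choose U hU hUI using exists_nhds_eq_of_local (n := n) (l := l) hI
  choose w hw hws using fun f => exists_contMDiff_mem (n := n) (l := l) f (hU f)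
  obtain ⟨H⟩ := h
  -- Evaluating `I` on a smooth approximation `w f` extends it to all continuous maps. For `g` near
  -- `f`, a smooth map in both `U f` and `U g` links the values at `w f` and `w g`.
  have hloc : IsLocallyConstant fun f => I (w f) := by
    refine (IsLocallyConstant.iff_eventually_eq _).2 fun f => ?_
    filter_upwards [eventually_mem_nhds_iff.2 (hU f)] with g hg
    obtain ⟨v, ⟨hv1, hv2⟩, hvs⟩ := exists_contMDiff_mem (n := n) (l := l) g
      (Filter.inter_mem hg (hU g))
    rw [hUI g _ (hw g) _ hv2 (hws g) hvs, hUI f _ hv1 _ (hw f) hvs (hws f)]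
  have hpath := (hloc.comp_continuous H.curry.continuous).apply_eq_of_preconnectedSpace 0 1
  have h0 : H.curry 0 = u := ContinuousMap.ext fun p => H.apply_zero p
  have h1 : H.curry 1 = u' := ContinuousMap.ext fun p => H.apply_one p
  simp only [Function.comp, h0, h1] at hpath
  rw [hUI u _ (mem_of_mem_nhds (hU u)) _ (hw u) hu (hws u), hpath,
    hUI u' _ (hw u') _ (mem_of_mem_nhds (hU u')) (hws u') hu']

end Perturbation

/-! ### The energy inequality -/

/-! ### Homotopy invariance of the calibrated integral. -/

section HomotopyInvariance

variable {m k : ℕ} {M : Type*} [TopologicalSpace M]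
  [ChartedSpace (EuclideanSpace ℝ (Fin (m + k))) M] [IsManifold (𝓡 (m + k)) ∞ M]
  [T2Space M] [CompactSpace M]
  {L : Type*} [TopologicalSpace L] [T2Space L] [ChartedSpace (EuclideanSpace ℝ (Fin k)) L]
  [IsManifold (𝓡 k) ∞ L]

lemma pullbackForm_congr {n l p : ℕ} {M : Type*} [TopologicalSpace M]
    [ChartedSpace (EuclideanSpace ℝ (Fin n)) M]
    {L : Type*} [TopologicalSpace L] [ChartedSpace (EuclideanSpace ℝ (Fin l)) L]
    {u u' : M → L} {x : M} (h : u =ᶠ[𝓝 x] u') (φ : DForm l L p) :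
    (pullbackForm u φ : DForm n M p) x = (pullbackForm u' φ : DForm n M p) x := by
  ext v
  refine form_congr φ h.eq_of_nhds _ _ (funext fun i => ?_)
  have := h.mfderiv_eq (I := 𝓡 n) (I' := 𝓡 l)
  exact DFunLike.congr_fun (F := EuclideanSpace ℝ (Fin n) →L[ℝ] EuclideanSpace ℝ (Fin l)) this (v i)

lemma pullbackForm_eq_zero {n l p : ℕ} {M : Type*} [TopologicalSpace M]
    [ChartedSpace (EuclideanSpace ℝ (Fin n)) M]
    {L : Type*} [TopologicalSpace L] [ChartedSpace (EuclideanSpace ℝ (Fin l)) L]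
    {u : M → L} {x : M} {φ : DForm l L p} (h : φ (u x) = 0) :
    (pullbackForm u φ : DForm n M p) x = 0 := by
  unfold pullbackForm
  rw [h]
  rfl

/-- Take `η` with `dη = w` on a neighbourhood `V` of `q`. Passing from `w` to `w - dη` leaves the
integral unchanged by Stokes' theorem, and the new form vanishes on `V`, so changes of `u` within
`V` are invisible. -/
lemma exists_nhds_integral_wedge_pullback_eq (hk : 0 < k) (o : ManifoldOrientation (m + k) M)
    {α : DForm (m + k) M m} (hα : α ∈ closedForms (m + k) M m) {w : DForm k L k}
    (hw : IsSmoothForm w) (q : L) : ∃ V ∈ 𝓝 q, ∀ u u' : C(M, L),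
      ContMDiff (𝓡 (m + k)) (𝓡 k) ∞ u → ContMDiff (𝓡 (m + k)) (𝓡 k) ∞ u' →
      (∀ x, u =ᶠ[𝓝 x] u' ∨ (u x ∈ V ∧ u' x ∈ V)) →
      integral o (wedgeForm α (pullbackForm u w)) =
        integral o (wedgeForm α (pullbackForm u' w)) := by
  obtain ⟨k, rfl⟩ := Nat.exists_eq_succ_of_ne_zero hk.ne'
  obtain ⟨η, hη, hηw⟩ := exists_eventually_dForm_eq hw q
  have h1 : ∀ u : M → L, ContMDiff (𝓡 (m + (k + 1))) (𝓡 (k + 1)) ∞ u →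
      integral o (wedgeForm α (pullbackForm u w)) =
        integral o (wedgeForm α (pullbackForm u (w - dForm η))) := fun u hu => by
    have hd : dForm η ∈ exactForms (k + 1) L (k + 1) := ⟨η, hη, rfl⟩
    have hs := IsSmoothForm.sub hw hη.dForm
    have e : w = (w - dForm η) + dForm η := by abel
    conv_lhs => rw [e]
    rw [pullbackForm_add, wedgeForm_add_right,
      integral_add o (hα.1.wedge (hs.pullback hu)).isContinuousForm
        (hα.1.wedge (hη.dForm.pullback hu)).isContinuousForm,
      integral_wedgeForm_exact_right o hα (pullbackForm_mem_exactForms hu hd), add_zero]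
  refine ⟨_, hηw, fun u u' hu hu' h => ?_⟩
  rw [h1 u hu, h1 u' hu']
  congr 2
  funext x
  rcases h x with h | ⟨h, h'⟩
  · exact pullbackForm_congr h _
  · have h2 : (w - dForm η) (u x) = 0 := sub_eq_zero.2 (Eq.symm h)
    have h3 : (w - dForm η) (u' x) = 0 := sub_eq_zero.2 (Eq.symm h')
    rw [pullbackForm_eq_zero h2, pullbackForm_eq_zero h3]

/-- `∫_M α ∧ u^* w` is a homotopy invariant of `u`. -/
lemma integral_wedge_pullback_eq_of_homotopic (hk : 0 < k) (o : ManifoldOrientation (m + k) M)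
    {α : DForm (m + k) M m} (hα : α ∈ closedForms (m + k) M m) {w : DForm k L k}
    (hw : IsSmoothForm w) {u u' : C(M, L)} (hu : ContMDiff (𝓡 (m + k)) (𝓡 k) ∞ u)
    (hu' : ContMDiff (𝓡 (m + k)) (𝓡 k) ∞ u') (h : u.Homotopic u') :
    integral o (wedgeForm α (pullbackForm u w)) = integral o (wedgeForm α (pullbackForm u' w)) :=
  eq_of_homotopic_of_local (I := fun u => integral o (wedgeForm α (pullbackForm u w)))
    (exists_nhds_integral_wedge_pullback_eq hk o hα hw) hu hu' h

end HomotopyInvariance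

/-! ### Nonnegative multiples of the volume form. -/

section Positivity

open MeasureTheory

variable {n : ℕ} {M : Type*} [TopologicalSpace M] [ChartedSpace (EuclideanSpace ℝ (Fin n)) M]
  [IsManifold (𝓡 n) ∞ M] [T2Space M] [CompactSpace M]
  [RiemannianBundle (fun x : M => TangentSpace (𝓡 n) x)]

lemma chartIntegrand_smul_volForm (hn : 0 < n) (o : ManifoldOrientation n M) {φ : DForm n M n}
    {g : M → ℝ} (hg : ∀ x, φ x = g x • volForm o x) (i : M) (y : EuclideanSpace ℝ (Fin n)) :
    chartIntegrand o i (fun x => chartPartition n M i x • φ x) y =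
      chartPartition n M i ((extChartAt (𝓡 n) i).symm y) *
        (g ((extChartAt (𝓡 n) i).symm y) * √(gramMatrix (coordFrame i y)).det) := by
  rw [show φ = fun x => g x • volForm o x from funext hg, chartIntegrand_smul_fun,
    chartIntegrand_smul_fun, chartIntegrand_volForm hn]

lemma chartIntegrand_nonneg (hn : 0 < n) (o : ManifoldOrientation n M) {φ : DForm n M n}
    {g : M → ℝ} (hg : ∀ x, φ x = g x • volForm o x) (hg0 : ∀ x, 0 ≤ g x) (i : M)
    (y : EuclideanSpace ℝ (Fin n)) :
    0 ≤ chartIntegrand o i (fun x => chartPartition n M i x • φ x) y := by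
  rw [chartIntegrand_smul_volForm hn o hg]
  exact mul_nonneg ((chartPartition n M).nonneg i _) (mul_nonneg (hg0 _) (Real.sqrt_nonneg _))

lemma integral_nonneg (hn : 0 < n) (o : ManifoldOrientation n M) {φ : DForm n M n}
    {g : M → ℝ} (hg : ∀ x, φ x = g x • volForm o x) (hg0 : ∀ x, 0 ≤ g x) : 0 ≤ integral o φ := by
  rw [integral_eq_sum]
  exact Finset.sum_nonneg fun i _ =>
    MeasureTheory.integral_nonneg (chartIntegrand_nonneg hn o hg hg0 i)

/-- All chart contributions are nonnegative, so each is zero, and a continuous nonnegative integrand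
of zero integral vanishes. At `x`, use a chart whose partition function is nonzero there; the
density `√(det g)` is positive. -/
lemma eq_zero_of_integral_eq_zero (hn : 0 < n) (o : ManifoldOrientation n M) {φ : DForm n M n}
    (hφ : IsContinuousForm φ) {g : M → ℝ} (hg : ∀ x, φ x = g x • volForm o x) (hg0 : ∀ x, 0 ≤ g x)
    (h : integral o φ = 0) (x : M) : g x = 0 := by
  have hnn := chartIntegrand_nonneg hn o hg hg0
  obtain ⟨i, hi, hix⟩ : ∃ i ∈ chartIndices n M, chartPartition n M i x ≠ 0 := by
    by_contra! h'
    have := chartPartition_sum (n := n) x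
    rw [Finset.sum_eq_zero h'] at this
    exact zero_ne_one this
  have hxs : x ∈ (extChartAt (𝓡 n) i).source :=
    chartPartition_subordinate n M i (subset_tsupport _ hix)
  rw [integral_eq_sum, Finset.sum_eq_zero_iff_of_nonneg fun i _ =>
    MeasureTheory.integral_nonneg (hnn i)] at h
  have h1 := (setIntegral_eq_zero_iff_of_nonneg_ae (Eventually.of_forall (hnn i))
    (integrableOn_chartPartition o hφ i)).1 (h i hi)
  have hc := (hφ.smul_fun
    (chartPartition n M i).contMDiff.continuous).continuousOn_chartIntegrand o i
  have h2 := Measure.eqOn_open_of_ae_eq h1 (isOpen_extChartAt_target i) hc continuousOn_const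
    ((extChartAt (𝓡 n) i).map_source hxs)
  rw [chartIntegrand_smul_volForm hn o hg] at h2
  have h3 : √(gramMatrix (coordFrame i (extChartAt (𝓡 n) i x))).det ≠ 0 :=
    (Real.sqrt_pos.2 (det_gramMatrix_pos o i ((extChartAt (𝓡 n) i).map_source hxs))).ne'
  have h4 := (mul_eq_zero.1 h2).resolve_left (by rwa [(extChartAt (𝓡 n) i).left_inv hxs])
  have h5 := (mul_eq_zero.1 h4).resolve_right h3
  rwa [(extChartAt (𝓡 n) i).left_inv hxs] at h5

end Positivity

/-! ### The calibration inequality, pointwise and integrated. -/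

section Inequality

variable {m k : ℕ} {M : Type*} [TopologicalSpace M]
  [ChartedSpace (EuclideanSpace ℝ (Fin (m + k))) M]
  [RiemannianBundle (fun x : M => TangentSpace (𝓡 (m + k)) x)]
  {L : Type*} [TopologicalSpace L] [ChartedSpace (EuclideanSpace ℝ (Fin k)) L]
  [RiemannianBundle (fun x : L => TangentSpace (𝓡 k) x)]

/-- The pointwise calibration inequality. -/
lemma exists_wedgeForm_eq_smul_volForm (hk : k ≠ 0) (oM : ManifoldOrientation (m + k) M)
    (oL : ManifoldOrientation k L) {α : DForm (m + k) M m} (hα : IsCalibration α) (u : M → L)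
    (x : M) : ∃ c : ℝ, wedgeForm α (pullbackForm u (volForm oL)) x = c • volForm oM x ∧
      c ≤ (√k ^ k)⁻¹ * normDu (m + k) k u x ^ k ∧
      (c = (√k ^ k)⁻¹ * normDu (m + k) k u x ^ k → ∀ v w : TangentSpace (𝓡 (m + k)) x,
        inner ℝ (mfderiv (𝓡 (m + k)) (𝓡 k) u x v) (mfderiv (𝓡 (m + k)) (𝓡 k) u x w) =
          (k : ℝ)⁻¹ * normDu (m + k) k u x ^ 2 *
            inner ℝ (((mfderiv (𝓡 (m + k)) (𝓡 k) u x).ker)ᗮ.starProjection v)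
              (((mfderiv (𝓡 (m + k)) (𝓡 k) u x).ker)ᗮ.starProjection w)) := by
  obtain ⟨c, hc, hc1, hc2⟩ := calibrated_wedge hk (oM.orient x) (oL.orient (u x))
    (mfderiv (𝓡 (m + k)) (𝓡 k) u x) (α x) (hα x) (pullbackForm u (volForm oL) x) (fun v => rfl)
    (stdOrthonormalBasis ℝ (TangentSpace (𝓡 (m + k)) x))
  refine ⟨c, ?_, (le_abs_self c).trans hc1, hc2⟩
  ext v
  exact congrArg (fun t : TangentSpace (𝓡 (m + k)) x [⋀^Fin (m + k)]→ₗ[ℝ] ℝ => t v) hc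

variable [IsManifold (𝓡 (m + k)) ∞ M] [T2Space M] [CompactSpace M]
  [IsContMDiffRiemannianBundle (𝓡 (m + k)) ∞ (EuclideanSpace ℝ (Fin (m + k)))
    (fun x : M => TangentSpace (𝓡 (m + k)) x)]
  [IsManifold (𝓡 k) ∞ L]
  [IsContMDiffRiemannianBundle (𝓡 k) ∞ (EuclideanSpace ℝ (Fin k))
    (fun x : L => TangentSpace (𝓡 k) x)]

/-- The energy inequality and its equality case. -/
lemma integral_wedge_le_energy (hk : 0 < k) (oM : ManifoldOrientation (m + k) M)
    (oL : ManifoldOrientation k L) {α : DForm (m + k) M m} (hs : IsSmoothForm α)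
    (hα : IsCalibration α) {u : M → L} (hu : ContMDiff (𝓡 (m + k)) (𝓡 k) ∞ u) :
    integral oM (wedgeForm α (pullbackForm u (volForm oL))) ≤ energy k oM k u ∧
      (energy k oM k u = integral oM (wedgeForm α (pullbackForm u (volForm oL))) →
        IsSmithSubmersion oM oL α u) := by
  choose c hc hc1 hc2 using exists_wedgeForm_eq_smul_volForm hk.ne' oM oL hα u
  have hn : 0 < m + k := by omega
  set φ := wedgeForm α (pullbackForm u (volForm oL))
  set ψ : DForm (m + k) M (m + k) :=
    (√k ^ k)⁻¹ • fun x => normDu (m + k) k u x ^ k • volForm oM x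
  have hφ : IsContinuousForm φ :=
    (hs.wedge ((isSmoothForm_volForm hk oL).pullback hu)).isContinuousForm
  have hψ : IsContinuousForm ψ := (isContinuousForm_energy hn oM hu k).smul _
  have hE : energy k oM k u = integral oM ψ := (integral_smul oM _ _).symm
  -- The gap between energy density and calibrated form is a nonnegative multiple of the volume
  -- form; its integral decides both the inequality and the equality case.
  have hg : ∀ x, (ψ - φ) x =
      ((√k ^ k)⁻¹ * normDu (m + k) k u x ^ k - c x) • volForm oM x := fun x => by
    ext v
    have h1 : φ x v = c x * volForm oM x v := congrArg (fun t => t v) (hc x)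
    change (√k ^ k)⁻¹ * (normDu (m + k) k u x ^ k * volForm oM x v) - φ x v =
      ((√k ^ k)⁻¹ * normDu (m + k) k u x ^ k - c x) * volForm oM x v
    rw [h1]
    ring
  have hsub := integral_sub oM hψ hφ
  have hcont : IsContinuousForm (ψ - φ) := by
    have := hψ.add (hφ.smul (-1))
    rwa [neg_one_smul, ← sub_eq_add_neg] at this
  rw [hE]
  refine ⟨?_, fun h => ?_⟩
  · have := integral_nonneg hn oM hg fun x => sub_nonneg.2 (hc1 x)
    linarith
  · have h0 : ∀ x, c x = (√k ^ k)⁻¹ * normDu (m + k) k u x ^ k := fun x => by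
      have := eq_zero_of_integral_eq_zero hn oM hcont hg (fun x => sub_nonneg.2 (hc1 x))
        (by rw [hsub, h, sub_self]) x
      linarith
    exact ⟨hu, fun x => by rw [← h0 x]; exact hc x, fun x => hc2 x (h0 x)⟩

lemma IsSmithSubmersion.energy_eq {oM : ManifoldOrientation (m + k) M}
    {oL : ManifoldOrientation k L} {α : DForm (m + k) M m} {u : M → L}
    (h : IsSmithSubmersion oM oL α u) :
    energy k oM k u = integral oM (wedgeForm α (pullbackForm u (volForm oL))) := by
  unfold energy
  rw [← integral_smul]
  congr 1
  funext x
  rw [h.wedge_eq x, mul_smul]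
  rfl

end Inequality

/-! ### Smith submersions are critical points -/

section Variation

open MeasureTheory

/-- Differentiation under the integral sign: on the compact set `[-ε/2, ε/2] × K` the continuous
derivative is bounded by a constant, integrable since `K` has finite measure. -/
lemma exists_hasDerivAt_setIntegral {E : Type*} [TopologicalSpace E] [MeasurableSpace E]
    [OpensMeasurableSpace E] [T2Space E] [SecondCountableTopology E] {μ : Measure E}
    [IsFiniteMeasureOnCompacts μ] {K : Set E} (hK : IsCompact K) {ε : ℝ} (hε : 0 < ε)
    {G G' : ℝ → E → ℝ} (hG : ∀ t ∈ Ioo (-ε) ε, ContinuousOn (G t) K)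
    (hG' : ContinuousOn (fun p : ℝ × E => G' p.1 p.2) (Ioo (-ε) ε ×ˢ K))
    (hd : ∀ t ∈ Ioo (-ε) ε, ∀ y ∈ K, HasDerivAt (fun s => G s y) (G' t y) t) :
    ∃ D, HasDerivAt (fun t => ∫ y in K, G t y ∂μ) D 0 := by
  have hsub : Icc (-(ε / 2)) (ε / 2) ⊆ Ioo (-ε) ε := fun t ht =>
    ⟨by linarith [ht.1], by linarith [ht.2]⟩
  have h0 : (0 : ℝ) ∈ Ioo (-ε) ε := ⟨by linarith, hε⟩
  obtain ⟨C, hC⟩ :=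
    ((isCompact_Icc (a := -(ε / 2)) (b := ε / 2)).prod hK).exists_bound_of_continuousOn
    (hG'.mono (prod_mono hsub subset_rfl))
  have hms : MeasurableSet K := hK.measurableSet
  have hnhds : Icc (-(ε / 2)) (ε / 2) ∈ 𝓝 (0 : ℝ) := Icc_mem_nhds (by linarith) (by linarith)
  have hfin : IsFiniteMeasure (μ.restrict K) := ⟨by
    rw [Measure.restrict_apply_univ]; exact hK.measure_lt_top⟩
  refine ⟨_, (hasDerivAt_integral_of_dominated_loc_of_deriv_le (μ := μ.restrict K) (F := G)
    (F' := G') (bound := fun _ => C) hnhds ?_ ?_ ?_ ?_ (integrable_const C) ?_).2⟩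
  · filter_upwards [hnhds] with t ht
    exact (hG t (hsub ht)).aestronglyMeasurable hms
  · exact (hG 0 h0).integrableOn_compact hK
  · refine ContinuousOn.aestronglyMeasurable ?_ hms
    exact hG'.comp (Continuous.prodMk_right (0 : ℝ)).continuousOn fun y hy => ⟨h0, hy⟩
  · exact (ae_restrict_iff' hms).2 (Eventually.of_forall fun y hy t ht => hC (t, y) ⟨ht, hy⟩)
  · exact (ae_restrict_iff' hms).2 (Eventually.of_forall fun y hy t ht => hd t (hsub ht) y hy)

variable {n l : ℕ} {M : Type*} [TopologicalSpace M] [ChartedSpace (EuclideanSpace ℝ (Fin n)) M]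
  [IsManifold (𝓡 n) ∞ M] [T2Space M] [CompactSpace M]
  [RiemannianBundle (fun x : M => TangentSpace (𝓡 n) x)]
  [IsContMDiffRiemannianBundle (𝓡 n) ∞ (EuclideanSpace ℝ (Fin n))
    (fun x : M => TangentSpace (𝓡 n) x)]
  {L : Type*} [TopologicalSpace L] [ChartedSpace (EuclideanSpace ℝ (Fin l)) L]
  [IsManifold (𝓡 l) ∞ L]
  [RiemannianBundle (fun x : L => TangentSpace (𝓡 l) x)]
  [IsContMDiffRiemannianBundle (𝓡 l) ∞ (EuclideanSpace ℝ (Fin l))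
    (fun x : L => TangentSpace (𝓡 l) x)]

/-- The `k`-energy is differentiable along smooth variations, for `k ≥ 2`. -/
lemma exists_hasDerivAt_energy (hn : 0 < n) (o : ManifoldOrientation n M) {k : ℕ} (hk : 2 ≤ k)
    {ε : ℝ} (hε : 0 < ε) {F : ℝ → M → L}
    (hF : ContMDiffOn (𝓘(ℝ, ℝ).prod (𝓡 n)) (𝓡 l) ∞ (fun p : ℝ × M => F p.1 p.2)
      (Ioo (-ε) ε ×ˢ univ)) : ∃ D, HasDerivAt (fun t => energy l o k (F t)) D 0 := by
  have hk' : (1 : ℝ) ≤ (k : ℝ) / 2 := by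
    have : (2 : ℝ) ≤ k := by exact_mod_cast hk
    linarith
  have key : ∀ i : M, ∃ D, HasDerivAt (fun t => chartIntegral o i
      (fun x => chartPartition n M i x • (normDu n l (F t) x ^ k • volForm o x) : DForm n M n))
        D 0 := by
    intro i
    obtain ⟨S, hS, hSe⟩ := exists_contDiffOn_normDu_sq o isOpen_Ioo hF i
    set T := (extChartAt (𝓡 n) i).target
    have hTo : IsOpen T := isOpen_extChartAt_target i
    have hUT : IsOpen (Ioo (-ε) ε ×ˢ T) := isOpen_Ioo.prod hTo
    set K := extChartAt (𝓡 n) i '' tsupport (chartPartition n M i)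
    have hK : IsCompact K := isCompact_chart_image
      (isClosed_tsupport (chartPartition n M i)).isCompact (chartPartition_subordinate n M i)
    have hKT : K ⊆ T := chart_image_subset (chartPartition_subordinate n M i)
    let c : EuclideanSpace ℝ (Fin n) → ℝ := fun y =>
      chartPartition n M i ((extChartAt (𝓡 n) i).symm y) * √(gramMatrix (coordFrame i y)).det
    have hc : ContinuousOn c T :=
      ((chartPartition n M i).contMDiff.continuous.comp_continuousOn
        (continuousOn_extChartAt_symm i)).mul (contDiffOn_sqrt_det o i).continuousOn
    -- Writing `|du|^k = (|du|²)^(k/2)` uses the smooth function `|du|²`. The exponent is at least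
    -- `1`, so the power stays continuously differentiable even where `du = 0`.
    let G : ℝ → EuclideanSpace ℝ (Fin n) → ℝ := fun t y => S (t, y) ^ ((k : ℝ) / 2) * c y
    let S' : ℝ → EuclideanSpace ℝ (Fin n) → ℝ := fun t y => fderiv ℝ S (t, y) (1, 0)
    let G' : ℝ → EuclideanSpace ℝ (Fin n) → ℝ := fun t y =>
      S' t y * ((k : ℝ) / 2) * S (t, y) ^ ((k : ℝ) / 2 - 1) * c y
    have hG : ∀ t ∈ Ioo (-ε) ε, ContinuousOn (G t) K := fun t ht =>
      ((hS.continuousOn.comp (Continuous.prodMk_right t).continuousOn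
        fun y hy => ⟨ht, hKT hy⟩).rpow_const fun y _ => Or.inr (by linarith)).mul (hc.mono hKT)
    have hG' : ContinuousOn (fun p : ℝ × EuclideanSpace ℝ (Fin n) => G' p.1 p.2)
        (Ioo (-ε) ε ×ˢ K) := by
      have hsub : Ioo (-ε) ε ×ˢ K ⊆ Ioo (-ε) ε ×ˢ T := prod_mono subset_rfl hKT
      have h1 : ContinuousOn (fun p => fderiv ℝ S p (1, 0)) (Ioo (-ε) ε ×ˢ T) :=
        (hS.continuousOn_fderiv_of_isOpen hUT (by simp)).clm_apply continuousOn_const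
      have h2 : ContinuousOn (fun p : ℝ × EuclideanSpace ℝ (Fin n) => c p.2) (Ioo (-ε) ε ×ˢ T) :=
        hc.comp continuousOn_snd fun p hp => hp.2
      have h3 : ContinuousOn (fun p => S p ^ ((k : ℝ) / 2 - 1)) (Ioo (-ε) ε ×ˢ T) :=
        hS.continuousOn.rpow_const fun p _ => Or.inr (by linarith)
      exact (((h1.mul continuousOn_const).mul h3).mul h2).mono hsub
    have hd : ∀ t ∈ Ioo (-ε) ε, ∀ y ∈ K, HasDerivAt (fun s => G s y) (G' t y) t := by
      intro t ht y hy
      have h1 := ((hS.contDiffAt (hUT.mem_nhds (show (t, y) ∈ _ from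
        ⟨ht, hKT hy⟩))).differentiableAt (by simp)).hasFDerivAt
      have h2 : HasDerivAt (fun s : ℝ => (s, y)) ((1 : ℝ), (0 : EuclideanSpace ℝ (Fin n))) t :=
        (hasDerivAt_id t).prodMk (hasDerivAt_const t y)
      have h3 : HasDerivAt (fun s => S (s, y)) (S' t y) t := h1.comp_hasDerivAt t h2
      exact (h3.rpow_const (Or.inr hk')).mul_const (c y)
    obtain ⟨D, hD⟩ := exists_hasDerivAt_setIntegral (μ := volume) hK hε hG hG' hd
    refine ⟨D, hD.congr_of_eventuallyEq ?_⟩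
    filter_upwards [Ioo_mem_nhds (neg_lt_zero.2 hε) hε] with t ht
    unfold chartIntegral
    rw [setIntegral_eq_of_subset_of_forall_sdiff_eq_zero hTo.measurableSet hKT]
    · refine setIntegral_congr_fun hK.measurableSet fun y hy => ?_
      have hN : normDu n l (F t) ((extChartAt (𝓡 n) i).symm y) ^ k =
          S (t, y) ^ ((k : ℝ) / 2) := by
        rw [← hSe t ht y (hKT hy), ← Real.rpow_natCast _ 2, ← Real.rpow_mul (normDu_nonneg _ _),
          ← Real.rpow_natCast]
        congr 1
        push_cast
        ring
      simp only [G, c]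
      rw [chartIntegrand_smul_fun, chartIntegrand_smul_fun, chartIntegrand_volForm hn, hN]
      ring
    · rintro y ⟨hy, hyK⟩
      refine chartIntegrand_eq_zero o i ?_
      have h0 : chartPartition n M i ((extChartAt (𝓡 n) i).symm y) = 0 :=
        image_eq_zero_of_notMem_tsupport (symm_notMem_of_notMem_image hy hyK)
      exact smul_eq_zero_of_left h0 _
  choose D hD using key
  refine ⟨(√k ^ k)⁻¹ * ∑ i ∈ chartIndices n M, D i, ?_⟩
  have h := (HasDerivAt.fun_sum fun i (_ : i ∈ chartIndices n M) => hD i).const_mul (√k ^ k)⁻¹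
  refine h.congr_of_eventuallyEq (Eventually.of_forall fun t => ?_)
  simp only [energy]
  rw [integral_eq_sum]

end Variation

/-! ### Members of a smooth variation. -/

lemma contMDiff_of_contMDiffOn_prod {n l : ℕ} {M : Type*} [TopologicalSpace M]
    [ChartedSpace (EuclideanSpace ℝ (Fin n)) M]
    {L : Type*} [TopologicalSpace L] [ChartedSpace (EuclideanSpace ℝ (Fin l)) L]
    {U : Set ℝ} {F : ℝ → M → L} (hF : ContMDiffOn (𝓘(ℝ, ℝ).prod (𝓡 n)) (𝓡 l) ∞
      (fun p : ℝ × M => F p.1 p.2) (U ×ˢ univ)) {t : ℝ} (ht : t ∈ U) :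
    ContMDiff (𝓡 n) (𝓡 l) ∞ (F t) := by
  rw [← contMDiffOn_univ]
  exact hF.comp (f := fun x : M => (t, x)) (contMDiff_const.prodMk contMDiff_id).contMDiffOn
    fun x _ => ⟨ht, mem_univ _⟩

/-- The homotopy is `(s, x) ↦ F (s t) x`; the segment from `0` to `t` stays in `U` by
order-connectedness. -/
lemma homotopic_of_continuousOn {X Y : Type*} [TopologicalSpace X] [TopologicalSpace Y] {U : Set ℝ}
    (hU : U.OrdConnected) (h0 : (0 : ℝ) ∈ U) {F : ℝ → X → Y}
    (hF : ContinuousOn (fun p : ℝ × X => F p.1 p.2) (U ×ˢ univ)) {t : ℝ} (ht : t ∈ U)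
    {u u' : C(X, Y)} (hu : ∀ x, u x = F 0 x) (hu' : ∀ x, u' x = F t x) : u.Homotopic u' := by
  have hseg : ∀ s : unitInterval, (s : ℝ) * t ∈ U := fun s => by
    refine hU.uIcc_subset h0 ht ?_
    rw [mem_uIcc]
    rcases le_total 0 t with h | h
    · exact Or.inl ⟨mul_nonneg s.2.1 h, mul_le_of_le_one_left h s.2.2⟩
    · exact Or.inr ⟨by nlinarith [s.2.2], mul_nonpos_of_nonneg_of_nonpos s.2.1 h⟩
  exact ⟨{ toFun := fun p => F ((p.1 : ℝ) * t) p.2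
           continuous_toFun := hF.comp_continuous
             (f := fun p : unitInterval × X => ((p.1 : ℝ) * t, p.2)) (by fun_prop)
             fun p => ⟨hseg p.1, mem_univ _⟩
           map_zero_left := fun x => by simp [hu]
           map_one_left := fun x => by simp [hu'] }⟩

end SmithMaps

end

/-! ### The main theorem. -/

theorem mainTheorem3 {m k : ℕ} (hk : 2 ≤ k)
    {M : Type*} [TopologicalSpace M] [T2Space M] [CompactSpace M]
    [ChartedSpace (EuclideanSpace ℝ (Fin (m + k))) M] [IsManifold (𝓡 (m + k)) ∞ M]
    [RiemannianBundle (fun x : M => TangentSpace (𝓡 (m + k)) x)]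
    [IsContMDiffRiemannianBundle (𝓡 (m + k)) ∞ (EuclideanSpace ℝ (Fin (m + k)))
      (fun x : M => TangentSpace (𝓡 (m + k)) x)]
    (oM : SmithMaps.ManifoldOrientation (m + k) M)
    {L : Type*} [TopologicalSpace L] [T2Space L] [SecondCountableTopology L]
    [ChartedSpace (EuclideanSpace ℝ (Fin k)) L] [IsManifold (𝓡 k) ∞ L]
    [RiemannianBundle (fun x : L => TangentSpace (𝓡 k) x)]
    [IsContMDiffRiemannianBundle (𝓡 k) ∞ (EuclideanSpace ℝ (Fin k))
      (fun x : L => TangentSpace (𝓡 k) x)]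
    (oL : SmithMaps.ManifoldOrientation k L)
    (α : SmithMaps.DForm (m + k) M m) (hα : SmithMaps.IsSmoothForm α)
    (hclosed : SmithMaps.dForm α = 0) (hcal : SmithMaps.IsCalibration α) :
    (∀ u : C^∞⟮𝓡 (m + k), M; 𝓡 k, L⟯,
      SmithMaps.topologicalEnergy oM oL α u =
        SmithMaps.integral oM
          (SmithMaps.wedgeForm α (SmithMaps.pullbackForm u (SmithMaps.volForm oL))) ∧
      SmithMaps.topologicalEnergy oM oL α u ≤ SmithMaps.energy k oM k u ∧
      (SmithMaps.energy k oM k u = SmithMaps.topologicalEnergy oM oL α u ↔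
        SmithMaps.IsSmithSubmersion oM oL α u)) ∧
    (∀ u u' : C^∞⟮𝓡 (m + k), M; 𝓡 k, L⟯, (u : C(M, L)).Homotopic u' →
      SmithMaps.topologicalEnergy oM oL α u = SmithMaps.topologicalEnergy oM oL α u') ∧
    (∀ u : C^∞⟮𝓡 (m + k), M; 𝓡 k, L⟯, SmithMaps.IsSmithSubmersion oM oL α u →
      (∀ u' : C^∞⟮𝓡 (m + k), M; 𝓡 k, L⟯, (u : C(M, L)).Homotopic u' →
        SmithMaps.energy k oM k u ≤ SmithMaps.energy k oM k u') ∧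
      SmithMaps.IsKHarmonic k oM k u) := by
  have hk0 : 0 < k := by omega
  have hcl : α ∈ SmithMaps.closedForms (m + k) M m := ⟨hα, hclosed⟩
  have htop : ∀ u : C(M, L), ContMDiff (𝓡 (m + k)) (𝓡 k) ∞ u →
      SmithMaps.topologicalEnergy oM oL α u = SmithMaps.integral oM
        (SmithMaps.wedgeForm α (SmithMaps.pullbackForm u (SmithMaps.volForm oL))) := fun u hu =>
    SmithMaps.topologicalEnergy_eq hk0 oM oL hcl hu
  have hvol := SmithMaps.isSmoothForm_volForm hk0 oL
  have hle : ∀ u : C(M, L), ContMDiff (𝓡 (m + k)) (𝓡 k) ∞ u →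
      SmithMaps.topologicalEnergy oM oL α u ≤ SmithMaps.energy k oM k u := fun u hu => by
    rw [htop u hu]
    exact (SmithMaps.integral_wedge_le_energy hk0 oM oL hα hcal hu).1
  have hhom : ∀ u u' : C(M, L), ContMDiff (𝓡 (m + k)) (𝓡 k) ∞ u →
      ContMDiff (𝓡 (m + k)) (𝓡 k) ∞ u' → u.Homotopic u' →
      SmithMaps.topologicalEnergy oM oL α u = SmithMaps.topologicalEnergy oM oL α u' :=
    fun u u' hu hu' h => by
      rw [htop u hu, htop u' hu']
      exact SmithMaps.integral_wedge_pullback_eq_of_homotopic hk0 oM hcl hvol hu hu' h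
  have heq : ∀ u : C(M, L), SmithMaps.IsSmithSubmersion oM oL α u →
      SmithMaps.energy k oM k u = SmithMaps.topologicalEnergy oM oL α u := fun u hu => by
    rw [htop u hu.contMDiff, hu.energy_eq]
  refine ⟨fun u => ⟨htop u u.contMDiff, hle u u.contMDiff, fun h => ?_, heq u⟩,
    fun u u' h => hhom u u' u.contMDiff u'.contMDiff h, fun u hu => ⟨fun u' h => ?_, ?_⟩⟩
  · refine (SmithMaps.integral_wedge_le_energy hk0 oM oL hα hcal u.contMDiff).2 ?_
    exact h.trans (htop u u.contMDiff)
  · refine ((heq u hu).trans (hhom u u' u.contMDiff u'.contMDiff h)).le.trans ?_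
    exact hle u' u'.contMDiff
  · intro ε hε F hF hF0
    obtain ⟨D, hD⟩ := SmithMaps.exists_hasDerivAt_energy (by omega) oM hk hε hF
    -- Every `F t` is homotopic to `u`, so its energy is at least the common topological bound,
    -- which `u` attains. Together with differentiability this forces the derivative to be zero.
    have hmin : IsLocalMin (fun t => SmithMaps.energy k oM k (F t)) 0 := by
      filter_upwards [Ioo_mem_nhds (neg_lt_zero.2 hε) hε] with t ht
      have hs := SmithMaps.contMDiff_of_contMDiffOn_prod hF ht
      let v : C(M, L) := ⟨F t, hs.continuous⟩
      have h := SmithMaps.homotopic_of_continuousOn ordConnected_Ioo ⟨neg_lt_zero.2 hε, hε⟩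
        hF.continuousOn ht (u := (u : C(M, L))) (u' := v) (fun x => (congrFun hF0 x).symm)
        fun x => rfl
      rw [hF0]
      exact ((heq u hu).trans (hhom u v u.contMDiff hs h)).le.trans (hle v hs)
    rwa [hmin.hasDerivAt_eq_zero hD] at hD
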